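/- **Setting.** Let $L$ be an even lattice of signature $(b,2)$, $b>0$, with integral quadratic form $q$ and bilinear form $(x,y)=q(x+y)-q(x)-q(y)$. Put $V=L\otimes\mathbb R$, let $L'$ be the dual lattice and $D_L=L'/L$ the discriminant group. Fix an orthogonal basis $(e_j)_{1\le j\le b+2}$ of $V$ with $(e_j,e_j)=1$ for $j\le b$ and $(e_j,e_j)=-1$ for $j=b+1,b+2$, let $g_0\colon V\to\mathbb R^{b,2}$ be the coordinate isometry and let $z_0=\langle e_{b+1},e_{b+2}\rangle$. Put $G=\mathrm{SO}(V)$ and $e(t)=\exp(2\pi i t)$. Pairs $x=(x_1,x_2)$ of vectors are row vectors, on which $2\times 2$ matrices act from the right; $(x,x')$ is the matrix $((x_i,x_j'))_{i,j}$, and $q(x)=\frac12(x,x)$. Elements of $(\mathbb R^{b,2})^2$ are $(b+2)\times2$ matrices; $x^+$ consists of the first $b$ rows and $x^-$ of the last two. **Very homogeneous polynomials.** A polynomial $P\colon(\mathbb R^{b,2})^2\to\mathbb C$ is very homogeneous of degree $(m^+,m^-)$, $m^\pm\in\mathbb Z_{\ge0}$, if $P(x)=P_b(x^+)P_2(x^-)$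 for polynomials with $P_b(x^+N)=(\det N)^{m^+}P_b(x^+)$ and $P_2(x^-N)=(\det N)^{m^-}P_2(x^-)$ for all $N\in\mathbb C^{2\times2}$. **Theta function.** For $\tau=x+iy$ in the Siegel upper half space $\mathbb H_2$, $\alpha,\beta\in V^2$, $g\in G$ and $\delta\in D_L^2$, put $z=g^{-1}(z_0)$ and $$\Theta^{\delta}_{L,2}(\tau,\alpha,\beta,g,P)=(\det y)^{1+m^-}\sum_{\lambda\in L^2+\delta}\exp\!\Big(-\tfrac1{8\pi}\mathrm{tr}(\Delta y^{-1})\Big)(P)\big(g_0(g(\lambda+\beta))\big)\, e\Big(\mathrm{tr}\,q((\lambda+\beta)_{z^\perp})\tau+\mathrm{tr}\,q((\lambda+\beta)_{z})\bar\tau-\mathrm{tr}(\lambda+\tfrac{\beta}{2},\alpha)\Big),$$ where $\Delta=\big(\sum_{i=1}^{b+2}\partial^2/\partial x_{i,j}\partial x_{i,k}\big)_{1\le j,k\le 2}$ and the subscripts $z$, $z^\perp$ denote orthogonal projections. Let $\Theta_{L,2}=\sum_{\delta\in D_L^2}\Theta^\delta_{L,2}\,\mathfrak e_\delta\in\mathbb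 C[D_L^2]$. **Metaplectic group and Weil representation.** $\mathrm{Mp}_4(\mathbb Z)$ is the group of pairs $(M,\varphi)$ with $M=\begin{pmatrix}A&B\\C&D\end{pmatrix}\in\mathrm{Sp}_4(\mathbb Z)$ and $\varphi$ a holomorphic square root of $\tau\mapsto\det(C\tau+D)$ on $\mathbb H_2$, with product $(M,\varphi)(N,\psi)=(MN,\varphi(N\cdot\tau)\psi(\tau))$, where $M\cdot\tau=(A\tau+B)(C\tau+D)^{-1}$. For $\gamma=(M,\varphi)$ and $k\in\frac12\mathbb Z$ write $\det(C\tau+D)^k=\varphi(\tau)^{2k}$. The Weil representation $\rho_{L,2}$ is the representation of $\mathrm{Mp}_4(\mathbb Z)$ on $\mathbb C[D_L^2]$ with $$\rho_{L,2}\Big(\begin{pmatrix}A&0\\0&A^{-t}\end{pmatrix},\det(A)^{1/2}\Big)\mathfrak e_\delta=\det(A)^{(2-b)/2}\,\mathfrak e_{\delta A^{-1}}\qquad(A\in\mathrm{GL}_2(\mathbb Z)),$$ $$\rho_{L,2}\Big(\begin{pmatrix}1&B\\0&1\end{pmatrix},1\Big)\mathfrak e_\delta=e(\mathrm{tr}\,q(\delta)B)\,\mathfrak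 e_\delta\qquad(B=B^t\in\mathbb Z^{2\times2}),$$ $$\rho_{L,2}\Big(\begin{pmatrix}0&-1\\1&0\end{pmatrix},(\det\tau)^{1/2}\Big)\mathfrak e_\delta=\frac{i^{2-b}}{|D_L|}\sum_{\delta'\in D_L^2}e(-\mathrm{tr}(\delta',\delta))\,\mathfrak e_{\delta'}.$$ Here $\det(A)^{1/2}$ and $\det(A)^{(2-b)/2}$ are principal values, and $(\det\tau)^{1/2}$ is the holomorphic square root on $\mathbb H_2$ with value $i$ at $\tau=iI_2$. **Theorem.** There is exactly one representation $\rho_{L,2}$ with these three properties. Let $P$ be very homogeneous of degree $(m^+,m^-)$ and let $\alpha,\beta\in V^2$, $g\in G$. The series defining $\Theta_{L,2}$ converge absolutely for every $\tau\in\mathbb H_2$, and for every $\gamma=\Big(\begin{pmatrix}A&B\\C&D\end{pmatrix},\varphi\Big)\in\mathrm{Mp}_4(\mathbb Z)$ and $\tau\in\mathbb H_2$ $$\Theta_{L,2}\big(\gamma\cdot\tau,\ \alpha A^t+\beta B^t,\ \alpha C^t+\beta D^t,\ g,\ P\big)=\det(C\tau+D)^{\,b/2-1+m^+-m^-}\ \rho_{L,2}(\gamma)\,\Theta_{L,2}(\tau,\alpha,\beta,g,P).$$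 -/

import Mathlib

open scoped TensorProduct Matrix

namespace SiegelTheta

open scoped ComplexOrder

noncomputable section

/-- The function `e(t) = exp(2πit)`. -/
def expi (t : ℂ) : ℂ := Complex.exp (2 * Real.pi * Complex.I * t)

/-- An integral `2 × 2` matrix, viewed over `ℂ`. -/
def toC (A : Matrix (Fin 2) (Fin 2) ℤ) : Matrix (Fin 2) (Fin 2) ℂ := A.map (fun n : ℤ => (n : ℂ))

/-- The imaginary part of a complex matrix, entry by entry. -/
def imPart (τ : Matrix (Fin 2) (Fin 2) ℂ) : Matrix (Fin 2) (Fin 2) ℝ := τ.map Complex.im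

/-- The Siegel upper half space of genus 2. -/
def HH2 : Type :=
  {τ : Matrix (Fin 2) (Fin 2) ℂ // τᵀ = τ ∧ (imPart τ).PosDef}

instance : TopologicalSpace HH2 :=
  inferInstanceAs (TopologicalSpace {τ : Matrix (Fin 2) (Fin 2) ℂ // τᵀ = τ ∧ (imPart τ).PosDef})

/-- The group `Sp₄(ℤ)`. -/
abbrev Sp4Z : Type := Matrix.symplecticGroup (Fin 2) ℤ

/-- The blocks of `M = (A B; C D)`. -/
def blkA (M : Sp4Z) : Matrix (Fin 2) (Fin 2) ℤ := M.1.toBlocks₁₁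
def blkB (M : Sp4Z) : Matrix (Fin 2) (Fin 2) ℤ := M.1.toBlocks₁₂
def blkC (M : Sp4Z) : Matrix (Fin 2) (Fin 2) ℤ := M.1.toBlocks₂₁
def blkD (M : Sp4Z) : Matrix (Fin 2) (Fin 2) ℤ := M.1.toBlocks₂₂

/-- `Aτ + B`. -/
def num (M : Sp4Z) (τ : HH2) : Matrix (Fin 2) (Fin 2) ℂ := toC (blkA M) * τ.1 + toC (blkB M)

/-- `Cτ + D`. -/
def den (M : Sp4Z) (τ : HH2) : Matrix (Fin 2) (Fin 2) ℂ := toC (blkC M) * τ.1 + toC (blkD M)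

theorem toC_mul (A B : Matrix (Fin 2) (Fin 2) ℤ) : toC (A * B) = toC A * toC B := by
  ext i j; simp [toC, Matrix.mul_apply]

theorem toC_add (A B : Matrix (Fin 2) (Fin 2) ℤ) : toC (A + B) = toC A + toC B := by
  ext i j; simp [toC]

theorem toC_neg (A : Matrix (Fin 2) (Fin 2) ℤ) : toC (-A) = -toC A := by
  ext i j; simp [toC]

theorem toC_one : toC 1 = 1 := by
  ext i j; simp [toC, Matrix.one_apply]

theorem toC_zero : toC 0 = 0 := by
  ext i j; simp [toC]

theorem toC_transpose (A : Matrix (Fin 2) (Fin 2) ℤ) : toC Aᵀ = (toC A)ᵀ := rfl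

theorem toC_conjTranspose (A : Matrix (Fin 2) (Fin 2) ℤ) : (toC A)ᴴ = (toC A)ᵀ := by
  ext i j; simp [toC]

theorem toC_det (A : Matrix (Fin 2) (Fin 2) ℤ) : (toC A).det = (A.det : ℂ) := by
  simp [toC, Matrix.det_fin_two]

theorem blk_eq (M : Sp4Z) : Matrix.fromBlocks (blkA M) (blkB M) (blkC M) (blkD M) = M.1 :=
  Matrix.fromBlocks_toBlocks M.1

theorem blk_rel (M : Sp4Z) :
    (toC (blkA M))ᵀ * toC (blkC M) = (toC (blkC M))ᵀ * toC (blkA M) ∧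
    (toC (blkB M))ᵀ * toC (blkD M) = (toC (blkD M))ᵀ * toC (blkB M) ∧
    (toC (blkA M))ᵀ * toC (blkD M) = 1 + (toC (blkC M))ᵀ * toC (blkB M) ∧
    (toC (blkD M))ᵀ * toC (blkA M) = 1 + (toC (blkB M))ᵀ * toC (blkC M) := by
  have h := M.2
  rw [← blk_eq M, SymplecticGroup.fromBlocks_mem_iff] at h
  obtain ⟨h1, h2, h3⟩ := h
  have h3' := congrArg toC (sub_eq_iff_eq_add.1 h3)
  have h4' := congrArg Matrix.transpose h3'
  have h1' := congrArg toC h1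
  have h2' := congrArg toC h2
  simp only [toC_mul, toC_add, toC_one, toC_transpose, Matrix.transpose_mul, Matrix.transpose_add,
    Matrix.transpose_one, Matrix.transpose_transpose] at h1' h2' h3' h4'
  exact ⟨h1', h2', h3', h4'⟩

/-- The imaginary part, viewed over `ℂ`. -/
def imC (τ : Matrix (Fin 2) (Fin 2) ℂ) : Matrix (Fin 2) (Fin 2) ℂ :=
  (imPart τ).map (fun r : ℝ => (r : ℂ))

theorem two_I_imC (τ : Matrix (Fin 2) (Fin 2) ℂ) (h : τᵀ = τ) :
    (2 * Complex.I) • imC τ = τ - τᴴ := by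
  have hs : ∀ i j, τ j i = τ i j := fun i j => congrFun (congrFun h i) j
  ext i j
  simp only [imC, imPart, Matrix.smul_apply, Matrix.map_apply, Matrix.sub_apply,
    Matrix.conjTranspose_apply, hs i j, smul_eq_mul]
  apply Complex.ext <;> simp
  ring

theorem posDef_imC_iff (τ : Matrix (Fin 2) (Fin 2) ℂ) :
    (imC τ).PosDef ↔ (imPart τ).PosDef := by
  constructor
  · intro h
    refine Matrix.PosDef.of_dotProduct_mulVec_pos ?_ ?_
    · ext i j
      have := congrFun (congrFun h.isHermitian i) j
      simpa [imC] using this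
    · intro x hx
      have hx' : (fun i => (x i : ℂ)) ≠ 0 := by
        intro h0
        exact hx (funext fun i => by simpa using congrFun h0 i)
      have := h.dotProduct_mulVec_pos hx'
      have h2 : (star (fun i => (x i : ℂ))) ⬝ᵥ (imC τ *ᵥ fun i => (x i : ℂ)) =
          ((star x ⬝ᵥ (imPart τ *ᵥ x) : ℝ) : ℂ) := by
        simp [dotProduct, Matrix.mulVec, imC, Fin.sum_univ_two]
      rw [h2] at this
      exact_mod_cast this
  · intro h
    have hs : imPart τ 1 0 = imPart τ 0 1 := by
      simpa using congrFun (congrFun h.isHermitian 0) 1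
    refine Matrix.PosDef.of_dotProduct_mulVec_pos ?_ ?_
    · ext i j
      have := congrFun (congrFun h.isHermitian i) j
      simp only [Matrix.conjTranspose_apply, star_trivial] at this
      simp [imC, this]
    · intro x hx
      have h2 : (star x) ⬝ᵥ (imC τ *ᵥ x) =
          ((star (fun i => (x i).re) ⬝ᵥ (imPart τ *ᵥ fun i => (x i).re) +
            star (fun i => (x i).im) ⬝ᵥ (imPart τ *ᵥ fun i => (x i).im) : ℝ) : ℂ) := by
        apply Complex.ext
        · simp [dotProduct, Matrix.mulVec, imC, Fin.sum_univ_two, hs]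
          ring
        · simp [dotProduct, Matrix.mulVec, imC, Fin.sum_univ_two, hs]
          ring
      rw [h2]
      have hr := h.posSemidef.dotProduct_mulVec_nonneg (fun i => (x i).re)
      have hi := h.posSemidef.dotProduct_mulVec_nonneg (fun i => (x i).im)
      have : 0 < star (fun i => (x i).re) ⬝ᵥ (imPart τ *ᵥ fun i => (x i).re) +
            star (fun i => (x i).im) ⬝ᵥ (imPart τ *ᵥ fun i => (x i).im) := by
        by_cases hre : (fun i => (x i).re) = 0
        · have him : (fun i => (x i).im) ≠ 0 := by
            intro h0
            exact hx (funext fun i => Complex.ext (congrFun hre i) (congrFun h0 i))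
          exact add_pos_of_nonneg_of_pos hr (h.dotProduct_mulVec_pos him)
        · exact add_pos_of_pos_of_nonneg (h.dotProduct_mulVec_pos hre) hi
      exact_mod_cast this

theorem den_num (M : Sp4Z) (τ : HH2) :
    (den M τ)ᴴ * num M τ - (num M τ)ᴴ * den M τ = (2 * Complex.I) • imC τ.1 := by
  obtain ⟨h1, h2, h3, h4⟩ := blk_rel M
  rw [two_I_imC _ τ.2.1]
  simp only [num, den, Matrix.conjTranspose_add, Matrix.conjTranspose_mul, toC_conjTranspose,
    Matrix.add_mul, Matrix.mul_add, Matrix.mul_assoc]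
  simp only [← Matrix.mul_assoc (toC _)ᵀ, h1, h2, h3, h4]
  simp only [Matrix.add_mul, Matrix.mul_add, Matrix.mul_assoc, Matrix.one_mul, Matrix.mul_one]
  abel

theorem den_num_transpose (M : Sp4Z) (τ : HH2) :
    (den M τ)ᵀ * num M τ = (num M τ)ᵀ * den M τ := by
  obtain ⟨h1, h2, h3, h4⟩ := blk_rel M
  have hs := τ.2.1
  simp only [num, den, Matrix.transpose_add, Matrix.transpose_mul,
    Matrix.add_mul, Matrix.mul_add, Matrix.mul_assoc, hs]
  simp only [← Matrix.mul_assoc (toC _)ᵀ, h1, h2, h3, h4]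
  simp only [Matrix.add_mul, Matrix.mul_add, Matrix.mul_assoc, Matrix.one_mul, Matrix.mul_one]
  abel

theorem den_det_ne_zero (M : Sp4Z) (τ : HH2) : (den M τ).det ≠ 0 := by
  intro h
  obtain ⟨v, hv, h0⟩ := Matrix.exists_mulVec_eq_zero_iff.2 h
  have hp := ((posDef_imC_iff τ.1).2 τ.2.2).dotProduct_mulVec_pos hv
  have h1 : star v ⬝ᵥ (((2 * Complex.I) • imC τ.1) *ᵥ v) = 0 := by
    rw [← den_num M τ, Matrix.sub_mulVec, dotProduct_sub, ← Matrix.mulVec_mulVec,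
      ← Matrix.mulVec_mulVec, h0, Matrix.mulVec_zero, dotProduct_zero, sub_zero,
      Matrix.dotProduct_mulVec, ← Matrix.star_mulVec, h0]
    simp
  rw [Matrix.smul_mulVec, dotProduct_smul, smul_eq_mul] at h1
  rcases mul_eq_zero.1 h1 with h2 | h2
  · simp at h2
  · exact hp.ne' h2

theorem act_mem (M : Sp4Z) (τ : HH2) :
    (num M τ * (den M τ)⁻¹)ᵀ = num M τ * (den M τ)⁻¹ ∧
      (imPart (num M τ * (den M τ)⁻¹)).PosDef := by
  have hd : IsUnit (den M τ).det := (den_det_ne_zero M τ).isUnit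
  have hdt : IsUnit ((den M τ)ᵀ).det := by rwa [Matrix.det_transpose]
  have hdh : IsUnit ((den M τ)ᴴ).det := by
    rw [Matrix.det_conjTranspose]; exact hd.star
  have hsym : (num M τ * (den M τ)⁻¹)ᵀ = num M τ * (den M τ)⁻¹ := by
    rw [Matrix.transpose_mul, Matrix.transpose_nonsing_inv]
    calc ((den M τ)ᵀ)⁻¹ * (num M τ)ᵀ
        = ((den M τ)ᵀ)⁻¹ * ((num M τ)ᵀ * den M τ) * (den M τ)⁻¹ := by
          rw [Matrix.mul_assoc, Matrix.mul_assoc, Matrix.mul_nonsing_inv _ hd, Matrix.mul_one]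
      _ = num M τ * (den M τ)⁻¹ := by
          rw [← den_num_transpose, ← Matrix.mul_assoc, Matrix.nonsing_inv_mul _ hdt,
            Matrix.one_mul]
  refine ⟨hsym, ?_⟩
  rw [← posDef_imC_iff]
  have key : imC (num M τ * (den M τ)⁻¹) = ((den M τ)⁻¹)ᴴ * imC τ.1 * (den M τ)⁻¹ := by
    have h2 : (2 * Complex.I) ≠ 0 := by simp
    apply smul_right_injective _ h2
    simp only
    rw [two_I_imC _ hsym, ← Matrix.smul_mul, ← Matrix.mul_smul, ← den_num M τ]
    rw [Matrix.conjTranspose_mul, Matrix.mul_sub, Matrix.sub_mul, Matrix.conjTranspose_nonsing_inv]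
    rw [← Matrix.mul_assoc _ ((den M τ)ᴴ), Matrix.nonsing_inv_mul _ hdh, Matrix.one_mul]
    rw [← Matrix.mul_assoc _ ((num M τ)ᴴ), Matrix.mul_assoc _ (den M τ),
      Matrix.mul_nonsing_inv _ hd, Matrix.mul_one]
  rw [key]
  apply Matrix.PosDef.conjTranspose_mul_mul_same ((posDef_imC_iff τ.1).2 τ.2.2)
  intro x y hxy
  have := congrArg (fun v => (den M τ) *ᵥ v) hxy
  simpa only [Matrix.mulVec_mulVec, Matrix.mul_nonsing_inv _ hd, Matrix.one_mulVec] using this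

/-- The action `M · τ = (Aτ + B)(Cτ + D)⁻¹` of `Sp₄(ℤ)` on the Siegel upper half space. -/
def act (M : Sp4Z) (τ : HH2) : HH2 := ⟨num M τ * (den M τ)⁻¹, act_mem M τ⟩

theorem num_eq (M : Sp4Z) (τ : HH2) : (act M τ).1 * den M τ = num M τ := by
  simp only [act]
  rw [Matrix.mul_assoc, Matrix.nonsing_inv_mul _ (den_det_ne_zero M τ).isUnit, Matrix.mul_one]

theorem blk_mul (M N : Sp4Z) :
    blkA (M * N) = blkA M * blkA N + blkB M * blkC N ∧
    blkB (M * N) = blkA M * blkB N + blkB M * blkD N ∧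
    blkC (M * N) = blkC M * blkA N + blkD M * blkC N ∧
    blkD (M * N) = blkC M * blkB N + blkD M * blkD N := by
  have h : (M * N).1 = M.1 * N.1 := rfl
  rw [← blk_eq M, ← blk_eq N, ← blk_eq (M * N), Matrix.fromBlocks_multiply] at h
  exact Matrix.fromBlocks_inj.1 h

theorem den_mul (M N : Sp4Z) (τ : HH2) : den (M * N) τ = den M (act N τ) * den N τ := by
  obtain ⟨-, -, h3, h4⟩ := blk_mul M N
  have hn := num_eq N τ
  simp only [den] at hn ⊢
  rw [h3, h4, Matrix.add_mul, Matrix.mul_assoc (toC (blkC M)), hn]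
  simp only [num, toC_add, toC_mul, Matrix.add_mul, Matrix.mul_add, Matrix.mul_assoc]
  abel

theorem num_mul (M N : Sp4Z) (τ : HH2) : num (M * N) τ = num M (act N τ) * den N τ := by
  obtain ⟨h1, h2, -, -⟩ := blk_mul M N
  have hn := num_eq N τ
  simp only [den, num] at hn ⊢
  rw [h1, h2, Matrix.add_mul (toC (blkA M) * _), Matrix.mul_assoc (toC (blkA M)), hn]
  simp only [toC_add, toC_mul, Matrix.add_mul, Matrix.mul_add, Matrix.mul_assoc]
  abel

theorem act_mul (M N : Sp4Z) (τ : HH2) : act (M * N) τ = act M (act N τ) := by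
  apply Subtype.ext
  have hd := (den_det_ne_zero N τ).isUnit
  change num (M * N) τ * (den (M * N) τ)⁻¹ = num M (act N τ) * (den M (act N τ))⁻¹
  rw [den_mul, num_mul, Matrix.mul_inv_rev, Matrix.mul_assoc, ← Matrix.mul_assoc (den N τ),
    Matrix.mul_nonsing_inv _ hd, Matrix.one_mul]

theorem den_one (τ : HH2) : den 1 τ = 1 := by
  have h := blk_eq 1
  have h' : ((1 : Sp4Z)).1 = Matrix.fromBlocks 1 0 0 1 := Matrix.fromBlocks_one.symm
  rw [h'] at h
  obtain ⟨-, -, h3, h4⟩ := Matrix.fromBlocks_inj.1 h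
  simp [den, h3, h4, toC_one, toC_zero]

theorem num_one (τ : HH2) : num 1 τ = τ.1 := by
  have h := blk_eq 1
  have h' : ((1 : Sp4Z)).1 = Matrix.fromBlocks 1 0 0 1 := Matrix.fromBlocks_one.symm
  rw [h'] at h
  obtain ⟨h3, h4, -, -⟩ := Matrix.fromBlocks_inj.1 h
  simp [num, h3, h4, toC_one, toC_zero]

theorem act_one (τ : HH2) : act 1 τ = τ := by
  apply Subtype.ext
  change num 1 τ * (den 1 τ)⁻¹ = τ.1
  rw [den_one, num_one]; simp

theorem continuous_den (M : Sp4Z) : Continuous (den M) := by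
  unfold den
  exact (continuous_const.matrix_mul continuous_subtype_val).add continuous_const

theorem continuous_act (M : Sp4Z) : Continuous (act M) := by
  refine Continuous.subtype_mk ?_ _
  have hn : Continuous (num M) := by
    unfold num
    exact (continuous_const.matrix_mul continuous_subtype_val).add continuous_const
  refine hn.matrix_mul ?_
  have h : (fun τ => (den M τ)⁻¹) = fun τ => ((den M τ).det)⁻¹ • (den M τ).adjugate := by
    funext τ
    rw [Matrix.inv_def, Ring.inverse_eq_inv']
  rw [h]
  exact ((continuous_den M).matrix_det.inv₀ (den_det_ne_zero M)).smul
    (continuous_den M).matrix_adjugate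

/-- The metaplectic group `Mp₄(ℤ)`: pairs of `M = (A B; C D) ∈ Sp₄(ℤ)` and a square root `φ` of
`τ ↦ det(Cτ + D)` on the Siegel upper half space. A continuous square root of this nowhere
vanishing holomorphic function is the same as a holomorphic one. -/
@[ext] structure Mp4Z where
  mat : Sp4Z
  root : HH2 → ℂ
  continuous_root : Continuous root
  root_sq : ∀ τ, root τ ^ 2 = (den mat τ).det

namespace Mp4Z

theorem root_ne_zero (γ : Mp4Z) (τ : HH2) : γ.root τ ≠ 0 := by
  intro h
  have := γ.root_sq τ
  rw [h] at this
  exact den_det_ne_zero γ.mat τ (by simpa using this.symm)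

/-- `(M, φ)(N, ψ) = (MN, φ(N τ) ψ(τ))`. -/
instance : Mul Mp4Z where
  mul γ δ :=
    { mat := γ.mat * δ.mat
      root := fun τ => γ.root (act δ.mat τ) * δ.root τ
      continuous_root := (γ.continuous_root.comp (continuous_act _)).mul δ.continuous_root
      root_sq := fun τ => by
        rw [mul_pow, γ.root_sq, δ.root_sq, den_mul, Matrix.det_mul] }

instance : One Mp4Z where
  one :=
    { mat := 1
      root := fun _ => 1
      continuous_root := continuous_const
      root_sq := fun τ => by simp [den_one] }

instance : Inv Mp4Z where
  inv γ :=
    { mat := γ.mat⁻¹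
      root := fun τ => (γ.root (act γ.mat⁻¹ τ))⁻¹
      continuous_root :=
        (γ.continuous_root.comp (continuous_act _)).inv₀ (fun τ => γ.root_ne_zero _)
      root_sq := fun τ => by
        have h := den_mul γ.mat γ.mat⁻¹ τ
        rw [mul_inv_cancel, den_one] at h
        have h' := congrArg Matrix.det h
        rw [Matrix.det_mul, Matrix.det_one, ← γ.root_sq] at h'
        rw [inv_pow]
        exact (eq_inv_of_mul_eq_one_right h'.symm).symm }

theorem mat_mul (γ δ : Mp4Z) : (γ * δ).mat = γ.mat * δ.mat := rfl

theorem root_mul (γ δ : Mp4Z) (τ : HH2) :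
    (γ * δ).root τ = γ.root (act δ.mat τ) * δ.root τ := rfl

instance : Group Mp4Z :=
  Group.ofLeftAxioms
    (fun γ δ ε => Mp4Z.ext (mul_assoc γ.mat δ.mat ε.mat) (funext fun τ => by
      simp only [root_mul, mat_mul, act_mul, mul_assoc]))
    (fun γ => Mp4Z.ext (one_mul γ.mat) (funext fun τ => one_mul (γ.root τ)))
    (fun γ => Mp4Z.ext (inv_mul_cancel γ.mat) (funext fun τ => by
      change (γ.root (act γ.mat⁻¹ (act γ.mat τ)))⁻¹ * γ.root τ = 1
      rw [← act_mul, inv_mul_cancel, act_one]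
      exact inv_mul_cancel₀ (γ.root_ne_zero τ)))

end Mp4Z

theorem den_of_blocks (M : Sp4Z) (A B C D : Matrix (Fin 2) (Fin 2) ℤ)
    (h : M.1 = Matrix.fromBlocks A B C D) (τ : HH2) : den M τ = toC C * τ.1 + toC D := by
  rw [← blk_eq M] at h
  obtain ⟨-, -, h3, h4⟩ := Matrix.fromBlocks_inj.1 h
  rw [den, h3, h4]

/-- The element `((1 B; 0 1), 1)` for a symmetric integral matrix `B`. -/
def mkT (B : Matrix (Fin 2) (Fin 2) ℤ) (hB : Bᵀ = B) : Mp4Z where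
  mat := ⟨Matrix.fromBlocks 1 B 0 1, by
    rw [SymplecticGroup.fromBlocks_mem_iff]; simp [hB]⟩
  root := fun _ => 1
  continuous_root := continuous_const
  root_sq := fun τ => by
    rw [den_of_blocks _ _ _ _ _ rfl τ]; simp [toC_one, toC_zero]

/-- The element `((A 0; 0 A⁻ᵗ), det(A)^{1/2})` for `A ∈ GL₂(ℤ)`, with the principal square root. -/
def mkDiag (A : GL (Fin 2) ℤ) : Mp4Z where
  mat := ⟨Matrix.fromBlocks A.1 0 0 (A⁻¹).1ᵀ, by
    rw [SymplecticGroup.fromBlocks_mem_iff]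
    refine ⟨by simp, by simp, ?_⟩
    rw [← Matrix.transpose_mul]
    simp⟩
  root := fun _ => ((A.1.det : ℤ) : ℂ) ^ (1 / 2 : ℂ)
  continuous_root := continuous_const
  root_sq := fun τ => by
    rw [den_of_blocks _ _ _ _ _ rfl τ, toC_zero, Matrix.zero_mul, zero_add, toC_det,
      Matrix.det_transpose, ← Complex.cpow_nat_mul]
    have h1 : A.1.det * (A⁻¹).1.det = 1 := by
      rw [← Matrix.det_mul, ← Units.val_mul, mul_inv_cancel, Units.val_one, Matrix.det_one]
    rcases Int.eq_one_or_neg_one_of_mul_eq_one h1 with h | h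
    · rw [h] at h1 ⊢; simp at h1; simp [h1]
    · rw [h] at h1 ⊢
      have : (A⁻¹).1.det = -1 := by linarith
      rw [this]; simp

theorem im_pos_aux (τ : HH2) : 0 < (τ.1 0 0).im := τ.2.2.diag_pos (i := 0)

theorem im_div_pos (τ : HH2) : 0 < (τ.1.det / τ.1 0 0).im := by
  set J : Sp4Z := SymplecticGroup.symJ (Fin 2) ℤ with hJ
  have hJ1 : J.1 = Matrix.fromBlocks 0 (-1) 1 0 := rfl
  have hden : den J τ = τ.1 := by
    rw [den_of_blocks J _ _ _ _ hJ1 τ]; simp [toC_one, toC_zero]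
  have hnum : num J τ = -1 := by
    have h := hJ1
    rw [← blk_eq J] at h
    obtain ⟨h3, h4, -, -⟩ := Matrix.fromBlocks_inj.1 h
    rw [num, h3, h4]; simp [toC_one, toC_zero, toC_neg]
  have h11 := (act J τ).2.2.diag_pos (i := 1)
  have hact : (act J τ).1 = -(τ.1)⁻¹ := by
    change num J τ * (den J τ)⁻¹ = _
    rw [hden, hnum]; simp
  have hd : τ.1.det ≠ 0 := by have := den_det_ne_zero J τ; rwa [hden] at this
  rw [imPart, Matrix.map_apply, hact, Matrix.neg_apply, Matrix.inv_def, Matrix.smul_apply,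
    Matrix.adjugate_fin_two, Ring.inverse_eq_inv'] at h11
  simp only [Matrix.of_apply, Matrix.cons_val', Matrix.cons_val_one, Matrix.cons_val_fin_one,
    smul_eq_mul] at h11
  have h2 : τ.1.det / τ.1 0 0 = ((τ.1.det)⁻¹ * τ.1 0 0)⁻¹ := by
    rw [mul_inv, inv_inv, div_eq_mul_inv]
  rw [h2, Complex.inv_im]
  rw [Complex.neg_im] at h11
  apply div_pos h11
  rw [Complex.normSq_pos]
  intro h0
  rw [h0] at h11
  simp at h11

/-- The holomorphic square root of `det τ` on the Siegel upper half space that takes the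
principal value `(-1)^{1/2} = i` at `τ = i·1`: for `τ = (τ₁ τ₂; τ₂ τ₃)`, the numbers `τ₁` and
`det τ / τ₁` have positive imaginary part, and both factors below are principal square roots. -/
def sqrtDet (τ : HH2) : ℂ := (τ.1 0 0) ^ (1 / 2 : ℂ) * (τ.1.det / τ.1 0 0) ^ (1 / 2 : ℂ)

theorem continuous_sqrtDet : Continuous sqrtDet := by
  have h00 : Continuous fun τ : HH2 => τ.1 0 0 := continuous_subtype_val.matrix_elem 0 0
  have hdet : Continuous fun τ : HH2 => τ.1.det := continuous_subtype_val.matrix_det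
  have hne : ∀ τ : HH2, τ.1 0 0 ≠ 0 := fun τ h => by
    have := im_pos_aux τ; rw [h] at this; simp at this
  refine Continuous.mul ?_ ?_
  · exact h00.cpow continuous_const (fun τ => Or.inr (im_pos_aux τ).ne')
  · exact (hdet.div h00 hne).cpow continuous_const (fun τ => Or.inr (im_div_pos τ).ne')

theorem sqrtDet_sq (τ : HH2) : sqrtDet τ ^ 2 = τ.1.det := by
  have hne : τ.1 0 0 ≠ 0 := fun h => by
    have := im_pos_aux τ; rw [h] at this; simp at this
  rw [sqrtDet, mul_pow, ← Complex.cpow_nat_mul, ← Complex.cpow_nat_mul]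
  simp [mul_div_cancel₀ _ hne]

theorem sqrtDet_I (τ : HH2) (h : τ.1 = Complex.I • 1) : sqrtDet τ = Complex.I := by
  have h2 : (Complex.I * Complex.I) / Complex.I = Complex.I := by simp
  rw [sqrtDet, h]
  simp only [Matrix.smul_apply, Matrix.one_apply_eq, smul_eq_mul, mul_one, Matrix.det_smul,
    Fintype.card_fin, Matrix.det_one, pow_two, h2]
  rw [← pow_two, ← Complex.cpow_nat_mul]
  simp

/-- The element `S = ((0 -1; 1 0), (det τ)^{1/2})`, with the square root `sqrtDet`. -/
def mkS : Mp4Z where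
  mat := SymplecticGroup.symJ (Fin 2) ℤ
  root := sqrtDet
  continuous_root := continuous_sqrtDet
  root_sq := fun τ => by
    have hJ1 : (SymplecticGroup.symJ (Fin 2) ℤ).1 = Matrix.fromBlocks 0 (-1) 1 0 := rfl
    rw [sqrtDet_sq, den_of_blocks _ _ _ _ _ hJ1 τ]
    simp [toC_one, toC_zero]


section Lattice

variable {L : Type*} [AddCommGroup L]

/-- The real bilinear form `(x, y) = q(x + y) - q(x) - q(y)` on `V = L ⊗ ℝ`. -/
def form (q : QuadraticForm ℤ L) : LinearMap.BilinForm ℝ (ℝ ⊗[ℤ] L) :=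
  LinearMap.BilinForm.baseChange ℝ (QuadraticMap.polarBilin q)

/-- The lattice `L` inside `V = L ⊗ ℝ`. -/
def lat (L : Type*) [AddCommGroup L] : Submodule ℤ (ℝ ⊗[ℤ] L) :=
  Submodule.span ℤ (Set.range fun l : L => (1 : ℝ) ⊗ₜ[ℤ] l)

theorem mem_lat {x : ℝ ⊗[ℤ] L} : x ∈ lat L ↔ ∃ l : L, (1 : ℝ) ⊗ₜ[ℤ] l = x := by
  constructor
  · intro h
    refine Submodule.span_induction (p := fun x _ => ∃ l : L, (1 : ℝ) ⊗ₜ[ℤ] l = x)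
      (fun x hx => hx) ⟨0, TensorProduct.tmul_zero L (1 : ℝ)⟩ ?_ ?_ h
    · rintro _ _ _ _ ⟨l, rfl⟩ ⟨m, rfl⟩
      exact ⟨l + m, TensorProduct.tmul_add _ _ _⟩
    · rintro n _ _ ⟨l, rfl⟩
      exact ⟨n • l, ((TensorProduct.mk ℤ ℝ L 1).toAddMonoidHom.map_zsmul n l)⟩
  · rintro ⟨l, rfl⟩
    exact Submodule.subset_span ⟨l, rfl⟩

/-- The dual lattice `L' = {x ∈ V : (x, y) ∈ ℤ for all y ∈ L}`. -/
def dual (q : QuadraticForm ℤ L) : Submodule ℤ (ℝ ⊗[ℤ] L) :=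
  (form q).dualSubmodule (lat L)

/-- The discriminant group `D_L = L' / L`. -/
abbrev Disc (q : QuadraticForm ℤ L) : Type _ := dual q ⧸ (lat L).submoduleOf (dual q)

/-- The class in `D_L²` of a pair of vectors in the dual lattice. -/
def cls (q : QuadraticForm ℤ L) (v : Fin 2 → dual q) : Fin 2 → Disc q :=
  fun j => Submodule.Quotient.mk (v j)

/-- A row vector `x = (x₁, x₂)` times an integral `2 × 2` matrix. -/
def rmul {W : Type*} [AddCommGroup W] (x : Fin 2 → W) (N : Matrix (Fin 2) (Fin 2) ℤ) :
    Fin 2 → W := fun j => ∑ i, N i j • x i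

/-- The matrix `(x, y)` of the inner products `(xᵢ, yⱼ)`. -/
def gram (q : QuadraticForm ℤ L) (x y : Fin 2 → ℝ ⊗[ℤ] L) : Matrix (Fin 2) (Fin 2) ℝ :=
  Matrix.of fun i j => form q (x i) (y j)

/-- The matrix `q(x) = (x, x) / 2`. -/
def qmat (q : QuadraticForm ℤ L) (x : Fin 2 → ℝ ⊗[ℤ] L) : Matrix (Fin 2) (Fin 2) ℝ :=
  (1 / 2 : ℝ) • gram q x x

/-- A real matrix, viewed over `ℂ`. -/
def ofR (X : Matrix (Fin 2) (Fin 2) ℝ) : Matrix (Fin 2) (Fin 2) ℂ := X.map (fun r : ℝ => (r : ℂ))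

theorem form_tmul (q : QuadraticForm ℤ L) (r s : ℝ) (x y : L) :
    form q (r ⊗ₜ x) (s ⊗ₜ y) = ((QuadraticMap.polar q x y : ℤ) : ℝ) * (r * s) := by
  simp [form, LinearMap.BilinForm.baseChange_tmul]

theorem form_symm (q : QuadraticForm ℤ L) (x y : ℝ ⊗[ℤ] L) : form q x y = form q y x := by
  induction x using TensorProduct.induction_on with
  | zero => simp
  | add x x' hx hx' => simp [hx, hx']
  | tmul r x =>
    induction y using TensorProduct.induction_on with
    | zero => simp
    | add y y' hy hy' => rw [map_add, map_add, hy, hy']; simp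
    | tmul s y => rw [form_tmul, form_tmul, QuadraticMap.polar_comm, mul_comm r s]

theorem dual_lat_int (q : QuadraticForm ℤ L) {x y : ℝ ⊗[ℤ] L} (hx : x ∈ dual q)
    (hy : y ∈ lat L) : ∃ n : ℤ, form q x y = n := by
  obtain ⟨n, hn⟩ := Submodule.mem_one.1 (hx y hy)
  exact ⟨n, by simpa using hn.symm⟩

theorem lat_even (q : QuadraticForm ℤ L) {x : ℝ ⊗[ℤ] L} (hx : x ∈ lat L) :
    ∃ n : ℤ, form q x x = 2 * n := by
  obtain ⟨l, rfl⟩ := mem_lat.1 hx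
  refine ⟨q l, ?_⟩
  rw [form_tmul, QuadraticMap.polar_self]
  simp

theorem lat_le_dual (q : QuadraticForm ℤ L) : lat L ≤ dual q := by
  intro x hx y hy
  obtain ⟨l, rfl⟩ := mem_lat.1 hx
  obtain ⟨m, rfl⟩ := mem_lat.1 hy
  refine Submodule.mem_one.2 ⟨QuadraticMap.polar q l m, ?_⟩
  rw [form_tmul]
  simp

theorem expi_int (z : ℂ) (n : ℤ) : expi (z + n) = expi z := by
  unfold expi
  rw [Complex.exp_eq_exp_iff_exists_int]
  exact ⟨n, by ring⟩

/-- A pair of vectors in the dual lattice that represents `γ ∈ D_L²`. -/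
def repr (q : QuadraticForm ℤ L) (γ : Fin 2 → Disc q) : Fin 2 → ℝ ⊗[ℤ] L :=
  fun j => ((Submodule.Quotient.mk_surjective _ (γ j)).choose : dual q)

/-- The number `e(tr(q(γ) B))` for `γ ∈ D_L²` and a symmetric integral matrix `B`. -/
def discQ (q : QuadraticForm ℤ L) (γ : Fin 2 → Disc q) (B : Matrix (Fin 2) (Fin 2) ℤ) : ℂ :=
  expi (ofR (qmat q (repr q γ)) * toC B).trace

/-- The number `e(-tr(γ, δ))` for `γ, δ ∈ D_L²`. -/
def discPair (q : QuadraticForm ℤ L) (γ δ : Fin 2 → Disc q) : ℂ :=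
  expi (-(ofR (gram q (repr q γ) (repr q δ))).trace)

theorem repr_sub (q : QuadraticForm ℤ L) (v : Fin 2 → dual q) (j : Fin 2) :
    repr q (cls q v) j - (v j : ℝ ⊗[ℤ] L) ∈ lat L := by
  have h := (Submodule.Quotient.mk_surjective ((lat L).submoduleOf (dual q)) (cls q v j)).choose_spec
  exact (Submodule.Quotient.eq ((lat L).submoduleOf (dual q))).1 h

theorem repr_mem (q : QuadraticForm ℤ L) (γ : Fin 2 → Disc q) (j : Fin 2) :
    repr q γ j ∈ dual q :=
  ((Submodule.Quotient.mk_surjective _ (γ j)).choose : dual q).2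

theorem discPair_cls (q : QuadraticForm ℤ L) (v w : Fin 2 → dual q) :
    discPair q (cls q v) (cls q w) =
      expi (-(ofR (gram q (fun j => v j) (fun j => w j))).trace) := by
  have key : ∀ j, ∃ n : ℤ, form q (repr q (cls q v) j) (repr q (cls q w) j) =
      form q (v j) (w j) + n := by
    intro j
    obtain ⟨n, hn⟩ := dual_lat_int q (v j).2 (repr_sub q w j)
    obtain ⟨m, hm⟩ := dual_lat_int q (repr_mem q (cls q w) j) (repr_sub q v j)
    rw [form_symm] at hm
    refine ⟨n + m, ?_⟩
    simp only [map_sub, LinearMap.sub_apply] at hn hm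
    push_cast
    linarith
  choose n hn using key
  rw [discPair, ← expi_int _ (n 0 + n 1)]
  congr 1
  simp [Matrix.trace, ofR, gram, Fin.sum_univ_two, hn]
  ring

theorem discQ_cls (q : QuadraticForm ℤ L) (v : Fin 2 → dual q) (B : Matrix (Fin 2) (Fin 2) ℤ)
    (hB : Bᵀ = B) :
    discQ q (cls q v) B = expi (ofR (qmat q (fun j => v j)) * toC B).trace := by
  have h10 : B 1 0 = B 0 1 := congrFun (congrFun hB 0) 1
  have key : ∀ i j, ∃ n : ℤ, form q (repr q (cls q v) i) (repr q (cls q v) j) =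
      form q (v i) (v j) + n := by
    intro i j
    obtain ⟨n, hn⟩ := dual_lat_int q (v i).2 (repr_sub q v j)
    obtain ⟨m, hm⟩ := dual_lat_int q (repr_mem q (cls q v) j) (repr_sub q v i)
    rw [form_symm] at hm
    refine ⟨n + m, ?_⟩
    simp only [map_sub, LinearMap.sub_apply] at hn hm
    push_cast
    linarith
  have key2 : ∀ j, ∃ n : ℤ, form q (repr q (cls q v) j) (repr q (cls q v) j) =
      form q (v j) (v j) + 2 * n := by
    intro j
    obtain ⟨n, hn⟩ := dual_lat_int q (v j).2 (repr_sub q v j)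
    obtain ⟨m, hm⟩ := lat_even q (repr_sub q v j)
    refine ⟨n + m, ?_⟩
    simp only [map_sub, LinearMap.sub_apply] at hn hm
    have := form_symm q (repr q (cls q v) j) (v j)
    push_cast
    linarith
  obtain ⟨n, hn⟩ := key 0 1
  obtain ⟨m0, h0⟩ := key2 0
  obtain ⟨m1, h1⟩ := key2 1
  have hn' := hn
  rw [form_symm, form_symm q (v 0)] at hn'
  rw [discQ, ← expi_int (ofR (qmat q (fun j => v j)) * toC B).trace
    (m0 * B 0 0 + m1 * B 1 1 + n * B 0 1)]
  congr 1
  simp [Matrix.trace, Matrix.mul_apply, ofR, qmat, gram, toC, Fin.sum_univ_two, h0, h1, hn, hn',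
    h10]
  ring

/-- The discriminant group of a non-degenerate lattice is finite. -/
theorem finite_disc [Module.Free ℤ L] [Module.Finite ℤ L] (q : QuadraticForm ℤ L)
    (hq : (form q).Nondegenerate) : Finite (Disc q) := by
  classical
  let c := Module.Free.chooseBasis ℤ L
  let bV := c.baseChange ℝ
  have hb : ∀ i, bV i = (1 : ℝ) ⊗ₜ[ℤ] c i := fun i => by simp [bV]
  have hlat : lat L = Submodule.span ℤ (Set.range bV) := by
    apply le_antisymm
    · intro x hx
      obtain ⟨l, rfl⟩ := mem_lat.1 hx
      rw [← c.sum_repr l, TensorProduct.tmul_sum]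
      refine Submodule.sum_mem _ fun i _ => ?_
      have h : (1 : ℝ) ⊗ₜ[ℤ] (c.repr l i • c i) = c.repr l i • bV i := by
        rw [hb]
        exact ((TensorProduct.mk ℤ ℝ L 1).toAddMonoidHom.map_zsmul _ (c i))
      rw [h]
      exact Submodule.smul_mem _ _ (Submodule.subset_span ⟨i, rfl⟩)
    · rw [Submodule.span_le]
      rintro _ ⟨i, rfl⟩
      exact mem_lat.2 ⟨c i, (hb i).symm⟩
  have hfg : (dual q).FG := by
    rw [dual, hlat, LinearMap.BilinForm.dualSubmodule_span_of_basis _ hq bV]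
    exact Submodule.fg_span (Set.finite_range _)
  have : Module.Finite ℤ (dual q) := Module.Finite.iff_fg.2 hfg
  let G : Matrix (Module.Free.ChooseBasisIndex ℤ L) (Module.Free.ChooseBasisIndex ℤ L) ℤ :=
    Matrix.of fun i j => QuadraticMap.polar q (c i) (c j)
  have hG : LinearMap.BilinForm.toMatrix bV (form q) = G.map (Int.cast : ℤ → ℝ) := by
    ext i j
    rw [LinearMap.BilinForm.toMatrix_apply, hb, hb, form_tmul]
    simp [G]
  have hdet : G.det ≠ 0 := by
    have h := (LinearMap.BilinForm.nondegenerate_iff_det_ne_zero bV).1 hq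
    rw [hG] at h
    intro h0
    apply h
    have := (Int.castRingHom ℝ).map_det G
    rw [h0] at this
    simpa using this.symm
  apply Module.finite_of_fg_torsion
  intro x
  obtain ⟨v, rfl⟩ := Submodule.Quotient.mk_surjective _ x
  refine ⟨⟨G.det, mem_nonZeroDivisors_of_ne_zero hdet⟩, ?_⟩
  change G.det • (Submodule.Quotient.mk v : Disc q) = 0
  rw [← Submodule.Quotient.mk_smul, Submodule.Quotient.mk_eq_zero]
  change ((G.det • v : dual q) : ℝ ⊗[ℤ] L) ∈ lat L
  have hv : ∀ i, ∃ n : ℤ, form q (bV i) (v : ℝ ⊗[ℤ] L) = n := fun i => by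
    obtain ⟨n, hn⟩ := dual_lat_int q v.2 (mem_lat.2 ⟨c i, rfl⟩ : (1 : ℝ) ⊗ₜ[ℤ] c i ∈ lat L)
    exact ⟨n, by rw [hb, form_symm, hn]⟩
  choose n hn using hv
  have h1 : (G.map (Int.cast : ℤ → ℝ)) *ᵥ (bV.repr (v : ℝ ⊗[ℤ] L)) = fun i => (n i : ℝ) := by
    funext i
    rw [← hn i, ← hG]
    conv_rhs => rw [← bV.sum_repr (v : ℝ ⊗[ℤ] L)]
    rw [map_sum]
    simp only [map_smul, smul_eq_mul, Matrix.mulVec, dotProduct,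
      LinearMap.BilinForm.toMatrix_apply, mul_comm]
  have h2 : ∀ i, (G.det : ℝ) * bV.repr (v : ℝ ⊗[ℤ] L) i = ((G.adjugate *ᵥ n) i : ℤ) := by
    have h := congrArg (fun w => (G.adjugate.map (Int.cast : ℤ → ℝ)) *ᵥ w) h1
    simp only [Matrix.mulVec_mulVec] at h
    have h3 : G.adjugate.map (Int.cast : ℤ → ℝ) * G.map (Int.cast : ℤ → ℝ) =
        (G.det : ℝ) • 1 := by
      have := congrArg (fun M => M.map (Int.castRingHom ℝ)) (Matrix.adjugate_mul G)
      simp only [Matrix.map_mul] at this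
      refine this.trans ?_
      ext i j
      rw [Matrix.map_apply, Matrix.smul_apply, Matrix.smul_apply, Matrix.one_apply,
        Matrix.one_apply]
      split_ifs <;> simp
    rw [h3] at h
    intro i
    have h4 := congrFun h i
    simp only [Matrix.smul_mulVec, Matrix.one_mulVec, Pi.smul_apply, smul_eq_mul] at h4
    rw [h4]
    simp [Matrix.mulVec, dotProduct]
  have h5 : ((G.det • v : dual q) : ℝ ⊗[ℤ] L) = ∑ i, (G.adjugate *ᵥ n) i • bV i := by
    rw [Submodule.coe_smul]
    conv_lhs => rw [← bV.sum_repr (v : ℝ ⊗[ℤ] L)]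
    rw [Finset.smul_sum]
    refine Finset.sum_congr rfl fun i _ => ?_
    rw [← Int.cast_smul_eq_zsmul ℝ, ← Int.cast_smul_eq_zsmul ℝ, smul_smul, h2]
  rw [h5]
  exact Submodule.sum_mem _ fun i _ =>
    Submodule.smul_mem _ _ (mem_lat.2 ⟨c i, (hb i).symm⟩)

/-- The standard basis vector `𝔢_γ` of `ℂ[D_L²]`. -/
def basisVec (q : QuadraticForm ℤ L) (γ : Fin 2 → Disc q) : (Fin 2 → Disc q) → ℂ :=
  open Classical in fun δ => if δ = γ then 1 else 0

/-- The defining property of the genus 2 Weil representation of `Mp₄(ℤ)` on `ℂ[D_L²]` for an even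
lattice `L` of signature `(b⁺, b⁻)`, the discriminant group `D_L` being finite. -/
structure IsWeilRepresentation (q : QuadraticForm ℤ L) (bpos bneg : ℕ)
    (ρ : Representation ℂ Mp4Z ((Fin 2 → Disc q) → ℂ)) : Prop where
  diag : ∀ (A : GL (Fin 2) ℤ) (γ : Fin 2 → Disc q),
    ρ (mkDiag A) (basisVec q γ) =
      (((A.1.det : ℤ) : ℂ) ^ (((bneg : ℂ) - (bpos : ℂ)) / 2)) • basisVec q (rmul γ (A⁻¹).1)
  trans : ∀ (B : Matrix (Fin 2) (Fin 2) ℤ) (hB : Bᵀ = B) (γ : Fin 2 → Disc q),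
    ρ (mkT B hB) (basisVec q γ) = discQ q γ B • basisVec q γ
  inversion : ∀ γ : Fin 2 → Disc q,
    ρ mkS (basisVec q γ) =
      (Complex.I ^ ((bneg : ℤ) - (bpos : ℤ)) / (Nat.card (Disc q) : ℂ)) •
        ∑ᶠ δ : Fin 2 → Disc q, discPair q δ γ • basisVec q δ

/-- An orthogonal basis `(eⱼ)` of `V` with `(eⱼ, eⱼ) = 1` for the first `b` vectors and
`(eⱼ, eⱼ) = -1` for the last two, so that `L` has signature `(b, 2)`. -/
def IsSignatureBasis (q : QuadraticForm ℤ L) {b : ℕ}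
    (e : Module.Basis (Fin b ⊕ Fin 2) ℝ (ℝ ⊗[ℤ] L)) : Prop :=
  (∀ i j, i ≠ j → form q (e i) (e j) = 0) ∧
  (∀ i : Fin b, form q (e (Sum.inl i)) (e (Sum.inl i)) = 1) ∧
  (∀ i : Fin 2, form q (e (Sum.inr i)) (e (Sum.inr i)) = -1)

/-- The group `G = SO(V)`. -/
def SOV (q : QuadraticForm ℤ L) : Subgroup ((ℝ ⊗[ℤ] L) ≃ₗ[ℝ] (ℝ ⊗[ℤ] L)) where
  carrier := {g | (∀ x y, form q (g x) (g y) = form q x y) ∧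
    LinearMap.det (g : (ℝ ⊗[ℤ] L) →ₗ[ℝ] (ℝ ⊗[ℤ] L)) = 1}
  mul_mem' := by
    rintro g h ⟨hg, hg'⟩ ⟨hh, hh'⟩
    refine ⟨fun x y => by simp [hg, hh], ?_⟩
    have : ((g * h : (ℝ ⊗[ℤ] L) ≃ₗ[ℝ] (ℝ ⊗[ℤ] L)) : (ℝ ⊗[ℤ] L) →ₗ[ℝ] (ℝ ⊗[ℤ] L)) =
      (g : (ℝ ⊗[ℤ] L) →ₗ[ℝ] (ℝ ⊗[ℤ] L)) * h := rfl
    rw [this, map_mul, hg', hh', mul_one]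
  one_mem' := ⟨fun x y => rfl, LinearMap.det_id⟩
  inv_mem' := by
    rintro g ⟨hg, hg'⟩
    refine ⟨fun x y => ?_, ?_⟩
    · rw [← hg]
      congr 1
      · exact congrArg _ (g.apply_symm_apply x)
      · exact g.apply_symm_apply y
    · have h := LinearEquiv.det_mul_det_symm g
      rw [hg', one_mul] at h
      exact h

/-- The base point `z₀` of the Grassmannian: the plane spanned by the last two basis vectors. -/
def zNull {b : ℕ} (e : Module.Basis (Fin b ⊕ Fin 2) ℝ (ℝ ⊗[ℤ] L)) : Submodule ℝ (ℝ ⊗[ℤ] L) :=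
  Submodule.span ℝ (Set.range fun i : Fin 2 => e (Sum.inr i))

/-- The plane `z` that `g` maps to `z₀`. -/
def zOf {b : ℕ} (e : Module.Basis (Fin b ⊕ Fin 2) ℝ (ℝ ⊗[ℤ] L))
    (g : (ℝ ⊗[ℤ] L) ≃ₗ[ℝ] (ℝ ⊗[ℤ] L)) : Submodule ℝ (ℝ ⊗[ℤ] L) :=
  (zNull e).comap (g : (ℝ ⊗[ℤ] L) →ₗ[ℝ] (ℝ ⊗[ℤ] L))

/-- The orthogonal projection `x ↦ x_z` of `V` to the plane `z` that the isometry `g` maps to `z₀`;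
see `projz_mem` and `sub_projz_orthogonal`. -/
def projz {b : ℕ} (e : Module.Basis (Fin b ⊕ Fin 2) ℝ (ℝ ⊗[ℤ] L))
    (g : (ℝ ⊗[ℤ] L) ≃ₗ[ℝ] (ℝ ⊗[ℤ] L)) (x : ℝ ⊗[ℤ] L) : ℝ ⊗[ℤ] L :=
  g.symm (∑ i : Fin 2, e.repr (g x) (Sum.inr i) • e (Sum.inr i))

theorem projz_mem {b : ℕ} (e : Module.Basis (Fin b ⊕ Fin 2) ℝ (ℝ ⊗[ℤ] L))
    (g : (ℝ ⊗[ℤ] L) ≃ₗ[ℝ] (ℝ ⊗[ℤ] L)) (x : ℝ ⊗[ℤ] L) : projz e g x ∈ zOf e g := by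
  change g (g.symm _) ∈ zNull e
  rw [LinearEquiv.apply_symm_apply]
  exact Submodule.sum_mem _ fun i _ =>
    Submodule.smul_mem _ _ (Submodule.subset_span ⟨i, rfl⟩)

theorem sub_projz_orthogonal {b : ℕ} (q : QuadraticForm ℤ L)
    (e : Module.Basis (Fin b ⊕ Fin 2) ℝ (ℝ ⊗[ℤ] L)) (he : IsSignatureBasis q e)
    (g : (ℝ ⊗[ℤ] L) ≃ₗ[ℝ] (ℝ ⊗[ℤ] L)) (hg : g ∈ SOV q) (x y : ℝ ⊗[ℤ] L) (hy : y ∈ zOf e g) :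
    form q (x - projz e g x) y = 0 := by
  rw [← hg.1, map_sub, projz, LinearEquiv.apply_symm_apply]
  have hx : g x - ∑ i : Fin 2, e.repr (g x) (Sum.inr i) • e (Sum.inr i) =
      ∑ i : Fin b, e.repr (g x) (Sum.inl i) • e (Sum.inl i) := by
    rw [sub_eq_iff_eq_add]
    conv_lhs => rw [← e.sum_repr (g x)]
    rw [Fintype.sum_sum_type]
  rw [hx]
  have hy' : g y ∈ zNull e := hy
  refine Submodule.span_induction (p := fun w _ => form q (∑ i : Fin b,
    e.repr (g x) (Sum.inl i) • e (Sum.inl i)) w = 0) ?_ ?_ ?_ ?_ hy'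
  · rintro _ ⟨k, rfl⟩
    simp only [map_sum, LinearMap.sum_apply, map_smul, LinearMap.smul_apply]
    exact Finset.sum_eq_zero fun i _ => by rw [he.1 _ _ (by simp), smul_zero]
  · simp
  · intro w w' _ _ h h'
    rw [map_add, h, h', add_zero]
  · intro r w _ h
    rw [map_smul, h, smul_zero]

/-- Very homogeneous polynomials of degree `(m⁺, m⁻)` on pairs of vectors in `ℝ^{b,2}`; the variable
`(i, j)` is the `i`-th coordinate of the `j`-th vector, and `i` runs through the `b` positive
coordinates followed by the two negative ones. -/
def IsVeryHomogeneous {b : ℕ} (P : MvPolynomial ((Fin b ⊕ Fin 2) × Fin 2) ℂ) (mpos mneg : ℕ) :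
    Prop :=
  ∃ (Pb : MvPolynomial (Fin b × Fin 2) ℂ) (P2 : MvPolynomial (Fin 2 × Fin 2) ℂ),
    P = MvPolynomial.rename (fun p => (Sum.inl p.1, p.2)) Pb *
      MvPolynomial.rename (fun p => (Sum.inr p.1, p.2)) P2 ∧
    (∀ (X : Matrix (Fin b) (Fin 2) ℝ) (N : Matrix (Fin 2) (Fin 2) ℂ),
      MvPolynomial.eval (fun p => (X.map (fun r : ℝ => (r : ℂ)) * N) p.1 p.2) Pb =
        N.det ^ mpos * MvPolynomial.eval (fun p => (X p.1 p.2 : ℂ)) Pb) ∧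
    (∀ (X : Matrix (Fin 2) (Fin 2) ℝ) (N : Matrix (Fin 2) (Fin 2) ℂ),
      MvPolynomial.eval (fun p => (X.map (fun r : ℝ => (r : ℂ)) * N) p.1 p.2) P2 =
        N.det ^ mneg * MvPolynomial.eval (fun p => (X p.1 p.2 : ℂ)) P2)

/-- The differential operator `tr(Δ Y) = ∑ᵢ ∑ⱼₖ Yₖⱼ ∂²/∂xᵢⱼ∂xᵢₖ` on polynomials. -/
def trLap {ι : Type*} [Fintype ι] (Y : Matrix (Fin 2) (Fin 2) ℝ) :
    Module.End ℂ (MvPolynomial (ι × Fin 2) ℂ) :=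
  ∑ i : ι, ∑ j : Fin 2, ∑ k : Fin 2, (Y k j : ℂ) •
    ((MvPolynomial.pderiv (i, j)).toLinearMap ∘ₗ (MvPolynomial.pderiv (i, k)).toLinearMap)

theorem trLap_isHomogeneous {ι : Type*} [Fintype ι] (Y : Matrix (Fin 2) (Fin 2) ℝ) {n : ℕ}
    {P : MvPolynomial (ι × Fin 2) ℂ} (hP : P.IsHomogeneous n) :
    (trLap Y P).IsHomogeneous (n - 1 - 1) := by
  simp only [trLap, LinearMap.sum_apply]
  refine MvPolynomial.IsHomogeneous.sum _ _ _ fun i _ => MvPolynomial.IsHomogeneous.sum _ _ _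
    fun j _ => MvPolynomial.IsHomogeneous.sum _ _ _ fun k _ => ?_
  rw [LinearMap.smul_apply, MvPolynomial.smul_eq_C_mul]
  have h : ((MvPolynomial.pderiv (i, j)) ((MvPolynomial.pderiv (i, k)) P)).IsHomogeneous
      (n - 1 - 1) := hP.pderiv.pderiv
  exact h.C_mul _

theorem trLap_pow_homogeneous {ι : Type*} [Fintype ι] (Y : Matrix (Fin 2) (Fin 2) ℝ) (m : ℕ) :
    ∀ (n : ℕ) (P : MvPolynomial (ι × Fin 2) ℂ), P.IsHomogeneous n → n < m →
      (trLap Y ^ m) P = 0 := by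
  induction m with
  | zero => intro n P _ h; omega
  | succ m ih =>
    intro n P hP hn
    rw [pow_succ, Module.End.mul_apply]
    rcases Nat.eq_zero_or_pos n with h0 | h0
    · subst h0
      rw [← MvPolynomial.totalDegree_zero_iff_isHomogeneous] at hP
      rw [MvPolynomial.totalDegree_eq_zero_iff_eq_C.1 hP]
      simp [trLap]
    · exact ih (n - 1 - 1) _ (trLap_isHomogeneous Y hP) (by omega)

/-- The terms of the series `exp(-tr(Δ y⁻¹)/(8π)) P` beyond the total degree of `P` vanish. -/
theorem trLap_pow_eq_zero {ι : Type*} [Fintype ι] (Y : Matrix (Fin 2) (Fin 2) ℝ) (m : ℕ)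
    (P : MvPolynomial (ι × Fin 2) ℂ) (h : P.totalDegree < m) : (trLap Y ^ m) P = 0 := by
  rw [← MvPolynomial.sum_homogeneousComponent P, map_sum]
  refine Finset.sum_eq_zero fun n hn => ?_
  rw [Finset.mem_range] at hn
  exact trLap_pow_homogeneous Y m n _ (MvPolynomial.homogeneousComponent_isHomogeneous n P)
    (by omega)

/-- The polynomial `exp(-tr(Δ y⁻¹)/(8π)) P`. The operator lowers the total degree, so the
exponential series has only the terms below; see `trLap_pow_eq_zero`. -/
def expLap {ι : Type*} [Fintype ι] (y : Matrix (Fin 2) (Fin 2) ℝ) (P : MvPolynomial (ι × Fin 2) ℂ) :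
    MvPolynomial (ι × Fin 2) ℂ :=
  ∑ m ∈ Finset.range (P.totalDegree + 1),
    (1 / (m.factorial : ℂ)) • (((-1 / (8 * Real.pi) : ℂ) • trLap y⁻¹) ^ m) P

/-- The summand of the theta series at the pair `v` of vectors. -/
def thetaTerm {b : ℕ} (q : QuadraticForm ℤ L) (e : Module.Basis (Fin b ⊕ Fin 2) ℝ (ℝ ⊗[ℤ] L))
    (P : MvPolynomial ((Fin b ⊕ Fin 2) × Fin 2) ℂ) (τ : HH2) (α β : Fin 2 → ℝ ⊗[ℤ] L)
    (g : (ℝ ⊗[ℤ] L) ≃ₗ[ℝ] (ℝ ⊗[ℤ] L)) (v : Fin 2 → ℝ ⊗[ℤ] L) : ℂ :=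
  MvPolynomial.eval (fun p => (e.repr (g ((v + β) p.2)) p.1 : ℂ)) (expLap (imPart τ.1) P) *
    expi ((ofR (qmat q fun j => (v + β) j - projz e g ((v + β) j)) * τ.1).trace +
      (ofR (qmat q fun j => projz e g ((v + β) j)) * τ.1.map (starRingEnd ℂ)).trace -
      (ofR (gram q (v + (1 / 2 : ℝ) • β) α)).trace)

/-- The `ℂ[D_L²]`-valued Siegel theta function `Θ_{L,2}(τ, α, β, g, P)`, where `P` is very
homogeneous of degree `(m⁺, m⁻)`; its component at `γ` is a sum over the coset `L² + γ`. -/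
def theta {b : ℕ} (q : QuadraticForm ℤ L) (e : Module.Basis (Fin b ⊕ Fin 2) ℝ (ℝ ⊗[ℤ] L))
    (P : MvPolynomial ((Fin b ⊕ Fin 2) × Fin 2) ℂ) (mneg : ℕ) (τ : HH2) (α β : Fin 2 → ℝ ⊗[ℤ] L)
    (g : (ℝ ⊗[ℤ] L) ≃ₗ[ℝ] (ℝ ⊗[ℤ] L)) : (Fin 2 → Disc q) → ℂ :=
  fun γ => (((imPart τ.1).det ^ (1 + mneg) : ℝ) : ℂ) *
    ∑' v : {v : Fin 2 → dual q // cls q v = γ},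
      thetaTerm q e P τ α β g (fun j => (v.1 j : ℝ ⊗[ℤ] L))

end Lattice

end

end SiegelTheta

/-! The Weil representation is not built from a presentation of Mp₄(ℤ); it is read off from the
theta functions. `Transforms q e γ R` says that one operator R on ℂ[D_L²] governs the behaviour of
all theta functions under γ, for every P, α, β, g and τ. The relation is multiplicative in (γ, R),
because the automorphy factor is a cocycle and (α, β) moves by a group action. Moreover R is
determined by γ, since the theta vectors with P = 1 span ℂ[D_L²] (`span_theta_eq_top`): at τ = i and
α = β = 0 every component is a sum of positive terms, and letting α run through (L')² twists the
components by the distinct, hence linearly independent, characters of D_L². So it is enough to find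
R on generators (`exists_transforms`), and γ ↦ R is then automatically a homomorphism, `weilRep`. On
the generators R is given by the prescribed formulas. Since these elements do generate Mp₄(ℤ)
(`closure_mpGens`), a representation with the prescribed values is unique, and the transformation
law holds for it by construction.

For translations and for GL₂(ℤ) the law is termwise: the first changes each summand by a root of
unity depending only on its class, the second permutes the lattice pairs. Inversion is Poisson
summation on (L')² (`sum_discPair_thetaSeries`). In orthogonal coordinates the exponential is a
product over i of exp(πi xᵢMᵢxᵢᵗ), where Mᵢ = τ for positive and Mᵢ = -τ̄ for negative coordinates,
and both points lie in the Siegel upper half space. The lattice dual to L' is L, so the transformed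
sum runs over a coset of L²; the covolume produces |D_L|.

The factor exp(-tr(Δy⁻¹)/8π) makes the summand reproduce itself under the Fourier transform
(`fourier_coordTerm`). The transform of a polynomial times a Gaussian applies a further exponential
of a second-order operator (`RapidDecay.fourier_evalR_mul`), and exponents add (`expDL_expDL`). With
M' = -M⁻¹ and y, y' the imaginary parts of M, M', the identity M'y'⁻¹M' = y⁻¹ + 2iM'
(`invPt_mul_im_inv`) shows that the sum is the operator for y' pulled back along the substitution by
-M'. Very homogeneity turns this substitution into powers of det τ and its conjugate. -/

namespace SiegelTheta

open scoped ComplexOrder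

noncomputable section

/-! ### Exponentials of second-order differential operators on polynomials -/

section QuadDiff

open MvPolynomial

variable {σ : Type*} [Fintype σ]

/-- The second order differential operator `∑ aₚₛ ∂ₚ∂ₛ` on polynomials. -/
def quadDiff (a : Matrix σ σ ℂ) : Module.End ℂ (MvPolynomial σ ℂ) :=
  ∑ p, ∑ s, a p s • ((pderiv p).toLinearMap ∘ₗ (pderiv s).toLinearMap)

theorem quadDiff_apply (a : Matrix σ σ ℂ) (P : MvPolynomial σ ℂ) :
    quadDiff a P = ∑ p, ∑ s, a p s • pderiv p (pderiv s P) := by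
  simp [quadDiff, LinearMap.sum_apply]

theorem quadDiff_isHomogeneous (a : Matrix σ σ ℂ) {n : ℕ} {P : MvPolynomial σ ℂ}
    (hP : P.IsHomogeneous n) : (quadDiff a P).IsHomogeneous (n - 1 - 1) := by
  rw [quadDiff_apply]
  refine IsHomogeneous.sum _ _ _ fun p _ => IsHomogeneous.sum _ _ _ fun s _ => ?_
  rw [smul_eq_C_mul]
  exact (hP.pderiv.pderiv : (pderiv p (pderiv s P)).IsHomogeneous (n - 1 - 1)).C_mul _

theorem quadDiff_pow_homogeneous (a : Matrix σ σ ℂ) (m : ℕ) :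
    ∀ (n : ℕ) (P : MvPolynomial σ ℂ), P.IsHomogeneous n → n < m → (quadDiff a ^ m) P = 0 := by
  induction m with
  | zero => intro n P _ h; omega
  | succ m ih =>
    intro n P hP hn
    rw [pow_succ, Module.End.mul_apply]
    rcases Nat.eq_zero_or_pos n with h0 | h0
    · subst h0
      rw [← totalDegree_zero_iff_isHomogeneous] at hP
      rw [totalDegree_eq_zero_iff_eq_C.1 hP]
      simp [quadDiff_apply]
    · exact ih (n - 1 - 1) _ (quadDiff_isHomogeneous a hP) (by omega)

theorem quadDiff_pow_eq_zero (a : Matrix σ σ ℂ) (m : ℕ) (P : MvPolynomial σ ℂ)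
    (h : P.totalDegree < m) : (quadDiff a ^ m) P = 0 := by
  rw [← sum_homogeneousComponent P, map_sum]
  refine Finset.sum_eq_zero fun n hn => ?_
  rw [Finset.mem_range] at hn
  exact quadDiff_pow_homogeneous a m n _ (homogeneousComponent_isHomogeneous n P) (by omega)

/-- The exponential `exp(∑ aₚₛ ∂ₚ∂ₛ) P`. -/
def expD (a : Matrix σ σ ℂ) (P : MvPolynomial σ ℂ) : MvPolynomial σ ℂ :=
  ∑ m ∈ Finset.range (P.totalDegree + 1), (1 / (m.factorial : ℂ)) • (quadDiff a ^ m) P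

/-- Powers beyond the total degree annihilate P, so any longer range gives the same sum. A common
range for several polynomials makes linearity and the later identities termwise. -/
theorem expD_eq (a : Matrix σ σ ℂ) (P : MvPolynomial σ ℂ) {N : ℕ} (h : P.totalDegree < N) :
    expD a P = ∑ m ∈ Finset.range N, (1 / (m.factorial : ℂ)) • (quadDiff a ^ m) P := by
  refine Finset.sum_subset (fun m hm => ?_) fun m _ hm => ?_
  · rw [Finset.mem_range] at hm ⊢; omega
  · rw [Finset.mem_range] at hm
    rw [quadDiff_pow_eq_zero a m P (by omega), smul_zero]

theorem expD_add (a : Matrix σ σ ℂ) (P Q : MvPolynomial σ ℂ) :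
    expD a (P + Q) = expD a P + expD a Q := by
  set N := P.totalDegree + Q.totalDegree + (P + Q).totalDegree + 1
  rw [expD_eq a P (N := N) (by omega), expD_eq a Q (N := N) (by omega),
    expD_eq a (P + Q) (N := N) (by omega), ← Finset.sum_add_distrib]
  simp only [map_add, smul_add]

theorem expD_smul (a : Matrix σ σ ℂ) (c : ℂ) (P : MvPolynomial σ ℂ) :
    expD a (c • P) = c • expD a P := by
  set N := P.totalDegree + (c • P).totalDegree + 1
  rw [expD_eq a P (N := N) (by omega), expD_eq a (c • P) (N := N) (by omega), Finset.smul_sum]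
  simp only [map_smul, smul_comm c]

/-- `expD` as a linear map. -/
def expDL (a : Matrix σ σ ℂ) : Module.End ℂ (MvPolynomial σ ℂ) where
  toFun := expD a
  map_add' := expD_add a
  map_smul' := expD_smul a

theorem expDL_C (a : Matrix σ σ ℂ) (c : ℂ) : expDL a (C c) = C c := by
  simp [expDL, expD]

/-- The commutator of two derivations is a derivation, and this one vanishes on the variables. -/
theorem pderiv_comm {σ : Type*} (r s : σ) (P : MvPolynomial σ ℂ) :
    pderiv r (pderiv s P) = pderiv s (pderiv r P) := by
  classical
  have h : ⁅pderiv (R := ℂ) r, pderiv (R := ℂ) s⁆ = 0 := by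
    refine MvPolynomial.derivation_ext fun i => ?_
    rw [Derivation.commutator_apply]
    simp only [pderiv_X, Pi.single_apply, Derivation.coe_zero, Pi.zero_apply]
    split_ifs <;> simp
  have := congrArg (fun D => D P) h
  rw [Derivation.commutator_apply] at this
  exact sub_eq_zero.1 this

theorem quadDiff_pderiv (a : Matrix σ σ ℂ) (r : σ) (P : MvPolynomial σ ℂ) :
    quadDiff a (pderiv r P) = pderiv r (quadDiff a P) := by
  rw [quadDiff_apply, quadDiff_apply, map_sum]
  refine Finset.sum_congr rfl fun p _ => ?_
  rw [map_sum]
  refine Finset.sum_congr rfl fun s _ => ?_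
  rw [Derivation.map_smul, pderiv_comm s r, pderiv_comm p r]

theorem quadDiff_pow_pderiv (a : Matrix σ σ ℂ) (r : σ) (m : ℕ) (P : MvPolynomial σ ℂ) :
    (quadDiff a ^ m) (pderiv r P) = pderiv r ((quadDiff a ^ m) P) := by
  induction m with
  | zero => rfl
  | succ m ih =>
    rw [pow_succ', Module.End.mul_apply, ih, quadDiff_pderiv, Module.End.mul_apply]

theorem expDL_pderiv (a : Matrix σ σ ℂ) (r : σ) (P : MvPolynomial σ ℂ) :
    expDL a (pderiv r P) = pderiv r (expDL a P) := by
  change expD a _ = pderiv r (expD a P)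
  set N := P.totalDegree + (pderiv r P).totalDegree + 1
  rw [expD_eq a P (N := N) (by omega), expD_eq a (pderiv r P) (N := N) (by omega), map_sum]
  simp only [quadDiff_pow_pderiv, Derivation.map_smul]

/-- The Leibniz rule leaves two first-order terms, one for each derivative that hits `X r`; the
symmetry of `a` merges them into the factor 2. -/
theorem quadDiff_X_mul (a : Matrix σ σ ℂ) (ha : ∀ p s, a p s = a s p) (r : σ)
    (P : MvPolynomial σ ℂ) :
    quadDiff a (X r * P) = X r * quadDiff a P + ∑ s, (2 * a r s) • pderiv s P := by
  classical
  have h : ∀ p s, a p s • pderiv p (pderiv s (X r * P)) =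
      X r * (a p s • pderiv p (pderiv s P)) +
        ((if p = r then a p s • pderiv s P else 0) + (if s = r then a p s • pderiv p P else 0)) := by
    intro p s
    rw [Derivation.leibniz, map_add, smul_eq_mul, smul_eq_mul, Derivation.leibniz,
      Derivation.leibniz, pderiv_X, pderiv_X]
    simp only [Pi.single_apply, smul_eq_mul, eq_comm (a := r)]
    have h1 : pderiv p (if s = r then (1 : MvPolynomial σ ℂ) else 0) = 0 := by
      split_ifs <;> simp
    rw [h1]
    split_ifs <;> simp only [smul_eq_C_mul] <;> ring
  rw [quadDiff_apply, quadDiff_apply]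
  simp only [h, Finset.sum_add_distrib, Finset.sum_ite_irrel, Finset.sum_const_zero,
    Finset.sum_ite_eq', Finset.mem_univ, if_true, Finset.mul_sum]
  congr 1
  rw [← Finset.sum_add_distrib]
  refine Finset.sum_congr rfl fun s _ => ?_
  rw [ha s r, ← add_smul, two_mul]

/-- The commutator with `X r` is first order and commutes with the operator, so a power contributes
m equal copies. The truncated exponent `m - 1` is harmless at m = 0, where the coefficient vanishes.
-/
theorem quadDiff_pow_X_mul (a : Matrix σ σ ℂ) (ha : ∀ p s, a p s = a s p) (r : σ) (m : ℕ)
    (P : MvPolynomial σ ℂ) :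
    (quadDiff a ^ m) (X r * P) = X r * (quadDiff a ^ m) P +
      (m : ℂ) • ∑ s, (2 * a r s) • pderiv s ((quadDiff a ^ (m - 1)) P) := by
  induction m with
  | zero => simp
  | succ m ih =>
    rw [pow_succ', Module.End.mul_apply, ih, map_add, quadDiff_X_mul a ha, map_smul, map_sum,
      Module.End.mul_apply, add_assoc]
    congr 1
    rcases Nat.eq_zero_or_pos m with h0 | h0
    · subst h0; simp
    · obtain ⟨k, rfl⟩ := Nat.exists_eq_add_of_le' h0
      simp only [Nat.add_sub_cancel, map_smul, quadDiff_pderiv]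
      rw [pow_succ', Module.End.mul_apply]
      push_cast
      module

/-- Conjugating multiplication by a variable with the exponential of a second order operator. -/
theorem expDL_X_mul (a : Matrix σ σ ℂ) (ha : ∀ p s, a p s = a s p) (r : σ)
    (P : MvPolynomial σ ℂ) :
    expDL a (X r * P) = X r * expDL a P + ∑ s, (2 * a r s) • pderiv s (expDL a P) := by
  change expD a _ = _ * expD a P + ∑ s, _ • pderiv s (expD a P)
  set N := P.totalDegree + (X r * P).totalDegree + 1
  rw [expD_eq a (X r * P) (N := N + 1) (by omega)]
  conv_rhs => rw [expD_eq a P (N := N + 1) (by omega)]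
  simp only [quadDiff_pow_X_mul a ha, smul_add, Finset.sum_add_distrib, Finset.mul_sum,
    mul_smul_comm]
  congr 1
  -- The correction vanishes at m = 0, and (m + 1)/(m + 1)! = 1/m! after the index shift. The shift
  -- leaves N terms, which still exceeds the total degree; this is why the sum was started with N +
  -- 1.
  rw [Finset.sum_range_succ', ← expD_eq a P (N := N + 1) (by omega),
    expD_eq a P (N := N) (by omega)]
  simp only [Nat.cast_zero, zero_smul, smul_zero, Nat.add_sub_cancel, map_sum,
    Finset.smul_sum, Finset.sum_const_zero, add_zero]
  rw [Finset.sum_comm]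
  refine Finset.sum_congr rfl fun s _ => Finset.sum_congr rfl fun m _ => ?_
  rw [Derivation.map_smul, smul_smul, smul_smul, smul_smul, Nat.factorial_succ]
  congr 1
  have : (m.factorial : ℂ) ≠ 0 := Nat.cast_ne_zero.2 m.factorial_ne_zero
  have : (m : ℂ) + 1 ≠ 0 := Nat.cast_add_one_ne_zero m
  push_cast
  field_simp

/-- No binomial expansion is needed: both sides fix constants and obey the same recursion
`expDL_X_mul` under multiplication by a variable. -/
theorem expDL_expDL (a c : Matrix σ σ ℂ) (ha : ∀ p s, a p s = a s p)
    (hc : ∀ p s, c p s = c s p) (P : MvPolynomial σ ℂ) :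
    expDL a (expDL c P) = expDL (a + c) P := by
  induction P using MvPolynomial.induction_on with
  | C z => simp only [expDL_C]
  | add P Q hP hQ => rw [map_add, map_add, map_add, hP, hQ]
  | mul_X P r hP =>
    rw [mul_comm P, expDL_X_mul c hc, map_add, map_sum, expDL_X_mul a ha,
      expDL_X_mul (a + c) (fun p s => by simp [ha p s, hc p s]), hP, add_assoc,
      ← Finset.sum_add_distrib]
    congr 1
    refine Finset.sum_congr rfl fun s _ => ?_
    rw [map_smul, expDL_pderiv, hP, Matrix.add_apply, mul_add, add_smul]

/-- The chain rule for a linear substitution. -/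
theorem pderiv_linear_subst (N : Matrix σ σ ℂ) (r : σ) (P : MvPolynomial σ ℂ) :
    pderiv r (aeval (fun p => ∑ s, N p s • (X s : MvPolynomial σ ℂ)) P) =
      ∑ p, N p r • aeval (fun p => ∑ s, N p s • (X s : MvPolynomial σ ℂ)) (pderiv p P) := by
  classical
  induction P using MvPolynomial.induction_on with
  | C z => simp
  | add P Q hP hQ => simp only [map_add, hP, hQ, smul_add, Finset.sum_add_distrib]
  | mul_X P p hP =>
    rw [map_mul, Derivation.leibniz, hP, aeval_X]
    simp only [Derivation.leibniz, pderiv_X, map_add, map_sum, Derivation.map_smul, smul_eq_mul,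
      map_mul, aeval_X, smul_add, Finset.sum_add_distrib, Finset.mul_sum, Pi.single_apply,
      mul_ite, mul_one, mul_zero, smul_ite, smul_zero, Finset.sum_ite_eq', Finset.sum_ite_eq,
      Finset.mem_univ, if_true, mul_smul_comm, apply_ite (aeval _), map_zero]

/-- The exponential of a second order operator after a linear substitution. -/
theorem aeval_expDL (N a c : Matrix σ σ ℂ) (ha : ∀ p s, a p s = a s p)
    (hc : ∀ p s, c p s = c s p) (h : N * c * Nᵀ = a) (P : MvPolynomial σ ℂ) :
    aeval (fun p => ∑ s, N p s • (X s : MvPolynomial σ ℂ)) (expDL a P) =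
      expDL c (aeval (fun p => ∑ s, N p s • (X s : MvPolynomial σ ℂ)) P) := by
  induction P using MvPolynomial.induction_on with
  | C z => simp only [expDL_C, aeval_C, algebraMap_eq]
  | add P Q hP hQ => simp only [map_add, hP, hQ]
  | mul_X P r hP =>
    rw [mul_comm P, expDL_X_mul a ha, map_add, map_mul, map_mul, hP, aeval_X]
    simp only [Finset.sum_mul, map_sum, smul_mul_assoc, map_smul, expDL_X_mul c hc, smul_add,
      Finset.sum_add_distrib, ← hP, pderiv_linear_subst]
    congr 1
    simp only [Finset.smul_sum, smul_smul]
    -- The r-th row of N c Nᵗ = a is what matches the first-order corrections before and after the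
    -- substitution.
    have key : ∀ p, 2 * a r p = ∑ s, ∑ t, N r s * (2 * c s t * N p t) := by
      intro p
      rw [← h]
      simp only [Matrix.mul_apply, Matrix.transpose_apply, Finset.sum_mul, Finset.mul_sum]
      rw [Finset.sum_comm]
      exact Finset.sum_congr rfl fun s _ => Finset.sum_congr rfl fun t _ => by ring
    simp only [key, Finset.sum_smul]
    rw [Finset.sum_comm]
    refine Finset.sum_congr rfl fun s _ => ?_
    rw [Finset.sum_comm]

end QuadDiff

/-! ### Poisson summation for rapidly decaying functions -/

section Poisson

open MeasureTheory

variable {ι : Type*} [Fintype ι]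

theorem norm_expi (z : ℂ) : ‖expi z‖ = Real.exp (-(2 * Real.pi * z.im)) := by
  rw [expi, Complex.norm_exp]
  simp

theorem expi_add (z w : ℂ) : expi (z + w) = expi z * expi w := by
  rw [expi, expi, expi, ← Complex.exp_add, mul_add]

/-- Continuous functions on `ℝⁿ` that decay faster than every power of the norm. -/
def RapidDecay (f : (ι → ℝ) → ℂ) : Prop :=
  Continuous f ∧ ∀ N : ℕ, ∃ C : ℝ, ∀ x, (1 + ‖x‖) ^ N * ‖f x‖ ≤ C

theorem RapidDecay.bound {f : (ι → ℝ) → ℂ} (hf : RapidDecay f) (N : ℕ) :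
    ∃ C : ℝ, ∀ x, ‖f x‖ ≤ C * ((1 + ‖x‖) ^ N)⁻¹ := by
  obtain ⟨C, hC⟩ := hf.2 N
  refine ⟨C, fun x => ?_⟩
  have h : 0 < (1 + ‖x‖) ^ N := by positivity
  rw [← div_eq_mul_inv, le_div_iff₀ h, mul_comm]
  exact hC x

theorem RapidDecay.integrable {f : (ι → ℝ) → ℂ} (hf : RapidDecay f) : Integrable f := by
  obtain ⟨C, hC⟩ := hf.bound (Module.finrank ℝ (ι → ℝ) + 1)
  have h := (integrable_one_add_norm (E := ι → ℝ) (μ := volume)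
    (r := ((Module.finrank ℝ (ι → ℝ) + 1 : ℕ) : ℝ)) (by push_cast; linarith)).const_mul C
  refine h.mono' hf.1.aestronglyMeasurable (Filter.Eventually.of_forall fun x => ?_)
  rw [Real.rpow_neg (by positivity), Real.rpow_natCast]
  exact hC x

theorem RapidDecay.mul_of_bound {f g : (ι → ℝ) → ℂ} (hf : RapidDecay f) (hg : Continuous g)
    (k : ℕ) (B : ℝ) (hB : ∀ x, ‖g x‖ ≤ B * (1 + ‖x‖) ^ k) : RapidDecay fun x => g x * f x := by
  refine ⟨hg.mul hf.1, fun N => ?_⟩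
  obtain ⟨C, hC⟩ := hf.2 (N + k)
  have hB0 : 0 ≤ B := by simpa using (norm_nonneg _).trans (hB 0)
  refine ⟨B * C, fun x => ?_⟩
  rw [norm_mul]
  calc (1 + ‖x‖) ^ N * (‖g x‖ * ‖f x‖)
      ≤ (1 + ‖x‖) ^ N * (B * (1 + ‖x‖) ^ k * ‖f x‖) := by gcongr; exact hB x
    _ = B * ((1 + ‖x‖) ^ (N + k) * ‖f x‖) := by rw [pow_add]; ring
    _ ≤ B * C := by gcongr; exact hC x

theorem RapidDecay.add {f g : (ι → ℝ) → ℂ} (hf : RapidDecay f) (hg : RapidDecay g) :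
    RapidDecay fun x => f x + g x := by
  refine ⟨hf.1.add hg.1, fun N => ?_⟩
  obtain ⟨C, hC⟩ := hf.2 N
  obtain ⟨D, hD⟩ := hg.2 N
  refine ⟨C + D, fun x => ?_⟩
  calc (1 + ‖x‖) ^ N * ‖f x + g x‖ ≤ (1 + ‖x‖) ^ N * (‖f x‖ + ‖g x‖) := by
        gcongr; exact norm_add_le _ _
    _ ≤ C + D := by rw [mul_add]; exact add_le_add (hC x) (hD x)

/-- Rapid decay is invariant under affine substitutions with injective linear part. -/
theorem RapidDecay.comp_affine {κ : Type*} [Fintype κ] {f : (ι → ℝ) → ℂ} (hf : RapidDecay f)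
    (T : (κ → ℝ) →ₗ[ℝ] (ι → ℝ)) (hT : Function.Injective T) (a : ι → ℝ) :
    RapidDecay fun x => f (T x + a) := by
  have hc : Continuous T := T.continuous_of_finiteDimensional
  refine ⟨hf.1.comp (hc.add continuous_const), fun N => ?_⟩
  obtain ⟨K, hK0, hK⟩ := T.exists_antilipschitzWith (LinearMap.ker_eq_bot.2 hT)
  obtain ⟨C, hC⟩ := hf.2 N
  have hb : ∀ x, ‖x‖ ≤ K * ‖T x‖ := fun x => by
    simpa using hK.le_mul_dist x 0
  refine ⟨((1 + K) * (1 + ‖a‖)) ^ N * C, fun x => ?_⟩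
  have h1 : 1 + ‖x‖ ≤ ((1 + K) * (1 + ‖a‖)) * (1 + ‖T x + a‖) := by
    have h2 : ‖T x‖ ≤ ‖T x + a‖ + ‖a‖ := by
      simpa using norm_sub_le (T x + a) a
    have h3 := hb x
    have hK' : (0 : ℝ) ≤ K := K.2
    have h4 : (K : ℝ) * ‖T x‖ ≤ K * (‖T x + a‖ + ‖a‖) := by gcongr
    have ha := norm_nonneg a
    have ht := norm_nonneg (T x + a)
    nlinarith [mul_nonneg ha ht, mul_nonneg hK' (mul_nonneg ha ht)]
  calc (1 + ‖x‖) ^ N * ‖f (T x + a)‖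
      ≤ (((1 + K) * (1 + ‖a‖)) * (1 + ‖T x + a‖)) ^ N * ‖f (T x + a)‖ := by gcongr
    _ = ((1 + K) * (1 + ‖a‖)) ^ N * ((1 + ‖T x + a‖) ^ N * ‖f (T x + a)‖) := by
        rw [mul_pow]; ring
    _ ≤ _ := by gcongr; exact hC _

/-- An integral vector viewed as a real vector. -/
def intVec (n : ι → ℤ) : ι → ℝ := fun i => n i

/-- The integral vectors form a lattice, over which ‖n‖⁻ᵏ is summable once k exceeds the rank. -/
theorem summable_one_add_norm_intVec :
    ∃ k : ℕ, Summable fun n : ι → ℤ => ((1 + ‖intVec n‖) ^ k)⁻¹ := by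
  classical
  let Λ : Submodule ℤ (ι → ℝ) := Submodule.span ℤ (Set.range (Pi.basisFun ℝ ι))
  let k := Module.finrank ℤ Λ + 1
  have hs : Summable fun z : Λ => (‖z‖ ^ k)⁻¹ := by
    simpa only [inv_pow] using ZLattice.summable_norm_pow_inv Λ k (by omega)
  have hmem : ∀ n : ι → ℤ, intVec n ∈ Λ := fun n => by
    have : intVec n = ∑ i, n i • Pi.basisFun ℝ ι i := by
      ext j; simp [intVec, Pi.single_apply, Finset.sum_apply]
    rw [this]
    exact Submodule.sum_mem _ fun i _ => Submodule.smul_mem _ _ (Submodule.subset_span ⟨i, rfl⟩)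
  have hinj : Function.Injective fun n : ι → ℤ => (⟨intVec n, hmem n⟩ : Λ) := by
    intro m n h
    funext i
    have := congrFun (congrArg Subtype.val h) i
    simpa [intVec] using this
  -- The comparison fails only at n = 0, where the inverse of ‖n‖ᵏ is 0 by convention.
  refine ⟨k, (hs.comp_injective hinj).of_norm_bounded_eventually ?_⟩
  rw [Filter.eventually_cofinite]
  refine (Set.finite_singleton (0 : ι → ℤ)).subset fun n hn => ?_
  by_contra h0
  apply hn
  have hne : 0 < ‖intVec n‖ := by
    rw [norm_pos_iff]
    intro h
    apply h0
    funext i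
    simpa [intVec] using congrFun h i
  rw [Real.norm_of_nonneg (by positivity)]
  simp only [Function.comp_apply, Submodule.coe_norm]
  gcongr
  linarith

/-- A bound for the translates of a rapidly decaying function that is uniform on balls. -/
theorem RapidDecay.exists_summable_bound {f : (ι → ℝ) → ℂ} (hf : RapidDecay f) (R : ℝ) :
    ∃ u : (ι → ℤ) → ℝ, Summable u ∧ ∀ x, ‖x‖ ≤ R → ∀ n, ‖f (x + intVec n)‖ ≤ u n := by
  obtain ⟨k, hk⟩ := summable_one_add_norm_intVec (ι := ι)
  obtain ⟨C, hC⟩ := hf.bound k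
  have hC0 : 0 ≤ C := by simpa using (norm_nonneg _).trans (hC 0)
  refine ⟨_, hk.mul_left (C * (1 + R) ^ k), fun x hx n => (hC _).trans ?_⟩
  have h1 : 1 + ‖intVec n‖ ≤ (1 + R) * (1 + ‖x + intVec n‖) := by
    have h2 : ‖intVec n‖ ≤ ‖x + intVec n‖ + ‖x‖ := by
      simpa using norm_sub_le (x + intVec n) x
    have := norm_nonneg (x + intVec n)
    have := norm_nonneg x
    nlinarith
  have hR : 0 ≤ R := (norm_nonneg x).trans hx
  rw [mul_assoc]
  gcongr
  rw [← div_eq_mul_inv, le_div_iff₀ (by positivity), inv_mul_le_iff₀ (by positivity), mul_comm,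
    ← mul_pow]
  gcongr

theorem RapidDecay.summable {f : (ι → ℝ) → ℂ} (hf : RapidDecay f) (x : ι → ℝ) :
    Summable fun n : ι → ℤ => f (x + intVec n) := by
  obtain ⟨u, hu, h⟩ := hf.exists_summable_bound ‖x‖
  exact hu.of_norm_bounded (h x le_rfl)

theorem RapidDecay.continuous_tsum {f : (ι → ℝ) → ℂ} (hf : RapidDecay f) :
    Continuous fun x => ∑' n : ι → ℤ, f (x + intVec n) := by
  rw [continuous_iff_continuousAt]
  intro x
  obtain ⟨u, hu, h⟩ := hf.exists_summable_bound (‖x‖ + 1)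
  have hc : ContinuousOn (fun x => ∑' n : ι → ℤ, f (x + intVec n))
      (Metric.closedBall 0 (‖x‖ + 1)) := by
    refine continuousOn_tsum (fun n => ?_) hu fun n y hy => h y (by simpa using hy) n
    exact (hf.1.comp (continuous_id.add continuous_const)).continuousOn
  refine hc.continuousAt (Metric.closedBall_mem_nhds_of_mem ?_)
  simp

/-- The half-open unit cube at an integral vector. -/
def unitCube (m : ι → ℤ) : Set (ι → ℝ) := {x | ∀ i, x i ∈ Set.Ioc (m i : ℝ) (m i + 1)}

theorem measurableSet_unitCube (m : ι → ℤ) : MeasurableSet (unitCube m) :=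
  MeasurableSet.univ_pi' fun _ => measurableSet_Ioc

theorem mem_unitCube {ι : Type*} {m : ι → ℤ} {x : ι → ℝ} : x ∈ unitCube m ↔ m = fun i => ⌈x i⌉ - 1 := by
  simp only [unitCube, Set.mem_ofPred_eq, Set.mem_Ioc, funext_iff]
  refine forall_congr' fun i => ?_
  rw [eq_sub_iff_add_eq, eq_comm, Int.ceil_eq_iff]
  push_cast
  simp

theorem iUnion_unitCube {ι : Type*} : ⋃ m : ι → ℤ, unitCube m = Set.univ := by
  ext x; simp [mem_unitCube]

theorem disjoint_unitCube {ι : Type*} : Pairwise (Function.onFun Disjoint (unitCube (ι := ι))) := by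
  intro m n hmn
  rw [Function.onFun, Set.disjoint_left]
  intro x hm hn
  exact hmn ((mem_unitCube.1 hm).trans (mem_unitCube.1 hn).symm)

/-- The translates of the half-open cube tile ℝⁿ, so an integral over ℝⁿ unfolds into integrals of
translates over one cube. -/
theorem hasSum_integral_unitCube {E : Type*} [NormedAddCommGroup E] [NormedSpace ℝ E]
    {h : (ι → ℝ) → E} (hh : Integrable h) :
    HasSum (fun m : ι → ℤ => ∫ x in unitCube 0, h (x + intVec m)) (∫ x, h x) := by
  have key := hasSum_integral_iUnion (μ := volume) (f := h)
    (measurableSet_unitCube (ι := ι)) disjoint_unitCube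
    (by rw [iUnion_unitCube, integrableOn_univ]; exact hh)
  rw [iUnion_unitCube, setIntegral_univ] at key
  convert key using 2 with m
  have hp := measurePreserving_add_right (volume : Measure (ι → ℝ)) (intVec m)
  have := hp.setIntegral_preimage_emb (measurableEmbedding_addRight (intVec m)) h (unitCube m)
  rw [← this]
  congr 2
  ext x
  simp [unitCube, intVec, add_comm _ (1 : ℝ)]

/-- **Poisson summation** on `ℝⁿ`. -/
theorem RapidDecay.poisson {f : (ι → ℝ) → ℂ} (hf : RapidDecay f)
    (hF : Summable fun n : ι → ℤ => ∫ x, expi (-∑ i, (n i : ℂ) * x i) * f x) :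
    ∑' n : ι → ℤ, f (intVec n) = ∑' n : ι → ℤ, ∫ x, expi (-∑ i, (n i : ℂ) * x i) * f x := by
  let π : (ι → ℝ) → UnitAddTorus ι := fun x i => (x i : UnitAddCircle)
  have hπ : IsOpenQuotientMap π :=
    IsOpenQuotientMap.piMap fun _ => QuotientAddGroup.isOpenQuotientMap_mk
  let F : (ι → ℝ) → ℂ := fun x => ∑' n : ι → ℤ, f (x + intVec n)
  have hFper : ∀ x y, π x = π y → F x = F y := by
    intro x y hxy
    have : ∀ i, ∃ m : ℤ, y i = x i + m := fun i => by
      have h := congrFun hxy i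
      rw [QuotientAddGroup.eq] at h
      obtain ⟨m, hm⟩ := AddSubgroup.mem_zmultiples_iff.1 h
      exact ⟨m, by simp at hm; linarith⟩
    choose m hm using this
    have hy : y = x + intVec m := funext hm
    rw [hy]
    change ∑' n, f (x + intVec n) = ∑' n, f (x + intVec m + intVec n)
    rw [← (Equiv.addLeft m).tsum_eq]
    refine tsum_congr fun n => congrArg f ?_
    ext i
    simp [intVec, add_assoc]
  -- The periodization descends to the torus: `hFper` makes the chosen lift irrelevant, and the
  -- quotient map carries continuity over.
  let G : UnitAddTorus ι → ℂ := fun t => F (hπ.surjective t).choose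
  have hG : ∀ x, G (π x) = F x := fun x => hFper _ _ (hπ.surjective (π x)).choose_spec
  have hGc : Continuous G := by
    rw [hπ.isQuotientMap.continuous_iff]
    exact hf.continuous_tsum.congr fun x => (hG x).symm
  have hchar : ∀ (n : ι → ℤ) (x : ι → ℝ),
      UnitAddTorus.mFourier (-n) (π x) = expi (-∑ i, (n i : ℂ) * x i) := by
    intro n x
    simp only [UnitAddTorus.mFourier, ContinuousMap.coe_mk, π, fourier_coe_apply, expi,
      ← Complex.exp_sum, Pi.neg_apply]
    congr 1
    rw [← Finset.sum_neg_distrib, Finset.mul_sum]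
    refine Finset.sum_congr rfl fun i _ => ?_
    push_cast
    simp
    ring
  have hcoeff : ∀ n, UnitAddTorus.mFourierCoeff G n =
      ∫ x, expi (-∑ i, (n i : ℂ) * x i) * f x := by
    intro n
    rw [UnitAddTorus.mFourierCoeff_eq_integral G n 0]
    let h : (ι → ℝ) → ℂ := fun x => expi (-∑ i, (n i : ℂ) * x i) * f x
    have hnorm : ∀ x : ι → ℝ, ‖expi (-∑ i, (n i : ℂ) * x i)‖ = 1 := by
      intro x
      rw [norm_expi]
      simp
    have hcont : Continuous fun x : ι → ℝ => expi (-∑ i, (n i : ℂ) * x i) := by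
      unfold expi; fun_prop
    have hh : Integrable h :=
      (hf.mul_of_bound hcont 0 1 fun x => by rw [hnorm x]; simp).integrable
    have h1 := hasSum_integral_unitCube hh
    have h2 := hasSum_integral_unitCube hh.norm
    have hper : ∀ (x : ι → ℝ) (m : ι → ℤ), h (x + intVec m) =
        expi (-∑ i, (n i : ℂ) * x i) * f (x + intVec m) := by
      intro x m
      simp only [h]
      congr 1
      rw [← hchar, ← hchar]
      congr 1
      funext i
      simp [π, intVec]
    have hset : {x : ι → ℝ | ∀ i, x i ∈ Set.Ioc ((0 : ι → ℝ) i) ((0 : ι → ℝ) i + 1)} =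
        unitCube 0 := by
      ext x; simp [unitCube]
    rw [hset]
    -- Sum and integral may be exchanged because the L¹ norms over the translated cubes add up to
    -- the L¹ norm over ℝⁿ.
    have h3 := hasSum_integral_of_summable_integral_norm (μ := volume.restrict (unitCube 0))
      (F := fun (m : ι → ℤ) x => h (x + intVec m))
      (fun m => (hh.comp_add_right (intVec m)).integrableOn) h2.summable
    rw [h1.unique h3]
    refine integral_congr_ae (Filter.Eventually.of_forall fun x => ?_)
    simp only
    rw [show (fun i => ((x i : ℝ) : UnitAddCircle)) = π x from rfl, hG, hchar, smul_eq_mul,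
      ← tsum_mul_left]
    exact tsum_congr fun m => (hper x m).symm
  have hsum : Summable (UnitAddTorus.mFourierCoeff G) := by
    rw [show UnitAddTorus.mFourierCoeff G = _ from funext hcoeff]; exact hF
  -- Summable Fourier coefficients make the Fourier series of the continuous periodization converge
  -- to it pointwise; Poisson's formula is its value at 0. No smoothness of `f` is needed.
  have := (UnitAddTorus.hasSum_mFourier_series_apply_of_summable (f := ⟨G, hGc⟩) hsum
    (π 0)).tsum_eq
  simp only [ContinuousMap.coe_mk, hG] at this
  rw [show F 0 = ∑' n : ι → ℤ, f (intVec n) from tsum_congr fun n => by rw [zero_add]] at this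
  rw [← this]
  refine tsum_congr fun n => ?_
  rw [hcoeff]
  have : UnitAddTorus.mFourier n (π 0) = 1 := by
    simp [UnitAddTorus.mFourier, π]
  rw [this, smul_eq_mul, mul_one]

end Poisson

/-! ### Fourier transforms of polynomials times Gaussians -/

section GaussianFourier

open MeasureTheory MvPolynomial

variable {σ : Type*} [Fintype σ]

/-- The value of a complex polynomial at a real point. -/
def evalR (x : σ → ℝ) (P : MvPolynomial σ ℂ) : ℂ := eval (fun p => (x p : ℂ)) P

theorem RapidDecay.evalR_mul {g : (σ → ℝ) → ℂ} (hg : RapidDecay g) (P : MvPolynomial σ ℂ) :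
    RapidDecay fun x => evalR x P * g x := by
  induction P using MvPolynomial.induction_on with
  | C z =>
    simp only [evalR, eval_C]
    exact hg.mul_of_bound continuous_const 0 ‖z‖ fun x => by simp
  | add P Q hP hQ =>
    simp only [evalR, map_add, add_mul]
    exact hP.add hQ
  | mul_X P r hP =>
    have h := hP.mul_of_bound (g := fun x => ((x r : ℝ) : ℂ)) (by fun_prop) 1 1 fun x => by
      rw [Complex.norm_real, pow_one, one_mul]
      have := norm_le_pi_norm x r
      linarith
    convert h using 2 with x
    simp only [evalR, map_mul, eval_X]
    ring

theorem hasDerivAt_eval_line (a c : σ → ℂ) (P : MvPolynomial σ ℂ) (t : ℝ) :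
    HasDerivAt (fun t : ℝ => eval (fun p => a p + t * c p) P)
      (∑ s, c s * eval (fun p => a p + t * c p) (pderiv s P)) t := by
  classical
  induction P using MvPolynomial.induction_on with
  | C z => simpa using hasDerivAt_const t z
  | add P Q hP hQ =>
    simp only [map_add, mul_add, Finset.sum_add_distrib]
    exact hP.add hQ
  | mul_X P r hP =>
    have hX : HasDerivAt (fun t : ℝ => a r + t * c r) (c r) t := by
      simpa using ((Complex.ofRealCLM.hasDerivAt (x := t)).mul_const (c r)).const_add (a r)
    simp only [map_mul, eval_X]
    refine (hP.mul hX).congr_deriv ?_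
    simp only [Derivation.leibniz, pderiv_X, Pi.single_apply, smul_eq_mul, map_add, map_mul,
      eval_X, mul_add, Finset.sum_add_distrib]
    rw [add_comm]
    congr 1
    · simp [apply_ite (eval _), mul_comm]
    · rw [← mul_add, Finset.sum_mul]
      exact Finset.sum_congr rfl fun s _ => by ring

/-- Multiplication by a coordinate corresponds to a derivative of the Fourier transform. -/
theorem RapidDecay.hasDerivAt_fourier [DecidableEq σ] {h : (σ → ℝ) → ℂ} (hh : RapidDecay h)
    (ξ : σ → ℝ) (r : σ) :
    HasDerivAt (fun t : ℝ => ∫ x, h x * expi (-∑ p, (x p : ℂ) * ((ξ + t • Pi.single r 1 : σ → ℝ) p : ℝ)))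
      (-(2 * Real.pi * Complex.I) *
        ∫ x, (x r : ℂ) * h x * expi (-∑ p, (x p : ℂ) * (ξ p : ℝ))) 0 := by
  have hE : ∀ (t : ℝ) (x : σ → ℝ), expi (-∑ p, (x p : ℂ) * ((ξ + t • Pi.single r 1 : σ → ℝ) p : ℝ)) =
      expi (-∑ p, (x p : ℂ) * (ξ p : ℝ)) * expi (-(t * x r)) := by
    intro t x
    rw [← expi_add]
    congr 1
    simp [mul_add, Finset.sum_add_distrib, Pi.single_apply, apply_ite Complex.ofReal]
    ring
  have hn : ∀ r : ℝ, ‖expi (r : ℂ)‖ = 1 := fun r => by rw [norm_expi]; simp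
  have hn1 : ∀ x : σ → ℝ, ‖expi (-∑ p, (x p : ℂ) * (ξ p : ℝ))‖ = 1 := fun x => by
    rw [norm_expi]; simp
  have hn2 : ∀ (t : ℝ) (x : σ → ℝ), ‖expi (-(t * x r))‖ = 1 := fun t x => by
    rw [norm_expi]; simp
  have hce : Continuous fun x : σ → ℝ => expi (-∑ p, (x p : ℂ) * (ξ p : ℝ)) := by
    unfold expi; fun_prop
  have hX : RapidDecay fun x => (x r : ℂ) * h x :=
    hh.mul_of_bound (by fun_prop) 1 1 fun x => by
      rw [Complex.norm_real, pow_one, one_mul]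
      have := norm_le_pi_norm x r
      linarith
  have h0 : RapidDecay fun x => expi (-∑ p, (x p : ℂ) * (ξ p : ℝ)) * h x :=
    hh.mul_of_bound hce 0 1 fun x => by rw [hn1]; simp
  have hct : ∀ t : ℝ, Continuous fun x : σ → ℝ => expi (-(t * x r)) := fun t => by
    unfold expi; fun_prop
  have key := hasDerivAt_integral_of_dominated_loc_of_deriv_le (μ := volume) (𝕜 := ℝ)
    (F := fun t x => h x * (expi (-∑ p, (x p : ℂ) * (ξ p : ℝ)) * expi (-(t * x r))))
    (F' := fun t x => -(2 * Real.pi * Complex.I) *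
      ((x r : ℂ) * h x * (expi (-∑ p, (x p : ℂ) * (ξ p : ℝ)) * expi (-(t * x r)))))
    (x₀ := (0 : ℝ)) (s := Set.univ) (bound := fun x => 2 * Real.pi * ‖(x r : ℂ) * h x‖)
    Filter.univ_mem
    (Filter.Eventually.of_forall fun t => (hh.1.mul (hce.mul (hct t))).aestronglyMeasurable)
    (h0.integrable.congr (Filter.Eventually.of_forall fun x => by
      simp only [Complex.ofReal_zero, zero_mul, neg_zero]
      rw [show expi 0 = 1 by simp [expi]]; ring))
    ((continuous_const.mul (hX.1.mul (hce.mul (hct 0)))).aestronglyMeasurable)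
    (Filter.Eventually.of_forall fun x t _ => by
      rw [norm_mul, norm_mul _ (expi _ * _), norm_mul (expi _), hn1, hn2]
      simp [abs_of_pos Real.pi_pos])
    (hX.integrable.norm.const_mul _)
    (Filter.Eventually.of_forall fun x t _ => by
      have h1 : HasDerivAt (fun t : ℝ => 2 * Real.pi * Complex.I * (-((t : ℂ) * x r)))
          (-(2 * Real.pi * Complex.I) * x r) t := by
        have := ((Complex.ofRealCLM.hasDerivAt (x := t)).mul_const (x r : ℂ)).neg.const_mul
          (2 * Real.pi * Complex.I)
        refine this.congr_deriv ?_
        simp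
      have h2 := (h1.cexp.const_mul (expi (-∑ p, (x p : ℂ) * (ξ p : ℝ)))).const_mul (h x)
      refine h2.congr_deriv ?_
      simp only [expi]
      ring)
  have h2 := key.2
  simp only [integral_const_mul, Complex.ofReal_zero, zero_mul, neg_zero] at h2
  rw [show expi 0 = 1 by simp [expi]] at h2
  simp only [mul_one] at h2
  simpa only [hE] using h2

/-- The Fourier transform of a polynomial times a Gaussian function. -/
theorem RapidDecay.fourier_evalR_mul {g : (σ → ℝ) → ℂ} (hg : RapidDecay g) (W : Matrix σ σ ℂ)
    (hW : ∀ p s, W p s = W s p) (c : ℂ)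
    (hbase : ∀ ξ : σ → ℝ, ∫ x, g x * expi (-∑ p, (x p : ℂ) * (ξ p : ℝ)) =
      c * Complex.exp (-Real.pi * ∑ p, ∑ s, W p s * (ξ p * ξ s)))
    (P : MvPolynomial σ ℂ) : ∀ ξ : σ → ℝ,
    ∫ x, evalR x P * g x * expi (-∑ p, (x p : ℂ) * (ξ p : ℝ)) =
      c * eval (fun p => -Complex.I * ∑ s, W p s * ξ s) (expDL ((1 / (4 * Real.pi) : ℂ) • W) P) *
        Complex.exp (-Real.pi * ∑ p, ∑ s, W p s * (ξ p * ξ s)) := by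
  classical
  have ha : ∀ p s, ((1 / (4 * Real.pi) : ℂ) • W) p s = ((1 / (4 * Real.pi) : ℂ) • W) s p :=
    fun p s => by simp [hW p s]
  induction P using MvPolynomial.induction_on with
  | C z =>
    intro ξ
    simp only [evalR, eval_C, expDL_C, mul_assoc, integral_const_mul, hbase]
    ring
  | add P Q hP hQ =>
    intro ξ
    have hce : Continuous fun x : σ → ℝ => expi (-∑ p, (x p : ℂ) * (ξ p : ℝ)) := by
      unfold expi; fun_prop
    have hi : ∀ R : MvPolynomial σ ℂ,
        Integrable fun x => evalR x R * g x * expi (-∑ p, (x p : ℂ) * (ξ p : ℝ)) := fun R =>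
      ((hg.evalR_mul R).mul_of_bound hce 0 1 fun x => by
        rw [norm_expi]; simp).integrable.congr
          (Filter.Eventually.of_forall fun x => mul_comm _ _)
    have h1 : ∀ x, evalR x (P + Q) * g x * expi (-∑ p, (x p : ℂ) * (ξ p : ℝ)) =
        evalR x P * g x * expi (-∑ p, (x p : ℂ) * (ξ p : ℝ)) +
        evalR x Q * g x * expi (-∑ p, (x p : ℂ) * (ξ p : ℝ)) := fun x => by
      simp only [evalR, map_add, add_mul]
    simp only [h1]
    rw [integral_add (hi P) (hi Q), hP, hQ, map_add, map_add]
    ring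
  | mul_X P r hP =>
    intro ξ
    -- A factor `x r` under the integral is, up to -2πi, a ξᵣ-derivative of the transform.
    -- Differentiating the known formula for P in that direction and comparing the two derivatives
    -- gives the formula for P · Xᵣ.
    have hd := (hg.evalR_mul P).hasDerivAt_fourier ξ r
    simp only [hP] at hd
    set Q := expDL ((1 / (4 * Real.pi) : ℂ) • W) P with hQ
    have hline : ∀ t : ℝ, (fun p => -Complex.I * ∑ s, W p s *
        ((ξ + t • Pi.single r 1 : σ → ℝ) s : ℂ)) =
        fun p => (-Complex.I * ∑ s, W p s * ξ s) + t * (-Complex.I * W p r) := by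
      intro t
      funext p
      simp [mul_add, Finset.sum_add_distrib, Pi.single_apply, apply_ite Complex.ofReal]
      ring
    have hquad : ∀ t : ℝ, ∑ p, ∑ s, W p s * (((ξ + t • Pi.single r 1 : σ → ℝ) p : ℂ) *
        ((ξ + t • Pi.single r 1 : σ → ℝ) s : ℂ)) =
        ∑ p, ∑ s, W p s * (ξ p * ξ s) + t * (2 * ∑ s, W r s * ξ s) + t ^ 2 * W r r := by
      intro t
      have h1 : ∑ p, W p r * (ξ p : ℂ) = ∑ s, W r s * ξ s :=
        Finset.sum_congr rfl fun p _ => by rw [hW]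
      have h2 : ∀ p s, W p s * (((ξ + t • Pi.single r 1 : σ → ℝ) p : ℂ) *
        ((ξ + t • Pi.single r 1 : σ → ℝ) s : ℂ)) = W p s * (ξ p * ξ s) +
          (if p = r then t * (W p s * ξ s) else 0) + (if s = r then t * (W p s * ξ p) else 0) +
          (if p = r then (if s = r then t ^ 2 * W p s else 0) else 0) := by
        intro p s
        simp only [Pi.add_apply, Pi.smul_apply, Pi.single_apply, smul_eq_mul]
        split_ifs <;> push_cast <;> ring
      simp only [h2, Finset.sum_add_distrib, Finset.sum_ite_irrel, Finset.sum_const_zero,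
        Finset.sum_ite_eq', Finset.mem_univ, if_true, ← Finset.mul_sum, h1]
      ring
    simp only [hline, hquad] at hd
    have he := (hasDerivAt_eval_line (fun p => -Complex.I * ∑ s, W p s * ξ s)
      (fun p => -Complex.I * W p r) Q 0)
    have hq : HasDerivAt (fun t : ℝ => -(Real.pi : ℂ) * (∑ p, ∑ s, W p s * (ξ p * ξ s) +
        t * (2 * ∑ s, W r s * ξ s) + t ^ 2 * W r r))
        (-(Real.pi : ℂ) * (2 * ∑ s, W r s * ξ s)) 0 := by
      have ht := Complex.ofRealCLM.hasDerivAt (x := (0 : ℝ))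
      have := (((ht.mul_const (2 * ∑ s, W r s * ξ s)).const_add
        (∑ p, ∑ s, W p s * (ξ p * ξ s))).add ((ht.pow 2).mul_const (W r r))).const_mul
          (-(Real.pi : ℂ))
      refine this.congr_deriv ?_
      simp
    have hu := hd.unique ((he.const_mul c).mul hq.cexp)
    simp only [Complex.ofReal_zero, zero_mul, add_zero, ne_eq, OfNat.ofNat_ne_zero,
      not_false_eq_true, zero_pow] at hu
    have hI : -(2 * Real.pi * Complex.I) ≠ 0 := by simp [Real.pi_ne_zero]
    have hlhs : ∀ x, evalR x (P * X r) * g x = (x r : ℂ) * (evalR x P * g x) := fun x => by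
      simp only [evalR, map_mul, eval_X]; ring
    simp only [hlhs]
    apply mul_left_cancel₀ hI
    -- Differentiating the exponential yields the variable evaluated at -i(Wξ)ᵣ; differentiating the
    -- polynomial yields the first-order term of `expDL_X_mul`.
    rw [hu, mul_comm P, expDL_X_mul _ ha, ← hQ]
    simp only [map_add, map_mul, map_sum, eval_X, smul_eval, Finset.mul_sum, Finset.sum_mul,
      mul_add, add_mul, Matrix.smul_apply, smul_eq_mul, hW r]
    rw [add_comm]
    have hpi : (Real.pi : ℂ) ≠ 0 := by simp [Real.pi_ne_zero]
    congr 1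
    · refine Finset.sum_congr rfl fun s _ => ?_
      ring_nf
      rw [Complex.I_sq]
      ring
    · refine Finset.sum_congr rfl fun s _ => ?_
      field_simp
      ring

end GaussianFourier

/-! ### Gaussians of points of the Siegel upper half space -/

section SiegelGaussian

open MeasureTheory

/-- The value of the quadratic form with symmetric matrix `M`. -/
def quadVal (M : Matrix (Fin 2) (Fin 2) ℂ) (u : Fin 2 → ℝ) : ℂ := ∑ j, ∑ k, M j k * (u j * u k)

theorem norm_sq_le_sum {σ : Type*} [Fintype σ] (x : σ → ℝ) : ‖x‖ ^ 2 ≤ ∑ p, x p ^ 2 := by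
  have h0 : 0 ≤ ∑ p, x p ^ 2 := Finset.sum_nonneg fun p _ => sq_nonneg _
  have h : ‖x‖ ≤ Real.sqrt (∑ p, x p ^ 2) := by
    rw [pi_norm_le_iff_of_nonneg (Real.sqrt_nonneg _)]
    intro p
    rw [Real.norm_eq_abs]
    refine Real.abs_le_sqrt ?_
    exact Finset.single_le_sum (f := fun p => x p ^ 2) (fun p _ => sq_nonneg _) (Finset.mem_univ p)
  calc ‖x‖ ^ 2 ≤ Real.sqrt (∑ p, x p ^ 2) ^ 2 := by gcongr
    _ = _ := Real.sq_sqrt h0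

theorem rapidDecay_of_gaussian_bound {σ : Type*} [Fintype σ] {g : (σ → ℝ) → ℂ}
    (hg : Continuous g) (ε : ℝ) (hε : 0 < ε) (h : ∀ x, ‖g x‖ ≤ Real.exp (-ε * ∑ p, x p ^ 2)) :
    RapidDecay g := by
  -- The maximum of Nr - εr² over real r is N²/(4ε).
  refine ⟨hg, fun N => ⟨Real.exp (N ^ 2 / (4 * ε)), fun x => ?_⟩⟩
  have h1 : (1 + ‖x‖) ^ N ≤ Real.exp (N * ‖x‖) := by
    rw [Real.exp_nat_mul]
    gcongr
    rw [add_comm]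
    exact Real.add_one_le_exp _
  calc (1 + ‖x‖) ^ N * ‖g x‖ ≤ Real.exp (N * ‖x‖) * Real.exp (-ε * ∑ p, x p ^ 2) := by
        gcongr; exact h x
    _ = Real.exp (N * ‖x‖ + -ε * ∑ p, x p ^ 2) := (Real.exp_add _ _).symm
    _ ≤ Real.exp (N ^ 2 / (4 * ε)) := by
        rw [Real.exp_le_exp]
        have h2 := mul_le_mul_of_nonneg_left (norm_sq_le_sum x) hε.le
        rw [le_div_iff₀ (by positivity)]
        nlinarith [sq_nonneg ((N : ℝ) - 2 * ε * ‖x‖)]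

theorem HH2.symm (τ : HH2) : τ.1 1 0 = τ.1 0 1 := congrFun (congrFun τ.2.1 0) 1

theorem quadVal_im (τ : HH2) (u : Fin 2 → ℝ) : (quadVal τ.1 u).im =
    (τ.1 0 0).im * u 0 ^ 2 + 2 * (τ.1 0 1).im * (u 0 * u 1) + (τ.1 1 1).im * u 1 ^ 2 := by
  simp only [quadVal, Fin.sum_univ_two, HH2.symm, Complex.add_im, Complex.mul_im,
    ← Complex.ofReal_mul, Complex.ofReal_re, Complex.ofReal_im]
  ring

theorem exists_quadVal_im_ge (τ : HH2) :
    ∃ ε : ℝ, 0 < ε ∧ ∀ u : Fin 2 → ℝ, ε * (u 0 ^ 2 + u 1 ^ 2) ≤ (quadVal τ.1 u).im := by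
  have h0 : 0 < (τ.1 0 0).im := τ.2.2.diag_pos (i := 0)
  have h1 : 0 < (τ.1 1 1).im := τ.2.2.diag_pos (i := 1)
  have hd := τ.2.2.det_pos
  rw [Matrix.det_fin_two] at hd
  simp only [imPart, Matrix.map_apply, HH2.symm] at hd
  set a := (τ.1 0 0).im
  set c := (τ.1 0 1).im
  set d := (τ.1 1 1).im
  -- Determinant over trace is a lower bound for the smaller eigenvalue. Multiplied by the trace,
  -- the difference is (a u₀ + c u₁)² + (c u₀ + d u₁)².
  refine ⟨(a * d - c * c) / (a + d), by positivity, fun u => ?_⟩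
  rw [quadVal_im, div_mul_eq_mul_div, div_le_iff₀ (by positivity)]
  nlinarith [sq_nonneg (a * u 0 + c * u 1), sq_nonneg (c * u 0 + d * u 1)]

theorem norm_cexp_quadVal (M : Matrix (Fin 2) (Fin 2) ℂ) (u : Fin 2 → ℝ) :
    ‖Complex.exp (Real.pi * Complex.I * quadVal M u)‖ = Real.exp (-Real.pi * (quadVal M u).im) := by
  rw [Complex.norm_exp]
  simp

theorem continuous_quadVal (M : Matrix (Fin 2) (Fin 2) ℂ) : Continuous (quadVal M) := by
  unfold quadVal; fun_prop

theorem rapidDecay_cexp_quadVal (τ : HH2) :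
    RapidDecay fun u : Fin 2 → ℝ => Complex.exp (Real.pi * Complex.I * quadVal τ.1 u) := by
  obtain ⟨ε, hε, h⟩ := exists_quadVal_im_ge τ
  refine rapidDecay_of_gaussian_bound
    (Complex.continuous_exp.comp (continuous_const.mul (continuous_quadVal _)))
    (Real.pi * ε) (by positivity) fun u => ?_
  rw [norm_cexp_quadVal, Real.exp_le_exp, Fin.sum_univ_two]
  have := mul_le_mul_of_nonneg_left (h u) Real.pi_pos.le
  linarith

/-- For z in the upper half plane, arg i - arg z lies in (-π/2, π/2), so the principal logarithm of
i/z splits without a jump. -/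
theorem cpow_half_I_div {z : ℂ} (hz : 0 < z.im) :
    (Complex.I / z) ^ (1 / 2 : ℂ) = Complex.I ^ (1 / 2 : ℂ) / z ^ (1 / 2 : ℂ) := by
  have hz0 : z ≠ 0 := fun h => by simp [h] at hz
  have h1 := Complex.arg_lt_pi_iff.2 (Or.inr hz.ne')
  have h2 : 0 < z.arg := by
    rcases (Complex.arg_nonneg_iff.2 hz.le).lt_or_eq with h | h
    · exact h
    · exact absurd (Complex.arg_eq_zero_iff.1 h.symm).2 hz.ne'
  have hlog : Complex.log (Complex.I / z) = Complex.log Complex.I - Complex.log z := by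
    rw [div_eq_mul_inv, (Complex.log_mul_eq_add_log_iff Complex.I_ne_zero (inv_ne_zero hz0)).2,
      Complex.log_inv _ h1.ne, sub_eq_add_neg]
    rw [Complex.arg_inv, if_neg h1.ne, Complex.arg_I, Set.mem_Ioc]
    constructor <;> linarith
  rw [Complex.cpow_def_of_ne_zero (div_ne_zero Complex.I_ne_zero hz0),
    Complex.cpow_def_of_ne_zero Complex.I_ne_zero, Complex.cpow_def_of_ne_zero hz0, hlog,
    ← Complex.exp_sub, sub_mul]

theorem integral_cexp_pi_I {z : ℂ} (hz : 0 < z.im) (c d : ℂ) :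
    ∫ x : ℝ, Complex.exp (Real.pi * Complex.I * (z * x ^ 2 + 2 * c * x + d)) =
      Complex.I ^ (1 / 2 : ℂ) / z ^ (1 / 2 : ℂ) *
        Complex.exp (Real.pi * Complex.I * (d - c ^ 2 / z)) := by
  have hz0 : z ≠ 0 := fun h => by simp [h] at hz
  have hpi : (Real.pi : ℂ) ≠ 0 := by simp [Real.pi_ne_zero]
  have h := integral_cexp_quadratic (b := Real.pi * Complex.I * z)
    (by simp; positivity) (Real.pi * Complex.I * (2 * c)) (Real.pi * Complex.I * d)
  rw [← cpow_half_I_div hz]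
  have h1 : (Real.pi : ℂ) / -(Real.pi * Complex.I * z) = Complex.I / z := by
    rw [div_eq_div_iff (by simp [hpi, hz0]) hz0]
    linear_combination ((Real.pi : ℂ) * z) * Complex.I_sq
  have h2 : (Real.pi * Complex.I * d - (Real.pi * Complex.I * (2 * c)) ^ 2 /
      (4 * (Real.pi * Complex.I * z)) : ℂ) = Real.pi * Complex.I * (d - c ^ 2 / z) := by
    have := Complex.I_ne_zero
    field_simp
    ring
  rw [h1, h2] at h
  rw [← h]
  congr 1
  funext x
  congr 1
  ring

/-- The Fourier transform of a Gaussian function on `ℝ²` with a matrix of the Siegel upper half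
space. -/
theorem fourier_cexp_quadVal (τ : HH2) (ξ : Fin 2 → ℝ) :
    ∫ u : Fin 2 → ℝ, Complex.exp (Real.pi * Complex.I * quadVal τ.1 u) *
      expi (-∑ p, (u p : ℂ) * (ξ p : ℝ)) =
      Complex.I / sqrtDet τ * Complex.exp (Real.pi * Complex.I * quadVal (-(τ.1)⁻¹) ξ) := by
  have hz := im_pos_aux τ
  have hd := im_div_pos τ
  have hz0 : τ.1 0 0 ≠ 0 := fun h => by simp [h] at hz
  have hd0 : τ.1.det ≠ 0 := fun h => by simp [h] at hd
  have hce : Continuous fun u : Fin 2 → ℝ => expi (-∑ p, (u p : ℂ) * (ξ p : ℝ)) := by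
    unfold expi; fun_prop
  have hint : Integrable fun u : Fin 2 → ℝ =>
      Complex.exp (Real.pi * Complex.I * quadVal τ.1 u) * expi (-∑ p, (u p : ℂ) * (ξ p : ℝ)) :=
    ((rapidDecay_cexp_quadVal τ).mul_of_bound hce 0 1 fun x => by
      rw [norm_expi]; simp).integrable.congr (Filter.Eventually.of_forall fun x => mul_comm _ _)
  have hmp := (volume_preserving_finTwoArrow ℝ).symm
  rw [← hmp.integral_comp', Measure.volume_eq_prod, integral_prod_symm]
  swap
  · exact (hmp.integrable_comp_emb (MeasurableEquiv.measurableEmbedding _)).2 hint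
  -- Completing the square in the first variable leaves det τ / τ₁₁ as the quadratic coefficient of
  -- the second. These are exactly the two numbers whose principal roots define `sqrtDet`, so the
  -- branch comes out right with no further argument.
  have hinner : ∀ t : ℝ, ∫ s : ℝ, (Complex.exp (Real.pi * Complex.I * quadVal τ.1
        ((MeasurableEquiv.finTwoArrow (α := ℝ)).symm (s, t))) *
      expi (-∑ p, (((MeasurableEquiv.finTwoArrow (α := ℝ)).symm (s, t)) p : ℂ) * (ξ p : ℝ))) =
      Complex.I ^ (1 / 2 : ℂ) / (τ.1 0 0) ^ (1 / 2 : ℂ) *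
        Complex.exp (Real.pi * Complex.I * (τ.1.det / τ.1 0 0 * t ^ 2 +
          2 * (τ.1 0 1 * ξ 0 / τ.1 0 0 - ξ 1) * t + -(ξ 0 : ℂ) ^ 2 / τ.1 0 0)) := by
    intro t
    have h := integral_cexp_pi_I hz (τ.1 0 1 * t - ξ 0) (τ.1 1 1 * t ^ 2 - 2 * t * ξ 1)
    have e1 : (τ.1 1 1 * t ^ 2 - 2 * t * ξ 1 - (τ.1 0 1 * t - ξ 0) ^ 2 / τ.1 0 0 : ℂ) =
        τ.1.det / τ.1 0 0 * t ^ 2 +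
          2 * (τ.1 0 1 * ξ 0 / τ.1 0 0 - ξ 1) * t + -(ξ 0 : ℂ) ^ 2 / τ.1 0 0 := by
      rw [Matrix.det_fin_two, HH2.symm]
      field_simp
      ring
    rw [← e1, ← h]
    congr 1
    funext s
    simp only [expi]
    rw [← Complex.exp_add]
    congr 1
    simp [quadVal, Fin.sum_univ_two, HH2.symm, MeasurableEquiv.finTwoArrow]
    ring
  simp only [hinner]
  rw [integral_const_mul, integral_cexp_pi_I hd]
  rw [← mul_assoc]
  congr 1
  · have h2 : Complex.I ^ (1 / 2 : ℂ) * Complex.I ^ (1 / 2 : ℂ) = Complex.I := by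
      rw [← pow_two, ← Complex.cpow_nat_mul]
      simp
    rw [div_mul_div_comm, h2, sqrtDet]
  · congr 2
    have hi : (τ.1)⁻¹ = (τ.1.det)⁻¹ • !![τ.1 1 1, -τ.1 0 1; -τ.1 1 0, τ.1 0 0] := by
      rw [Matrix.inv_def, Matrix.adjugate_fin_two, Ring.inverse_eq_inv']
    rw [hi]
    simp only [quadVal, Fin.sum_univ_two, HH2.symm, Matrix.neg_apply, Matrix.smul_apply,
      Matrix.of_apply, Matrix.cons_val', Matrix.cons_val_zero, Matrix.cons_val_one,
      Matrix.cons_val_fin_one, smul_eq_mul]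
    have e2 : τ.1 1 1 = (τ.1.det + τ.1 0 1 ^ 2) / τ.1 0 0 := by
      rw [Matrix.det_fin_two, HH2.symm, eq_div_iff hz0]; ring
    rw [e2]
    field_simp
    ring

end SiegelGaussian

/-! ### Block diagonal matrices -/

section BlockMat

variable {ι : Type*} [Fintype ι] [DecidableEq ι]

/-- The block diagonal matrix with the given `2 × 2` blocks. -/
def blockMat (M : ι → Matrix (Fin 2) (Fin 2) ℂ) : Matrix (ι × Fin 2) (ι × Fin 2) ℂ :=
  Matrix.of fun p s => if p.1 = s.1 then M p.1 p.2 s.2 else 0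

/-- Stated for module-valued `f` because it is applied to numbers as well as to derivatives of
polynomials. -/
theorem sum_blockMat (M : ι → Matrix (Fin 2) (Fin 2) ℂ) {E : Type*} [AddCommMonoid E] [Module ℂ E]
    (p : ι × Fin 2) (f : ι × Fin 2 → E) :
    ∑ s, blockMat M p s • f s = ∑ k, M p.1 p.2 k • f (p.1, k) := by
  rw [Fintype.sum_prod_type]
  simp only [blockMat, Matrix.of_apply, ite_smul, zero_smul, Finset.sum_ite_irrel,
    Finset.sum_const_zero, Finset.sum_ite_eq, Finset.mem_univ, if_true]

theorem blockMat_mul (M N : ι → Matrix (Fin 2) (Fin 2) ℂ) :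
    blockMat M * blockMat N = blockMat fun i => M i * N i := by
  ext p s
  rw [Matrix.mul_apply]
  have := sum_blockMat M p (fun r => blockMat N r s)
  simp only [smul_eq_mul] at this
  rw [this]
  simp only [blockMat, Matrix.of_apply, Matrix.mul_apply]
  split_ifs <;> simp

omit [Fintype ι] in
theorem blockMat_transpose (M : ι → Matrix (Fin 2) (Fin 2) ℂ) :
    (blockMat M)ᵀ = blockMat fun i => (M i)ᵀ := by
  ext p s
  simp only [blockMat, Matrix.of_apply, Matrix.transpose_apply]
  by_cases h : p.1 = s.1
  · rw [if_pos h, if_pos h.symm, h]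
  · rw [if_neg h, if_neg (Ne.symm h)]

omit [Fintype ι] in
theorem blockMat_add (M N : ι → Matrix (Fin 2) (Fin 2) ℂ) :
    blockMat M + blockMat N = blockMat fun i => M i + N i := by
  ext p s
  simp only [blockMat, Matrix.of_apply, Matrix.add_apply]
  split_ifs <;> simp

omit [Fintype ι] in
theorem blockMat_smul (c : ℂ) (M : ι → Matrix (Fin 2) (Fin 2) ℂ) :
    c • blockMat M = blockMat fun i => c • M i := by
  ext p s
  simp [blockMat]

omit [Fintype ι] in
theorem blockMat_symm {M : ι → Matrix (Fin 2) (Fin 2) ℂ} (h : ∀ i, (M i)ᵀ = M i)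
    (p s : ι × Fin 2) : blockMat M p s = blockMat M s p := by
  conv_lhs => rw [show M = fun i => (M i)ᵀ from funext fun i => (h i).symm, ← blockMat_transpose]
  rfl

end BlockMat

/-! ### Linear substitutions in very homogeneous polynomials -/

section VeryHomogeneous

open MvPolynomial

theorem eval_linear_subst {σ : Type*} [Fintype σ] (N : Matrix σ σ ℂ) (x : σ → ℂ)
    (P : MvPolynomial σ ℂ) :
    eval x (aeval (fun p => ∑ s, N p s • (X s : MvPolynomial σ ℂ)) P) =
      eval (fun p => ∑ s, N p s * x s) P := by
  induction P using MvPolynomial.induction_on with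
  | C z => simp
  | add P Q hP hQ => simp only [map_add, hP, hQ]
  | mul_X P r hP => simp only [map_mul, hP, aeval_X, eval_X, map_sum, smul_eval]

/-- A linear substitution in a very homogeneous polynomial. -/
theorem IsVeryHomogeneous.aeval_blockMat {b : ℕ} {P : MvPolynomial ((Fin b ⊕ Fin 2) × Fin 2) ℂ}
    {mpos mneg : ℕ} (hP : IsVeryHomogeneous P mpos mneg)
    (M : Fin b ⊕ Fin 2 → Matrix (Fin 2) (Fin 2) ℂ) (N N' : Matrix (Fin 2) (Fin 2) ℂ)
    (hN : ∀ i, M (Sum.inl i) = Nᵀ) (hN' : ∀ i, M (Sum.inr i) = N'ᵀ) :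
    aeval (fun p => ∑ s, blockMat M p s • (X s : MvPolynomial ((Fin b ⊕ Fin 2) × Fin 2) ℂ)) P =
      (N.det ^ mpos * N'.det ^ mneg) • P := by
  obtain ⟨Pb, P2, rfl, h1, h2⟩ := hP
  -- Very homogeneity is given at real points only, with complex N; polynomials that agree on the
  -- real points are equal because ℝ is infinite.
  refine MvPolynomial.funext_set (fun _ => Set.range ((↑) : ℝ → ℂ))
    (fun _ => Set.infinite_range_of_injective Complex.ofReal_injective) fun x hx => ?_
  have hx' : ∀ p, ∃ r : ℝ, (r : ℂ) = x p := fun p => hx p (Set.mem_univ p)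
  choose r hr using hx'
  obtain rfl : (fun p => (r p : ℂ)) = x := funext hr
  rw [eval_linear_subst]
  have hs : ∀ p : (Fin b ⊕ Fin 2) × Fin 2, ∑ s, blockMat M p s * (r s : ℂ) =
      ∑ k, M p.1 p.2 k * (r (p.1, k) : ℂ) := fun p => by
    simpa only [smul_eq_mul] using sum_blockMat M p (fun s => (r s : ℂ))
  simp only [hs, map_mul, eval_rename, smul_eval]
  have e1 := h1 (Matrix.of fun i j => r (Sum.inl i, j)) N
  have e2 := h2 (Matrix.of fun i j => r (Sum.inr i, j)) N'
  simp only [Matrix.of_apply, Matrix.mul_apply, Matrix.map_apply] at e1 e2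
  simp only [Function.comp_def, hN, hN', Matrix.transpose_apply]
  simp only [mul_comm (N _ _), mul_comm (N' _ _), e1, e2]
  ring

/-- This puts the operator of the theta function within reach of the calculus of `expDL`. Symmetry
of y is needed because `trLap` contracts with the transposed entry of y⁻¹. -/
theorem expLap_eq_expDL {ι : Type*} [Fintype ι] [DecidableEq ι] (y : Matrix (Fin 2) (Fin 2) ℝ)
    (hy : yᵀ = y) (P : MvPolynomial (ι × Fin 2) ℂ) :
    expLap y P = expDL (blockMat fun _ : ι => (-1 / (8 * Real.pi) : ℂ) • ofR y⁻¹) P := by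
  have h : quadDiff (blockMat fun _ : ι => (-1 / (8 * Real.pi) : ℂ) • ofR y⁻¹) =
      (-1 / (8 * Real.pi) : ℂ) • trLap y⁻¹ := by
    refine LinearMap.ext fun Q => ?_
    have hs : ∀ j k, y⁻¹ j k = y⁻¹ k j := fun j k => by
      have : (y⁻¹)ᵀ = y⁻¹ := by rw [Matrix.transpose_nonsing_inv, hy]
      exact congrFun (congrFun this k) j
    rw [quadDiff_apply, Fintype.sum_prod_type, LinearMap.smul_apply, trLap, LinearMap.sum_apply,
      Finset.smul_sum]
    refine Finset.sum_congr rfl fun i _ => ?_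
    rw [LinearMap.sum_apply, Finset.smul_sum]
    refine Finset.sum_congr rfl fun j _ => ?_
    rw [sum_blockMat, LinearMap.sum_apply, Finset.smul_sum]
    refine Finset.sum_congr rfl fun k _ => ?_
    simp only [Matrix.smul_apply, ofR, Matrix.map_apply, hs k j, LinearMap.smul_apply, smul_smul,
      smul_eq_mul]
    rfl
  rw [expLap, ← h]
  rfl

end VeryHomogeneous

/-! ### The maps τ ↦ -τ̄ and τ ↦ -τ⁻¹ -/

section SiegelPoints

/-- The point `-τ̄` of the Siegel upper half space. -/
def negConj (τ : HH2) : HH2 :=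
  ⟨-τ.1.map (starRingEnd ℂ), by
    constructor
    · rw [Matrix.transpose_neg, ← Matrix.transpose_map, τ.2.1]
    · have : imPart (-τ.1.map (starRingEnd ℂ)) = imPart τ.1 := by
        ext i j; simp [imPart]
      rw [this]
      exact τ.2.2⟩

theorem imPart_negConj (τ : HH2) : imPart (negConj τ).1 = imPart τ.1 := by
  ext i j; simp [imPart, negConj]

/-- The point `-τ⁻¹` of the Siegel upper half space. -/
def invPt (τ : HH2) : HH2 := act (SymplecticGroup.symJ (Fin 2) ℤ) τ

theorem det_ne_zero (τ : HH2) : τ.1.det ≠ 0 := by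
  have h := den_det_ne_zero (SymplecticGroup.symJ (Fin 2) ℤ) τ
  rw [den_of_blocks _ _ _ _ _ (rfl : (SymplecticGroup.symJ (Fin 2) ℤ).1 =
    Matrix.fromBlocks 0 (-1) 1 0) τ] at h
  simpa [toC_one, toC_zero] using h

theorem blk_of_eq (M : Sp4Z) {A B C D : Matrix (Fin 2) (Fin 2) ℤ}
    (h : M.1 = Matrix.fromBlocks A B C D) : blkA M = A ∧ blkB M = B ∧ blkC M = C ∧ blkD M = D := by
  rw [← blk_eq M] at h
  exact Matrix.fromBlocks_inj.1 h

theorem invPt_val (τ : HH2) : (invPt τ).1 = -(τ.1)⁻¹ := by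
  obtain ⟨h1, h2, h3, h4⟩ := blk_of_eq (SymplecticGroup.symJ (Fin 2) ℤ)
    (rfl : _ = Matrix.fromBlocks 0 (-1) 1 0)
  change num _ τ * (den _ τ)⁻¹ = _
  rw [num, den, h1, h2, h3, h4]
  simp [toC_one, toC_zero, toC_neg]

theorem map_conj_inv (M : Matrix (Fin 2) (Fin 2) ℂ) :
    M⁻¹.map (starRingEnd ℂ) = (M.map (starRingEnd ℂ))⁻¹ := by
  have h := Matrix.conjTranspose_nonsing_inv M
  have h2 := congrArg Matrix.transpose h
  rw [Matrix.transpose_nonsing_inv] at h2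
  exact h2

/-- Because the two maps commute, positive and negative coordinates are handled by one and the same
Fourier computation. -/
theorem invPt_negConj (τ : HH2) : invPt (negConj τ) = negConj (invPt τ) := by
  apply Subtype.ext
  have h : ∀ τ : HH2, (negConj τ).1 = -τ.1.map (starRingEnd ℂ) := fun _ => rfl
  have h2 : (-τ.1⁻¹).map (starRingEnd ℂ) = -(τ.1⁻¹).map (starRingEnd ℂ) := by
    ext i j; simp
  have h3 : (-τ.1.map (starRingEnd ℂ))⁻¹ = -(τ.1.map (starRingEnd ℂ))⁻¹ := by
    refine Matrix.inv_eq_right_inv ?_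
    rw [neg_mul_neg, Matrix.mul_nonsing_inv]
    have := (starRingEnd ℂ).map_det τ.1
    rw [RingHom.mapMatrix_apply] at this
    rw [← this]
    exact ((map_ne_zero _).2 (det_ne_zero τ)).isUnit
  rw [invPt_val, h, h, invPt_val, h3, h2, map_conj_inv]

theorem ofR_mul (X Y : Matrix (Fin 2) (Fin 2) ℝ) : ofR (X * Y) = ofR X * ofR Y := by
  ext i j; simp [ofR, Matrix.mul_apply]

theorem ofR_one : ofR 1 = 1 := by
  ext i j; simp [ofR, Matrix.one_apply, apply_ite Complex.ofReal]

theorem imC_mul_ofR_inv (τ : HH2) : imC τ.1 * ofR (imPart τ.1)⁻¹ = 1 := by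
  change ofR (imPart τ.1) * _ = 1
  rw [← ofR_mul, Matrix.mul_nonsing_inv _ τ.2.2.det_pos.ne'.isUnit, ofR_one]

/-- The inverse imaginary parts of `τ` and `τ' = -τ⁻¹` satisfy `τ' y'⁻¹ τ' = y⁻¹ + 2iτ'`. -/
theorem invPt_mul_im_inv (τ : HH2) :
    (invPt τ).1 * ofR (imPart (invPt τ).1)⁻¹ * (invPt τ).1 =
      ofR (imPart τ.1)⁻¹ + (2 * Complex.I) • (invPt τ).1 := by
  have hd : IsUnit τ.1.det := (det_ne_zero τ).isUnit
  have hdh : IsUnit (τ.1)ᴴ.det := by rw [Matrix.det_conjTranspose]; exact hd.star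
  set Y := imC τ.1 with hY
  set Y' := imC (invPt τ).1 with hY'
  set V := ofR (imPart τ.1)⁻¹ with hV
  set V' := ofR (imPart (invPt τ).1)⁻¹ with hV'
  have h1 : Y * V = 1 := imC_mul_ofR_inv τ
  have h2 : Y' * V' = 1 := imC_mul_ofR_inv (invPt τ)
  have h1' : V * Y = 1 := mul_eq_one_comm.1 h1
  have e1 : τ.1 = τ.1ᴴ + (2 * Complex.I) • Y := by
    rw [hY, two_I_imC _ τ.2.1]; abel
  have e2 : (2 * Complex.I) • Y' = (τ.1ᴴ)⁻¹ - (τ.1)⁻¹ := by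
    rw [hY', two_I_imC _ (invPt τ).2.1, invPt_val, Matrix.conjTranspose_neg,
      Matrix.conjTranspose_nonsing_inv]
    abel
  -- This inverts y' = (τᴴ)⁻¹ y τ⁻¹. Multiplying by -τ⁻¹ on both sides and writing τᴴ = τ - 2iy
  -- gives the identity.
  have hinv : V' = τ.1 * V * τ.1ᴴ := by
    have h3 : Y' * (τ.1 * V * τ.1ᴴ) = 1 := by
      have h2I : (2 * Complex.I) ≠ 0 := by simp
      apply smul_right_injective _ h2I
      simp only
      rw [← Matrix.smul_mul, e2, Matrix.sub_mul]
      have e3 : (τ.1)⁻¹ * (τ.1 * V * τ.1ᴴ) = V * τ.1ᴴ := by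
        rw [Matrix.mul_assoc, ← Matrix.mul_assoc, Matrix.nonsing_inv_mul _ hd, Matrix.one_mul]
      have e4 : (τ.1ᴴ)⁻¹ * (τ.1 * V * τ.1ᴴ) = V * τ.1ᴴ + (2 * Complex.I) • 1 := by
        conv_lhs => enter [2, 1, 1]; rw [e1]
        rw [Matrix.add_mul, Matrix.smul_mul, h1, Matrix.add_mul, Matrix.mul_add,
          Matrix.mul_assoc τ.1ᴴ, ← Matrix.mul_assoc _ τ.1ᴴ, Matrix.nonsing_inv_mul _ hdh,
          Matrix.one_mul, Matrix.smul_mul, Matrix.one_mul, Matrix.mul_smul,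
          Matrix.nonsing_inv_mul _ hdh]
      rw [e3, e4]
      abel
    rw [← Matrix.mul_one V', ← h3, ← Matrix.mul_assoc V', mul_eq_one_comm.1 h2, Matrix.one_mul]
  have e5 : (invPt τ).1 * τ.1 = -1 := by
    rw [invPt_val, Matrix.neg_mul, Matrix.nonsing_inv_mul _ hd]
  have e6 : τ.1 * (invPt τ).1 = -1 := by
    rw [invPt_val, Matrix.mul_neg, Matrix.mul_nonsing_inv _ hd]
  have e7 : τ.1ᴴ = τ.1 - (2 * Complex.I) • Y := by
    rw [hY, two_I_imC _ τ.2.1]; abel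
  rw [hinv, ← Matrix.mul_assoc, ← Matrix.mul_assoc, e5, e7, Matrix.mul_assoc, Matrix.sub_mul, e6,
    Matrix.smul_mul, Matrix.neg_mul, Matrix.one_mul, Matrix.mul_sub, Matrix.mul_smul,
    ← Matrix.mul_assoc, Matrix.neg_mul, Matrix.neg_mul, h1']
  simp
end SiegelPoints

/-! ### Products of Gaussians over the coordinates -/

section GaussProd

open MeasureTheory

variable {ι : Type*} [Fintype ι]

/-- Grouping the variables into pairs lets the integral factor over the coordinates. Boxes determine
the product measure, so it is compared on boxes. -/
theorem measurePreserving_uncurry (κ : Type*) [Fintype κ] :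
    MeasurePreserving (MeasurableEquiv.curry ι κ ℝ) volume volume := by
  have h : MeasurePreserving (MeasurableEquiv.curry ι κ ℝ).symm volume volume := by
    refine ⟨(MeasurableEquiv.curry ι κ ℝ).symm.measurable, ?_⟩
    refine (Measure.pi_eq fun s hs => ?_).symm
    rw [(MeasurableEquiv.curry ι κ ℝ).symm.map_apply]
    have : (MeasurableEquiv.curry ι κ ℝ).symm ⁻¹' Set.univ.pi s =
        Set.univ.pi fun i => Set.univ.pi fun k => s (i, k) := by
      ext x
      simp [Set.mem_pi, MeasurableEquiv.curry]
    rw [this, volume_pi_pi, Fintype.prod_prod_type]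
    simp only [volume_pi_pi]
  exact h.symm

/-- The product of the Gaussian functions `exp(πi xᵢ Mᵢ xᵢᵗ)`. -/
def gaussProd (M : ι → HH2) (x : ι × Fin 2 → ℝ) : ℂ :=
  ∏ i, Complex.exp (Real.pi * Complex.I * quadVal (M i).1 fun j => x (i, j))

theorem rapidDecay_gaussProd (M : ι → HH2) : RapidDecay (gaussProd M) := by
  choose ε hε h using fun i => exists_quadVal_im_ge (M i)
  obtain ⟨δ, hδ, hle⟩ : ∃ δ : ℝ, 0 < δ ∧ ∀ i, δ ≤ ε i := by
    rcases isEmpty_or_nonempty ι with hι | hι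
    · exact ⟨1, one_pos, fun i => isEmptyElim i⟩
    · obtain ⟨i, hi⟩ := Finite.exists_min ε
      exact ⟨ε i, hε i, hi⟩
  have hc : Continuous (gaussProd M) := by
    unfold gaussProd
    refine continuous_finsetProd _ fun i _ => ?_
    exact Complex.continuous_exp.comp (continuous_const.mul ((continuous_quadVal _).comp
      (by fun_prop)))
  refine rapidDecay_of_gaussian_bound hc (Real.pi * δ) (by positivity) fun x => ?_
  rw [gaussProd, norm_prod]
  simp only [norm_cexp_quadVal]
  rw [← Real.exp_sum, Real.exp_le_exp, Fintype.sum_prod_type, Finset.mul_sum]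
  refine Finset.sum_le_sum fun i _ => ?_
  rw [Fin.sum_univ_two, neg_mul, neg_mul, neg_le_neg_iff, mul_assoc]
  refine mul_le_mul_of_nonneg_left (le_trans ?_ (h i _)) Real.pi_pos.le
  gcongr
  exact hle i

theorem fourier_gaussProd (M : ι → HH2) (ξ : ι × Fin 2 → ℝ) :
    ∫ x, gaussProd M x * expi (-∑ p, (x p : ℂ) * (ξ p : ℝ)) =
      (∏ i, Complex.I / sqrtDet (M i)) * gaussProd (fun i => invPt (M i)) ξ := by
  rw [← (measurePreserving_uncurry (ι := ι) (Fin 2)).symm.integral_comp']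
  have h : ∀ x : ι → Fin 2 → ℝ, gaussProd M ((MeasurableEquiv.curry ι (Fin 2) ℝ).symm x) *
      expi (-∑ p, (((MeasurableEquiv.curry ι (Fin 2) ℝ).symm x) p : ℂ) * (ξ p : ℝ)) =
      ∏ i, (Complex.exp (Real.pi * Complex.I * quadVal (M i).1 (x i)) *
        expi (-∑ j, (x i j : ℂ) * (ξ (i, j) : ℝ))) := by
    intro x
    rw [Finset.prod_mul_distrib, gaussProd]
    congr 1
    simp only [expi]
    rw [← Complex.exp_sum, Fintype.sum_prod_type, ← Finset.sum_neg_distrib, Finset.mul_sum]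
    rfl
  simp only [h]
  rw [integral_fintype_prod_volume_eq_prod (fun i (u : Fin 2 → ℝ) =>
    Complex.exp (Real.pi * Complex.I * quadVal (M i).1 u) *
        expi (-∑ j, (u j : ℂ) * (ξ (i, j) : ℝ)))]
  rw [gaussProd, ← Finset.prod_mul_distrib]
  refine Finset.prod_congr rfl fun i _ => ?_
  rw [fourier_cexp_quadVal (M i) fun j => ξ (i, j), invPt_val]

end GaussProd

/-! ### The theta summand in coordinates and its Fourier transform -/

section CoordTerm

open MeasureTheory MvPolynomial

variable {b : ℕ}

/-- The point `τ` for the positive coordinates and `-τ̄` for the negative ones. -/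
def sgnPt (b : ℕ) (τ : HH2) : Fin b ⊕ Fin 2 → HH2 := Sum.elim (fun _ => τ) fun _ => negConj τ

theorem imPart_sgnPt (τ : HH2) (i : Fin b ⊕ Fin 2) : imPart (sgnPt b τ i).1 = imPart τ.1 := by
  rcases i with i | i
  · rfl
  · exact imPart_negConj τ

theorem invPt_sgnPt (τ : HH2) (i : Fin b ⊕ Fin 2) :
    invPt (sgnPt b τ i) = sgnPt b (invPt τ) i := by
  rcases i with i | i
  · rfl
  · exact invPt_negConj τ

theorem imPart_symm (τ : HH2) : (imPart τ.1)ᵀ = imPart τ.1 := by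
  rw [imPart, ← Matrix.transpose_map, τ.2.1]

theorem ofR_inv_symm (τ : HH2) : (ofR (imPart τ.1)⁻¹)ᵀ = ofR (imPart τ.1)⁻¹ := by
  have : ((imPart τ.1)⁻¹)ᵀ = (imPart τ.1)⁻¹ := by
    rw [Matrix.transpose_nonsing_inv, imPart_symm]
  conv_rhs => rw [← this]
  rfl

/-- The summand of the theta series without its character, in coordinates. -/
def coordTerm (P : MvPolynomial ((Fin b ⊕ Fin 2) × Fin 2) ℂ) (τ : HH2)
    (x : (Fin b ⊕ Fin 2) × Fin 2 → ℝ) : ℂ :=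
  evalR x (expLap (imPart τ.1) P) * gaussProd (sgnPt b τ) x

theorem rapidDecay_coordTerm (P : MvPolynomial ((Fin b ⊕ Fin 2) × Fin 2) ℂ) (τ : HH2) :
    RapidDecay (coordTerm P τ) :=
  (rapidDecay_gaussProd _).evalR_mul _

theorem det_negConj (τ : HH2) : (negConj τ).1.det = (starRingEnd ℂ) τ.1.det := by
  change (-τ.1.map (starRingEnd ℂ)).det = _
  have := (starRingEnd ℂ).map_det τ.1
  rw [RingHom.mapMatrix_apply] at this
  rw [Matrix.det_neg, this]
  simp

theorem det_invPt (τ : HH2) : (invPt τ).1.det = (τ.1.det)⁻¹ := by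
  rw [invPt_val, Matrix.det_neg, Matrix.det_nonsing_inv, Ring.inverse_eq_inv']
  simp

/-- There are exactly two negative coordinates, so the root at -τ̄ occurs squared and its branch
plays no role. -/
theorem prod_sgnPt (τ : HH2) : ∏ i, Complex.I / sqrtDet (sgnPt b τ i) =
    (Complex.I / sqrtDet τ) ^ b * -((starRingEnd ℂ) τ.1.det)⁻¹ := by
  rw [Fintype.prod_sum_type]
  simp only [sgnPt, Sum.elim_inl, Sum.elim_inr, Finset.prod_const, Finset.card_univ,
    Fintype.card_fin]
  rw [div_pow _ _ 2, sqrtDet_sq, det_negConj, Complex.I_sq, neg_div, one_div]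

/-- The Fourier transform of the summand of the theta series. -/
theorem fourier_coordTerm {P : MvPolynomial ((Fin b ⊕ Fin 2) × Fin 2) ℂ} {mpos mneg : ℕ}
    (hP : IsVeryHomogeneous P mpos mneg) (τ : HH2) (ξ : (Fin b ⊕ Fin 2) × Fin 2 → ℝ) :
    ∫ x, coordTerm P τ x * expi (-∑ p, (x p : ℂ) * (ξ p : ℝ)) =
      (Complex.I / sqrtDet τ) ^ b * -((starRingEnd ℂ) τ.1.det)⁻¹ *
        ((τ.1.det)⁻¹ ^ mpos * ((starRingEnd ℂ) τ.1.det)⁻¹ ^ mneg) *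
          coordTerm P (invPt τ) ξ := by
  -- The blocks -iM' are chosen so that exp(-π ξWξᵗ) is the transformed Gaussian; the evaluation
  -- point -iWξ then equals -M'ξ, that is Nξ below.
  set W : Matrix ((Fin b ⊕ Fin 2) × Fin 2) ((Fin b ⊕ Fin 2) × Fin 2) ℂ :=
    blockMat fun i => (-Complex.I) • (sgnPt b (invPt τ) i).1 with hW
  have hWs : ∀ p s, W p s = W s p := blockMat_symm fun i => by
    rw [Matrix.transpose_smul, (sgnPt b (invPt τ) i).2.1]
  have hWsum : ∀ (p : (Fin b ⊕ Fin 2) × Fin 2) (x : (Fin b ⊕ Fin 2) × Fin 2 → ℂ),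
      ∑ s, W p s * x s =
        -Complex.I * ∑ k, (sgnPt b (invPt τ) p.1).1 p.2 k * x (p.1, k) := fun p x => by
    have := sum_blockMat (fun i => (-Complex.I) • (sgnPt b (invPt τ) i).1) p x
    simp only [smul_eq_mul, Matrix.smul_apply] at this
    rw [hW, this, Finset.mul_sum]
    exact Finset.sum_congr rfl fun k _ => mul_assoc _ _ _
  have hgauss : ∀ ξ : (Fin b ⊕ Fin 2) × Fin 2 → ℝ, gaussProd (sgnPt b (invPt τ)) ξ =
      Complex.exp (-Real.pi * ∑ p, ∑ s, W p s * (ξ p * ξ s)) := by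
    intro ξ
    rw [gaussProd, ← Complex.exp_sum, Fintype.sum_prod_type, Finset.mul_sum]
    congr 1
    refine Finset.sum_congr rfl fun i _ => ?_
    simp only [hWsum _ (fun s => (ξ _ : ℂ) * ξ s), quadVal, Finset.mul_sum]
    refine Finset.sum_congr rfl fun j _ => Finset.sum_congr rfl fun k _ => ?_
    ring
  have hbase := fourier_gaussProd (sgnPt b τ)
  simp only [invPt_sgnPt, hgauss, prod_sgnPt] at hbase
  have key := (rapidDecay_gaussProd (sgnPt b τ)).fourier_evalR_mul W hWs _ hbase
    (expLap (imPart τ.1) P) ξ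
  simp only [coordTerm]
  rw [key, hgauss]
  rw [expLap_eq_expDL _ (imPart_symm τ), expLap_eq_expDL _ (imPart_symm (invPt τ))]
  set a0 : Matrix ((Fin b ⊕ Fin 2) × Fin 2) ((Fin b ⊕ Fin 2) × Fin 2) ℂ :=
    blockMat fun _ => (-1 / (8 * Real.pi) : ℂ) • ofR (imPart τ.1)⁻¹ with ha0
  set c : Matrix ((Fin b ⊕ Fin 2) × Fin 2) ((Fin b ⊕ Fin 2) × Fin 2) ℂ :=
    blockMat fun _ => (-1 / (8 * Real.pi) : ℂ) • ofR (imPart (invPt τ).1)⁻¹ with hc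
  set N : Matrix ((Fin b ⊕ Fin 2) × Fin 2) ((Fin b ⊕ Fin 2) × Fin 2) ℂ :=
    blockMat fun i => -(sgnPt b (invPt τ) i).1 with hN
  have ha0s : ∀ p s, a0 p s = a0 s p := blockMat_symm fun i => by
    rw [Matrix.transpose_smul, ofR_inv_symm]
  have hcs : ∀ p s, c p s = c s p := blockMat_symm fun i => by
    rw [Matrix.transpose_smul, ofR_inv_symm]
  have hW's : ∀ p s, ((1 / (4 * Real.pi) : ℂ) • W) p s = ((1 / (4 * Real.pi) : ℂ) • W) s p :=
    fun p s => by simp [hWs p s]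
  -- This is `invPt_mul_im_inv` in each block, scaled by -1/(8π): the operator for y plus the one
  -- produced by the Fourier transform is the operator for y' pulled back along N.
  have hNc : N * c * Nᵀ = (1 / (4 * Real.pi) : ℂ) • W + a0 := by
    rw [hN, hc, ha0, hW, blockMat_mul, blockMat_transpose, blockMat_mul, blockMat_smul,
      blockMat_add]
    congr 1
    funext i
    have h := invPt_mul_im_inv (sgnPt b τ i)
    rw [invPt_sgnPt, imPart_sgnPt, imPart_sgnPt] at h
    rw [Matrix.transpose_neg, (sgnPt b (invPt τ) i).2.1, Matrix.mul_smul, Matrix.smul_mul,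
      Matrix.neg_mul, neg_mul_neg, h, smul_add, smul_smul, smul_smul, add_comm]
    congr 2
    ring
  have heval : (fun p => -Complex.I * ∑ s, W p s * (ξ s : ℂ)) =
      fun p => ∑ s, N p s * (ξ s : ℂ) := by
    funext p
    have := sum_blockMat (fun i => -(sgnPt b (invPt τ) i).1) p (fun s => (ξ s : ℂ))
    simp only [smul_eq_mul, Matrix.neg_apply, neg_mul, Finset.sum_neg_distrib] at this
    rw [hWsum p (fun s => (ξ s : ℂ)), hN, this, ← mul_assoc, neg_mul_neg, Complex.I_mul_I,
      neg_one_mul]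
  have hsub := hP.aeval_blockMat (fun i => -(sgnPt b (invPt τ) i).1)
    (-(invPt τ).1) (-(negConj (invPt τ)).1)
    (fun i => by rw [Matrix.transpose_neg, (invPt τ).2.1]; rfl)
    (fun i => by rw [Matrix.transpose_neg, (negConj (invPt τ)).2.1]; rfl)
  have hdet : ∀ τ : HH2, (-τ.1).det = τ.1.det := fun τ => by rw [Matrix.det_neg]; simp
  rw [hdet, hdet, det_negConj, det_invPt, map_inv₀] at hsub
  rw [expDL_expDL _ _ hW's ha0s, heval, ← eval_linear_subst, ← hNc,
    aeval_expDL N _ c (fun p s => by rw [hNc]; simp [hWs p s, ha0s p s]) hcs rfl, hsub, map_smul,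
    smul_eval, evalR]
  ring

end CoordTerm

/-! ### Generators of the symplectic and metaplectic groups -/

section Generators

open Matrix

/-- Convexity makes the half space connected, so two continuous roots of the same nowhere vanishing
function differ by one global sign. -/
theorem convex_siegel :
    Convex ℝ {τ : Matrix (Fin 2) (Fin 2) ℂ | τᵀ = τ ∧ (imPart τ).PosDef} := by
  rintro x ⟨hx, hx'⟩ y ⟨hy, hy'⟩ a c ha hc hac
  refine ⟨by rw [transpose_add, transpose_smul, transpose_smul, hx, hy], ?_⟩
  have h : imPart (a • x + c • y) = a • imPart x + c • imPart y := by
    ext i j; simp [imPart]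
  rw [h]
  rcases ha.eq_or_lt with rfl | ha
  · have : c = 1 := by linarith
    simpa [this] using hy'
  · exact (hx'.smul ha).add_posSemidef (hy'.posSemidef.smul hc)

instance : PreconnectedSpace HH2 :=
  Subtype.preconnectedSpace convex_siegel.isPreconnected

/-- The root of a metaplectic element is determined by the matrix up to a sign. -/
theorem Mp4Z.root_eq_or_eq_neg (γ δ : Mp4Z) (h : γ.mat = δ.mat) :
    γ.root = δ.root ∨ γ.root = -δ.root := by
  have := isPreconnected_univ.eq_or_eq_neg_of_sq_eq (f := γ.root) (g := δ.root)
    γ.continuous_root.continuousOn δ.continuous_root.continuousOn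
    (fun τ _ => by simp only [Pi.pow_apply, γ.root_sq, δ.root_sq, h])
    (fun {τ} _ => δ.root_ne_zero τ)
  simpa only [Set.eqOn_univ] using this

/-- The point `i` of the Siegel upper half space. -/
def iPt : HH2 := ⟨Complex.I • 1, by simp, by
  have : imPart (Complex.I • 1) = 1 := by
    ext i j
    simp [imPart, Matrix.one_apply, apply_ite Complex.im]
  rw [this]
  exact Matrix.PosDef.one⟩

/-- The projection from the metaplectic to the symplectic group. -/
def Mp4Z.matHom : Mp4Z →* Sp4Z where
  toFun := Mp4Z.mat
  map_one' := rfl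
  map_mul' := Mp4Z.mat_mul

/-- The elements on which the Weil representation is prescribed. -/
def mpGens : Set Mp4Z :=
  {γ | (∃ A, γ = mkDiag A) ∨ (∃ B hB, γ = mkT B hB) ∨ γ = mkS}

/-- The image in `Sp₄(ℤ)` of the subgroup generated by `mpGens`. -/
def spGen : Subgroup Sp4Z := (Subgroup.closure mpGens).map Mp4Z.matHom

theorem mat_mem_spGen {γ : Mp4Z} (h : γ ∈ mpGens) : γ.mat ∈ spGen :=
  ⟨γ, Subgroup.subset_closure h, rfl⟩

/-- The embedding of `SL₂(ℤ) × SL₂(ℤ)` into `Sp₄(ℤ)`. -/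
def embSL2 : SpecialLinearGroup (Fin 2) ℤ × SpecialLinearGroup (Fin 2) ℤ →* Sp4Z where
  toFun g := ⟨fromBlocks (diagonal ![g.1 0 0, g.2 0 0]) (diagonal ![g.1 0 1, g.2 0 1])
      (diagonal ![g.1 1 0, g.2 1 0]) (diagonal ![g.1 1 1, g.2 1 1]), by
    have h1 := g.1.det_coe
    have h2 := g.2.det_coe
    rw [det_fin_two] at h1 h2
    rw [SymplecticGroup.fromBlocks_mem_iff]
    refine ⟨?_, ?_, ?_⟩
    · ext i j; fin_cases i <;> fin_cases j <;> simp [mul_comm]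
    · ext i j; fin_cases i <;> fin_cases j <;> simp [mul_comm]
    · ext i j; fin_cases i <;> fin_cases j <;> simp <;> linarith⟩
  map_one' := by
    apply Subtype.ext
    change fromBlocks _ _ _ _ = (1 : Matrix (Fin 2 ⊕ Fin 2) (Fin 2 ⊕ Fin 2) ℤ)
    rw [← fromBlocks_one]
    congr 1 <;> ext i j <;> fin_cases i <;> fin_cases j <;> simp
  map_mul' g h := by
    apply Subtype.ext
    change fromBlocks _ _ _ _ = fromBlocks _ _ _ _ * fromBlocks _ _ _ _
    rw [fromBlocks_multiply]
    congr 1 <;> ext i j <;> fin_cases i <;> fin_cases j <;>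
      simp [Matrix.mul_apply, Fin.sum_univ_two]

/-- The inversion in a single SL₂ factor is not among the generators. It is recovered from opposite
unipotents as S = T⁻¹ L T⁻¹ with L = S T⁻¹ S⁻¹. -/
theorem embSL2_mem_aux (φ : SpecialLinearGroup (Fin 2) ℤ →* Sp4Z)
    (hT : φ ModularGroup.T ∈ spGen)
    (hL : φ (ModularGroup.S * ModularGroup.T⁻¹ * ModularGroup.S⁻¹) ∈ spGen)
    (g : SpecialLinearGroup (Fin 2) ℤ) : φ g ∈ spGen := by
  have hS : φ ModularGroup.S ∈ spGen := by
    have : ModularGroup.S = ModularGroup.T⁻¹ *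
        (ModularGroup.S * ModularGroup.T⁻¹ * ModularGroup.S⁻¹) * ModularGroup.T⁻¹ := by
      apply Subtype.ext
      decide
    rw [this, map_mul, map_mul, map_inv]
    exact mul_mem (mul_mem (inv_mem hT) hL) (inv_mem hT)
  have h : Subgroup.closure {ModularGroup.S, ModularGroup.T} ≤ spGen.comap φ := by
    rw [Subgroup.closure_le]
    rintro _ (rfl | rfl)
    · exact hS
    · exact hT
  rw [SpecialLinearGroup.SL2Z_generators] at h
  exact h (Subgroup.mem_top g)

/-- Conjugating the translation by -B with the symplectic inversion gives the lower unipotent with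
entry B. -/
theorem symJ_conj_mem (B : Matrix (Fin 2) (Fin 2) ℤ) (hB : Bᵀ = B) (X : Sp4Z)
    (hX : X.1 = fromBlocks 1 0 B 1) : X ∈ spGen := by
  have hS : mkS.mat ∈ spGen := mat_mem_spGen (Or.inr (Or.inr rfl))
  have hT : (mkT (-B) (by rw [transpose_neg, hB])).mat ∈ spGen :=
    mat_mem_spGen (Or.inr (Or.inl ⟨_, _, rfl⟩))
  have h : X * mkS.mat = mkS.mat * (mkT (-B) (by rw [transpose_neg, hB])).mat := by
    apply Subtype.ext
    change X.1 * fromBlocks 0 (-1) 1 0 = fromBlocks 0 (-1) 1 0 * fromBlocks 1 (-B) 0 1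
    rw [hX, fromBlocks_multiply, fromBlocks_multiply]
    simp
  rw [eq_mul_inv_of_mul_eq h]
  exact mul_mem (mul_mem hS hT) (inv_mem hS)

theorem mkT_mat_eq_mem (B : Matrix (Fin 2) (Fin 2) ℤ) (hB : Bᵀ = B) (X : Sp4Z)
    (hX : X.1 = fromBlocks 1 B 0 1) : X ∈ spGen := by
  have : X = (mkT B hB).mat := Subtype.ext hX
  rw [this]
  exact mat_mem_spGen (Or.inr (Or.inl ⟨_, _, rfl⟩))

theorem embSL2_mem (g : SpecialLinearGroup (Fin 2) ℤ × SpecialLinearGroup (Fin 2) ℤ) :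
    embSL2 g ∈ spGen := by
  have hL : (ModularGroup.S * ModularGroup.T⁻¹ * ModularGroup.S⁻¹).1 = !![1, 0; 1, 1] := by
    decide
  have h1 : ∀ g, embSL2.comp (MonoidHom.inl _ _) g ∈ spGen := by
    refine embSL2_mem_aux _ (mkT_mat_eq_mem (diagonal ![1, 0]) (by simp) _ ?_)
      (symJ_conj_mem (diagonal ![1, 0]) (by simp) _ ?_)
    · change fromBlocks _ _ _ _ = _
      have e : ∀ i j, ModularGroup.T i j = !![1, 1; 0, 1] i j := fun i j => rfl
      simp only [MonoidHom.inl_apply, e]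
      congr 1 <;> ext i j <;> fin_cases i <;> fin_cases j <;> simp
    · change fromBlocks _ _ _ _ = _
      have e : ∀ i j, (ModularGroup.S * ModularGroup.T⁻¹ * ModularGroup.S⁻¹) i j =
        !![1, 0; 1, 1] i j := fun i j => congrFun (congrFun hL i) j
      simp only [MonoidHom.inl_apply, e]
      congr 1 <;> ext i j <;> fin_cases i <;> fin_cases j <;> simp
  have h2 : ∀ g, embSL2.comp (MonoidHom.inr _ _) g ∈ spGen := by
    refine embSL2_mem_aux _ (mkT_mat_eq_mem (diagonal ![0, 1]) (by simp) _ ?_)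
      (symJ_conj_mem (diagonal ![0, 1]) (by simp) _ ?_)
    · change fromBlocks _ _ _ _ = _
      have e : ∀ i j, ModularGroup.T i j = !![1, 1; 0, 1] i j := fun i j => rfl
      simp only [MonoidHom.inr_apply, e]
      congr 1 <;> ext i j <;> fin_cases i <;> fin_cases j <;> simp
    · change fromBlocks _ _ _ _ = _
      have e : ∀ i j, (ModularGroup.S * ModularGroup.T⁻¹ * ModularGroup.S⁻¹) i j =
        !![1, 0; 1, 1] i j := fun i j => congrFun (congrFun hL i) j
      simp only [MonoidHom.inr_apply, e]
      congr 1 <;> ext i j <;> fin_cases i <;> fin_cases j <;> simp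
  have : g = (g.1, 1) * (1, g.2) := by simp
  rw [this, map_mul]
  exact mul_mem (h1 g.1) (h2 g.2)

/-- Every integral vector is moved to the first axis by some element of `SL₂(ℤ)`. -/
theorem exists_SL2_kill (a c : ℤ) :
    ∃ g : SpecialLinearGroup (Fin 2) ℤ, g 1 0 * a + g 1 1 * c = 0 := by
  by_cases h : a = 0 ∧ c = 0
  · exact ⟨1, by simp [h.1, h.2]⟩
  · have hd : Int.gcd a c ≠ 0 := fun h0 => h (Int.gcd_eq_zero_iff.1 h0)
    obtain ⟨a', ha⟩ := Int.gcd_dvd_left a c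
    obtain ⟨c', hc⟩ := Int.gcd_dvd_right a c
    have hb := Int.gcd_eq_gcd_ab a c
    set d : ℤ := (Int.gcd a c : ℤ)
    have hd' : d ≠ 0 := Int.natCast_ne_zero.2 hd
    have h1 : a' * Int.gcdA a c + c' * Int.gcdB a c = 1 := by
      apply mul_left_cancel₀ hd'
      calc d * (a' * Int.gcdA a c + c' * Int.gcdB a c)
          = (d * a') * Int.gcdA a c + (d * c') * Int.gcdB a c := by ring
        _ = d * 1 := by rw [← ha, ← hc, mul_one, hb]
    refine ⟨⟨!![Int.gcdA a c, Int.gcdB a c; -c', a'], ?_⟩, ?_⟩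
    · rw [det_fin_two_of]; linarith
    · change -c' * a + a' * c = 0
      rw [ha, hc]; ring

theorem sp_rel (M : Sp4Z) : (blkA M)ᵀ * blkC M = (blkC M)ᵀ * blkA M ∧
    (blkB M)ᵀ * blkD M = (blkD M)ᵀ * blkB M ∧
    (blkA M)ᵀ * blkD M - (blkC M)ᵀ * blkB M = 1 := by
  have h := M.2
  rwa [← blk_eq M, SymplecticGroup.fromBlocks_mem_iff] at h

/-- When C = 0, the symplectic relations give AᵗD = 1 and make DᵗB symmetric, so M is a diagonal
element times the translation by DᵗB. -/
theorem mem_spGen_of_blkC_eq_zero (M : Sp4Z) (h : blkC M = 0) : M ∈ spGen := by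
  obtain ⟨-, h2, h3⟩ := sp_rel M
  rw [h, transpose_zero, Matrix.zero_mul, sub_zero] at h3
  have h4 : blkA M * (blkD M)ᵀ = 1 := by
    have := congrArg transpose h3
    rw [transpose_mul, transpose_transpose, transpose_one] at this
    exact mul_eq_one_comm.1 this
  have h5 : (blkD M)ᵀ * blkA M = 1 := mul_eq_one_comm.1 h4
  let A : GL (Fin 2) ℤ := ⟨blkA M, (blkD M)ᵀ, h4, h5⟩
  have hs : ((blkD M)ᵀ * blkB M)ᵀ = (blkD M)ᵀ * blkB M := by
    rw [transpose_mul, transpose_transpose, h2]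
  have hM : M = (mkDiag A).mat * (mkT _ hs).mat := by
    apply Subtype.ext
    change M.1 = fromBlocks (blkA M) 0 0 ((blkD M)ᵀ)ᵀ * fromBlocks 1 ((blkD M)ᵀ * blkB M) 0 1
    rw [fromBlocks_multiply, ← blk_eq M, h, ← Matrix.mul_assoc, h4]
    simp
  rw [hM]
  exact mul_mem (mat_mem_spGen (Or.inl ⟨_, rfl⟩)) (mat_mem_spGen (Or.inr (Or.inl ⟨_, _, rfl⟩)))

/-- Euclidean elimination by left multiplication until C = 0. The two SL₂ factors act separately on
the row pairs (A₀, C₀) and (A₁, C₁) and clear the first column of C; GL₂(ℤ) then clears the lower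
entry of the first column of A; the second SL₂ factor finishes. -/
theorem spGen_eq_top : spGen = ⊤ := by
  have hemb : ∀ g : SpecialLinearGroup (Fin 2) ℤ × SpecialLinearGroup (Fin 2) ℤ,
      blkA (embSL2 g) = diagonal ![g.1 0 0, g.2 0 0] ∧
      blkB (embSL2 g) = diagonal ![g.1 0 1, g.2 0 1] ∧
      blkC (embSL2 g) = diagonal ![g.1 1 0, g.2 1 0] ∧
      blkD (embSL2 g) = diagonal ![g.1 1 1, g.2 1 1] := fun g => blk_of_eq _ rfl
  have step3 : ∀ M : Sp4Z, blkC M 0 0 = 0 → blkC M 1 0 = 0 → blkA M 1 0 = 0 → M ∈ spGen := by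
    intro M h1 h2 h3
    obtain ⟨r1, -, r3⟩ := sp_rel M
    have e1 := congrFun (congrFun r1 0) 1
    have e3 := congrFun (congrFun r3 0) 0
    simp only [Matrix.mul_apply, transpose_apply, Fin.sum_univ_two, Matrix.sub_apply, h1, h2, h3,
      zero_mul, add_zero, sub_zero, one_apply_eq] at e1 e3
    -- Symmetry of AᵗC gives A₀₀C₀₁ = 0, and AᵗD - CᵗB = 1 excludes A₀₀ = 0.
    have h4 : blkC M 0 1 = 0 := by
      rcases mul_eq_zero.1 e1 with h | h
      · rw [h] at e3; simp at e3
      · exact h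
    obtain ⟨g, hg⟩ := exists_SL2_kill (blkA M 1 1) (blkC M 1 1)
    rw [← Subgroup.mul_mem_cancel_left spGen (embSL2_mem (1, g))]
    apply mem_spGen_of_blkC_eq_zero
    rw [(blk_mul _ _).2.2.1, (hemb _).2.2.1, (hemb _).2.2.2]
    ext i j
    fin_cases i <;> fin_cases j <;> simp [h1, h2, h3, h4, hg]
  have step2 : ∀ M : Sp4Z, blkC M 0 0 = 0 → blkC M 1 0 = 0 → M ∈ spGen := by
    intro M h1 h2
    obtain ⟨g, hg⟩ := exists_SL2_kill (blkA M 0 0) (blkA M 1 0)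
    let U : GL (Fin 2) ℤ := ⟨g.1, (g⁻¹).1, congrArg Subtype.val (mul_inv_cancel g),
      congrArg Subtype.val (inv_mul_cancel g)⟩
    rw [← Subgroup.mul_mem_cancel_left spGen
      (mat_mem_spGen (Or.inl ⟨U, rfl⟩) : (mkDiag U).mat ∈ spGen)]
    obtain ⟨b1, b2, b3, b4⟩ := blk_of_eq (mkDiag U).mat rfl
    have e1 := (blk_mul (mkDiag U).mat M).1
    have e3 := (blk_mul (mkDiag U).mat M).2.2.1
    rw [b1, b2, Matrix.zero_mul, add_zero] at e1
    rw [b3, b4, Matrix.zero_mul, zero_add] at e3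
    apply step3
    · rw [e3]; simp [Matrix.mul_apply, h1, h2]
    · rw [e3]; simp [Matrix.mul_apply, h1, h2]
    · rw [e1, Matrix.mul_apply, Fin.sum_univ_two]; exact hg
  rw [eq_top_iff]
  intro M _
  obtain ⟨g, hg⟩ := exists_SL2_kill (blkA M 0 0) (blkC M 0 0)
  obtain ⟨h, hh⟩ := exists_SL2_kill (blkA M 1 0) (blkC M 1 0)
  rw [← Subgroup.mul_mem_cancel_left spGen (embSL2_mem (g, h))]
  apply step2
  · rw [(blk_mul _ _).2.2.1, (hemb _).2.2.1, (hemb _).2.2.2]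
    simp [hg]
  · rw [(blk_mul _ _).2.2.1, (hemb _).2.2.1, (hemb _).2.2.2]
    simp [hh]

theorem act_val (M : Sp4Z) (τ : HH2) : (act M τ).1 = num M τ * (den M τ)⁻¹ := rfl

/-- The metaplectic group is generated by the elements on which the Weil representation is
prescribed. -/
theorem closure_mpGens : Subgroup.closure mpGens = ⊤ := by
  rw [eq_top_iff]
  intro γ _
  have h : γ.mat ∈ spGen := by rw [spGen_eq_top]; trivial
  obtain ⟨η, hη, hm⟩ := h
  -- This word lies over the identity matrix, and its root at τ = i·1 is i · i · 1 = -1. It is the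
  -- nontrivial element of the kernel, so both lifts of every symplectic matrix are reached.
  let ζ : Mp4Z := mkS * mkS * mkDiag (-1)
  have hζ : ζ ∈ Subgroup.closure mpGens :=
    mul_mem (mul_mem (Subgroup.subset_closure (Or.inr (Or.inr rfl)))
      (Subgroup.subset_closure (Or.inr (Or.inr rfl))))
      (Subgroup.subset_closure (Or.inl ⟨_, rfl⟩))
  have hζm : ζ.mat = 1 := by
    apply Subtype.ext
    change fromBlocks 0 (-1) 1 0 * fromBlocks 0 (-1) 1 0 *
      fromBlocks (-1 : GL (Fin 2) ℤ).1 0 0 ((-1 : GL (Fin 2) ℤ)⁻¹).1ᵀ =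
        (1 : Matrix (Fin 2 ⊕ Fin 2) (Fin 2 ⊕ Fin 2) ℤ)
    rw [← fromBlocks_one, fromBlocks_multiply, fromBlocks_multiply]
    simp
  have hdiag : act (mkDiag (-1)).mat iPt = iPt := by
    apply Subtype.ext
    obtain ⟨h1, h2, h3, h4⟩ := blk_of_eq (mkDiag (-1)).mat rfl
    rw [act_val, num, den, h1, h2, h3, h4]
    have e1 : toC (-1 : GL (Fin 2) ℤ).1 = -1 := by
      rw [Units.val_neg, Units.val_one, toC_neg, toC_one]
    have e2 : toC ((-1 : GL (Fin 2) ℤ)⁻¹).1ᵀ = -1 := by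
      rw [inv_neg, inv_one, Units.val_neg, Units.val_one, transpose_neg, transpose_one, toC_neg,
        toC_one]
    have e3 : (-1 : Matrix (Fin 2) (Fin 2) ℂ)⁻¹ = -1 := Matrix.inv_eq_right_inv (by simp)
    rw [e1, e2, toC_zero, Matrix.zero_mul, zero_add, add_zero, e3]
    simp
  have hS : act mkS.mat iPt = iPt := by
    apply Subtype.ext
    change (invPt iPt).1 = _
    rw [invPt_val]
    have : (iPt.1)⁻¹ = -iPt.1 := by
      refine Matrix.inv_eq_right_inv ?_
      simp [iPt, smul_smul]
    rw [this, neg_neg]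
  have hζr : ζ.root iPt = -1 := by
    change sqrtDet (act mkS.mat (act (mkDiag (-1)).mat iPt)) *
      sqrtDet (act (mkDiag (-1)).mat iPt) * (mkDiag (-1)).root iPt = -1
    have hr : (mkDiag (-1)).root iPt = 1 := by
      change (((-1 : Matrix (Fin 2) (Fin 2) ℤ).det : ℤ) : ℂ) ^ (1 / 2 : ℂ) = 1
      simp [det_neg]
    rw [hdiag, hS, sqrtDet_I iPt rfl, hr, mul_one, Complex.I_mul_I]
  have hζ1 : ζ.root = -(1 : Mp4Z).root := by
    rcases Mp4Z.root_eq_or_eq_neg ζ 1 hζm with h | h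
    · rw [h] at hζr
      have : (1 : ℂ) = -1 := hζr
      norm_num at this
    · exact h
  rcases Mp4Z.root_eq_or_eq_neg γ η hm.symm with h | h
  · rwa [show γ = η from Mp4Z.ext hm.symm h]
  · have : γ = η * ζ := by
      refine Mp4Z.ext ?_ ?_
      · rw [Mp4Z.mat_mul, hζm, mul_one]; exact hm.symm
      · funext τ
        rw [Mp4Z.root_mul, hζm, act_one, hζ1, h]
        change -η.root τ = η.root τ * -1
        ring
    rw [this]
    exact mul_mem hη hζ

end Generators

/-! ### Lattice vectors and the theta summand in orthogonal coordinates -/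

section LatticeCoord

variable {L : Type*} [AddCommGroup L] {q : QuadraticForm ℤ L} {b : ℕ}
  {e : Module.Basis (Fin b ⊕ Fin 2) ℝ (ℝ ⊗[ℤ] L)}

/-- The signs of the diagonal form of signature `(b, 2)`. -/
def sgn (b : ℕ) : Fin b ⊕ Fin 2 → ℝ := Sum.elim (fun _ => 1) fun _ => -1

theorem form_basis (he : IsSignatureBasis q e) (i j : Fin b ⊕ Fin 2) :
    form q (e i) (e j) = if i = j then sgn b i else 0 := by
  split_ifs with h
  · subst h
    rcases i with i | i
    · exact he.2.1 i
    · exact he.2.2 i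
  · exact he.1 i j h

theorem form_eq_sum_repr (he : IsSignatureBasis q e) (x y : ℝ ⊗[ℤ] L) :
    form q x y = ∑ i, sgn b i * e.repr x i * e.repr y i := by
  conv_lhs => rw [← e.sum_repr x, ← e.sum_repr y]
  simp only [map_sum, LinearMap.sum_apply, map_smul, LinearMap.smul_apply, form_basis he,
    smul_eq_mul, mul_ite, mul_zero, Finset.sum_ite_eq', Finset.mem_univ, if_true]
  exact Finset.sum_congr rfl fun i _ => by ring

theorem form_nondegenerate (he : IsSignatureBasis q e) : (form q).Nondegenerate := by
  classical
  rw [LinearMap.BilinForm.nondegenerate_iff_det_ne_zero e]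
  have : LinearMap.BilinForm.toMatrix e (form q) = Matrix.diagonal (sgn b) := by
    ext i j
    rw [LinearMap.BilinForm.toMatrix_apply, form_basis he, Matrix.diagonal_apply]
  rw [this, Matrix.det_diagonal, Finset.prod_ne_zero_iff]
  rintro (i | i) _ <;> simp [sgn]

/-- The coordinates of a pair of vectors with respect to the basis `g⁻¹e`. -/
def coord (e : Module.Basis (Fin b ⊕ Fin 2) ℝ (ℝ ⊗[ℤ] L))
    (g : (ℝ ⊗[ℤ] L) ≃ₗ[ℝ] (ℝ ⊗[ℤ] L)) (v : Fin 2 → ℝ ⊗[ℤ] L) : (Fin b ⊕ Fin 2) × Fin 2 → ℝ :=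
  fun p => e.repr (g (v p.2)) p.1

/-- The trace form on pairs of vectors. -/
def trForm (q : QuadraticForm ℤ L) (v w : Fin 2 → ℝ ⊗[ℤ] L) : ℝ := ∑ j, form q (v j) (w j)

theorem trForm_comm (v w : Fin 2 → ℝ ⊗[ℤ] L) : trForm q v w = trForm q w v :=
  Finset.sum_congr rfl fun _ _ => form_symm q _ _

theorem trForm_add_left (v v' w : Fin 2 → ℝ ⊗[ℤ] L) :
    trForm q (v + v') w = trForm q v w + trForm q v' w := by
  simp [trForm, Finset.sum_add_distrib]

theorem trForm_add_right (v w w' : Fin 2 → ℝ ⊗[ℤ] L) :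
    trForm q v (w + w') = trForm q v w + trForm q v w' := by
  simp [trForm, Finset.sum_add_distrib]

theorem trForm_smul_left (c : ℝ) (v w : Fin 2 → ℝ ⊗[ℤ] L) :
    trForm q (c • v) w = c * trForm q v w := by
  simp [trForm, mul_add]

theorem trForm_neg_right (v w : Fin 2 → ℝ ⊗[ℤ] L) : trForm q v (-w) = -trForm q v w := by
  simp [trForm]

theorem form_eq_coord (he : IsSignatureBasis q e) {g : (ℝ ⊗[ℤ] L) ≃ₗ[ℝ] (ℝ ⊗[ℤ] L)}
    (hg : g ∈ SOV q) (x y : ℝ ⊗[ℤ] L) :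
    form q x y = ∑ i, sgn b i * e.repr (g x) i * e.repr (g y) i := by
  rw [← hg.1, form_eq_sum_repr he]

theorem trForm_eq_coord (he : IsSignatureBasis q e) {g : (ℝ ⊗[ℤ] L) ≃ₗ[ℝ] (ℝ ⊗[ℤ] L)}
    (hg : g ∈ SOV q) (v w : Fin 2 → ℝ ⊗[ℤ] L) :
    trForm q v w = ∑ p : (Fin b ⊕ Fin 2) × Fin 2, coord e g v p * (sgn b p.1 * coord e g w p) := by
  rw [Fintype.sum_prod_type, Finset.sum_comm]
  simp only [trForm, form_eq_coord he hg]
  exact Finset.sum_congr rfl fun j _ => Finset.sum_congr rfl fun i _ => by simp only [coord]; ring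

theorem repr_projz (g : (ℝ ⊗[ℤ] L) ≃ₗ[ℝ] (ℝ ⊗[ℤ] L)) (x : ℝ ⊗[ℤ] L) (i : Fin b ⊕ Fin 2) :
    e.repr (g (projz e g x)) i = Sum.elim (fun _ => 0) (fun k => e.repr (g x) (Sum.inr k)) i := by
  rw [projz, LinearEquiv.apply_symm_apply]
  rcases i with i | i
  · simp
  · fin_cases i <;> simp [Fin.sum_univ_two]

theorem trace_qmat_mul (u : Fin 2 → ℝ ⊗[ℤ] L) (M : Matrix (Fin 2) (Fin 2) ℂ) (hM : Mᵀ = M) :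
    (ofR (qmat q u) * M).trace = 1 / 2 * ∑ j, ∑ k, M j k * (form q (u j) (u k) : ℂ) := by
  have h : ∀ i j, M j i = M i j := fun i j => congrFun (congrFun hM i) j
  simp only [Matrix.trace, Matrix.diag_apply, Matrix.mul_apply, ofR, qmat, gram,
    Matrix.map_apply, Matrix.smul_apply, Matrix.of_apply, smul_eq_mul, Finset.mul_sum]
  refine Finset.sum_congr rfl fun j _ => Finset.sum_congr rfl fun k _ => ?_
  rw [h j k]
  push_cast
  ring

theorem trace_gram (u w : Fin 2 → ℝ ⊗[ℤ] L) : (ofR (gram q u w)).trace = (trForm q u w : ℂ) := by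
  simp [Matrix.trace, ofR, gram, trForm]

/-- The summand of the theta series in coordinates. -/
theorem thetaTerm_eq (he : IsSignatureBasis q e) {g : (ℝ ⊗[ℤ] L) ≃ₗ[ℝ] (ℝ ⊗[ℤ] L)}
    (hg : g ∈ SOV q) (P : MvPolynomial ((Fin b ⊕ Fin 2) × Fin 2) ℂ) (τ : HH2)
    (α β v : Fin 2 → ℝ ⊗[ℤ] L) :
    thetaTerm q e P τ α β g v = coordTerm P τ (coord e g (v + β)) *
      expi (-(trForm q (v + (1 / 2 : ℝ) • β) α : ℝ)) := by
  rw [thetaTerm, coordTerm, sub_eq_add_neg, expi_add, trace_gram, ← mul_assoc]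
  congr 2
  have hs : (τ.1.map (starRingEnd ℂ))ᵀ = τ.1.map (starRingEnd ℂ) := by
    rw [← Matrix.transpose_map, τ.2.1]
  rw [trace_qmat_mul _ _ τ.2.1, trace_qmat_mul _ _ hs, gaussProd, ← Complex.exp_sum, expi,
    Fintype.sum_sum_type]
  congr 1
  set w := v + β
  have h1 : ∀ j k, form q (w j - projz e g (w j)) (w k - projz e g (w k)) =
      ∑ i : Fin b, coord e g w (Sum.inl i, j) * coord e g w (Sum.inl i, k) := by
    intro j k
    rw [form_eq_coord he hg]
    simp [Fintype.sum_sum_type, repr_projz, sgn, coord]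
  have h2 : ∀ j k, form q (projz e g (w j)) (projz e g (w k)) =
      -∑ i : Fin 2, coord e g w (Sum.inr i, j) * coord e g w (Sum.inr i, k) := by
    intro j k
    rw [form_eq_coord he hg]
    simp only [Fintype.sum_sum_type, repr_projz, sgn, coord, Sum.elim_inl, Sum.elim_inr]
    simp
  have h3 : ∀ i, sgnPt b τ (Sum.inl i) = τ := fun _ => rfl
  have h4 : ∀ i, sgnPt b τ (Sum.inr i) = negConj τ := fun _ => rfl
  have h5 : ∀ j k, (negConj τ).1 j k = -(starRingEnd ℂ) (τ.1 j k) := fun _ _ => rfl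
  simp only [h1, h2, h3, h4, quadVal, h5, Matrix.map_apply]
  rw [mul_add]
  congr 1
  · simp only [Complex.ofReal_sum, Complex.ofReal_mul, Finset.mul_sum]
    rw [Finset.sum_comm]
    rw [Finset.sum_comm (s := (Finset.univ : Finset (Fin b)))]
    rw [Finset.sum_comm]
    refine Finset.sum_congr rfl fun j _ => ?_
    rw [Finset.sum_comm (s := (Finset.univ : Finset (Fin b)))]
    refine Finset.sum_congr rfl fun k _ => Finset.sum_congr rfl fun i _ => ?_
    ring
  · simp only [Complex.ofReal_neg, Complex.ofReal_sum, Complex.ofReal_mul, Finset.mul_sum]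
    simp only [Fin.sum_univ_two]
    ring

/-- Bases of a nondegenerate lattice and of its dual lattice. -/
theorem exists_dual_bases [Module.Free ℤ L] [Module.Finite ℤ L] (he : IsSignatureBasis q e) :
    ∃ (cV dV : Module.Basis (Fin b ⊕ Fin 2) ℝ (ℝ ⊗[ℤ] L))
      (bL : Module.Basis (Fin b ⊕ Fin 2) ℤ (lat L)) (bD : Module.Basis (Fin b ⊕ Fin 2) ℤ (dual q)),
      (∀ k, (bL k : ℝ ⊗[ℤ] L) = cV k) ∧ (∀ k, (bD k : ℝ ⊗[ℤ] L) = dV k) ∧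
      ∀ k l, form q (dV k) (cV l) = if k = l then 1 else 0 := by
  classical
  have hq := form_nondegenerate he
  let c0 := Module.Free.chooseBasis ℤ L
  let ε := (c0.baseChange ℝ).indexEquiv e
  let c := c0.reindex ε
  let cV := c.baseChange ℝ
  have hc : ∀ i, cV i = (1 : ℝ) ⊗ₜ[ℤ] c i := fun i => by simp [cV]
  have hlat : lat L = Submodule.span ℤ (Set.range cV) := by
    apply le_antisymm
    · intro x hx
      obtain ⟨l, rfl⟩ := mem_lat.1 hx
      rw [← c.sum_repr l, TensorProduct.tmul_sum]
      refine Submodule.sum_mem _ fun i _ => ?_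
      have h : (1 : ℝ) ⊗ₜ[ℤ] (c.repr l i • c i) = c.repr l i • cV i := by
        rw [hc]
        exact (TensorProduct.mk ℤ ℝ L 1).toAddMonoidHom.map_zsmul _ (c i)
      rw [h]
      exact Submodule.smul_mem _ _ (Submodule.subset_span ⟨i, rfl⟩)
    · rw [Submodule.span_le]
      rintro _ ⟨i, rfl⟩
      exact mem_lat.2 ⟨c i, (hc i).symm⟩
  have hdual : dual q = Submodule.span ℤ (Set.range ((form q).dualBasis hq cV)) := by
    rw [dual, hlat, LinearMap.BilinForm.dualSubmodule_span_of_basis _ hq cV]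
  refine ⟨cV, (form q).dualBasis hq cV,
    (cV.restrictScalars ℤ).map (LinearEquiv.ofEq _ _ hlat.symm),
    (((form q).dualBasis hq cV).restrictScalars ℤ).map (LinearEquiv.ofEq _ _ hdual.symm),
    fun k => ?_, fun k => ?_, fun k l => ?_⟩
  · simp
  · simp
  · rw [LinearMap.BilinForm.apply_dualBasis_left]
    simp [eq_comm]

end LatticeCoord

/-! ### Symmetries of the coordinate summand -/

section Subst

open MvPolynomial

variable {b : ℕ}

/-- Substitution of block-diagonal linear forms in the harmonic polynomial factor. -/
theorem evalR_expLap_subst {P : MvPolynomial ((Fin b ⊕ Fin 2) × Fin 2) ℂ} {mpos mneg : ℕ}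
    (hP : IsVeryHomogeneous P mpos mneg) {y y' : Matrix (Fin 2) (Fin 2) ℝ} (hy : yᵀ = y)
    (hy' : y'ᵀ = y') (N N' : Matrix (Fin 2) (Fin 2) ℂ) (hN : Nᵀ * ofR y⁻¹ * N = ofR y'⁻¹)
    (hN' : N'ᵀ * ofR y⁻¹ * N' = ofR y'⁻¹) (x x' : (Fin b ⊕ Fin 2) × Fin 2 → ℝ)
    (hx : ∀ i j, (x' (Sum.inl i, j) : ℂ) = ∑ k, x (Sum.inl i, k) * N k j)
    (hx' : ∀ i j, (x' (Sum.inr i, j) : ℂ) = ∑ k, x (Sum.inr i, k) * N' k j) :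
    evalR x' (expLap y' P) = N.det ^ mpos * N'.det ^ mneg * evalR x (expLap y P) := by
  set M : Fin b ⊕ Fin 2 → Matrix (Fin 2) (Fin 2) ℂ :=
    Sum.elim (fun _ => Nᵀ) fun _ => N'ᵀ with hM
  have hinv : ∀ {y : Matrix (Fin 2) (Fin 2) ℝ}, yᵀ = y → (ofR y⁻¹)ᵀ = ofR y⁻¹ := by
    intro y hy
    have : (y⁻¹)ᵀ = y⁻¹ := by rw [Matrix.transpose_nonsing_inv, hy]
    conv_rhs => rw [← this]
    rfl
  have hsymm : ∀ {y : Matrix (Fin 2) (Fin 2) ℝ}, yᵀ = y → ∀ p s,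
      (blockMat fun _ : Fin b ⊕ Fin 2 => (-1 / (8 * Real.pi) : ℂ) • ofR y⁻¹) p s =
      (blockMat fun _ : Fin b ⊕ Fin 2 => (-1 / (8 * Real.pi) : ℂ) • ofR y⁻¹) s p := by
    intro y hy
    exact blockMat_symm fun i => by rw [Matrix.transpose_smul, hinv hy]
  have heval : (fun p => (x' p : ℂ)) = fun p => ∑ s, blockMat M p s * (x s : ℂ) := by
    funext p
    have := sum_blockMat M p (fun s => (x s : ℂ))
    simp only [smul_eq_mul] at this
    rw [this]
    obtain ⟨i | i, j⟩ := p
    · rw [hx]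
      exact Finset.sum_congr rfl fun k _ => mul_comm _ _
    · rw [hx']
      exact Finset.sum_congr rfl fun k _ => mul_comm _ _
  have hNc : blockMat M * (blockMat fun _ : Fin b ⊕ Fin 2 =>
      (-1 / (8 * Real.pi) : ℂ) • ofR y⁻¹) * (blockMat M)ᵀ =
      blockMat fun _ : Fin b ⊕ Fin 2 => (-1 / (8 * Real.pi) : ℂ) • ofR y'⁻¹ := by
    rw [blockMat_mul, blockMat_transpose, blockMat_mul]
    congr 1
    funext i
    rcases i with i | i
    · simp only [hM, Sum.elim_inl, Matrix.transpose_transpose, Matrix.mul_smul, Matrix.smul_mul, hN]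
    · simp only [hM, Sum.elim_inr, Matrix.transpose_transpose, Matrix.mul_smul, Matrix.smul_mul,
        hN']
  rw [evalR, evalR, expLap_eq_expDL _ hy, expLap_eq_expDL _ hy', heval, ← eval_linear_subst,
    aeval_expDL (blockMat M) _ _ (hsymm hy') (hsymm hy) hNc,
    hP.aeval_blockMat M N N' (fun _ => rfl) (fun _ => rfl), map_smul, smul_eval]

/-- Negating the pair of negative coordinates is right multiplication of x⁻ by -1, a 2 × 2 matrix of
determinant 1, and the Gaussian is even. This lets Euclidean Fourier duality replace duality for the
indefinite form. -/
theorem coordTerm_sgn {P : MvPolynomial ((Fin b ⊕ Fin 2) × Fin 2) ℂ} {mpos mneg : ℕ}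
    (hP : IsVeryHomogeneous P mpos mneg) (τ : HH2) (x : (Fin b ⊕ Fin 2) × Fin 2 → ℝ) :
    coordTerm P τ (fun p => sgn b p.1 * x p) = coordTerm P τ x := by
  have h := evalR_expLap_subst hP (imPart_symm τ) (imPart_symm τ) 1 (-1) (by simp) (by simp) x
    (fun p => sgn b p.1 * x p) (fun i j => by simp [sgn, Matrix.one_apply])
    (fun i j => by simp [sgn, Matrix.one_apply])
  rw [coordTerm, h, coordTerm, gaussProd, gaussProd]
  have hd : (-1 : Matrix (Fin 2) (Fin 2) ℂ).det = 1 := by rw [Matrix.det_neg]; simp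
  rw [hd, Matrix.det_one, one_pow, one_pow, one_mul, one_mul]
  congr 1
  refine Finset.prod_congr rfl fun i _ => ?_
  rcases i with i | i <;> simp [sgn, quadVal]

/-- Passing from τ to AτAᵗ is compensated by x ↦ xA in the Gaussian, and Aᵗy'⁻¹A = y⁻¹ does the same
for the differential operator. Very homogeneity leaves only a power of det A. -/
theorem coordTerm_mul_GL {P : MvPolynomial ((Fin b ⊕ Fin 2) × Fin 2) ℂ} {mpos mneg : ℕ}
    (hP : IsVeryHomogeneous P mpos mneg) (A : GL (Fin 2) ℤ) (τ τ' : HH2)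
    (h : τ'.1 = toC A.1 * τ.1 * (toC A.1)ᵀ) (x x' : (Fin b ⊕ Fin 2) × Fin 2 → ℝ)
    (hx : ∀ i j, x' (i, j) = ∑ k, x (i, k) * A.1 k j) :
    coordTerm P τ x' = (A.1.det : ℂ) ^ (mpos + mneg) * coordTerm P τ' x := by
  have hdet : IsUnit A.1.det := by
    rw [← Matrix.isUnit_iff_isUnit_det]; exact A.isUnit
  have hAR : toC A.1 = ofR (A.1.map (Int.cast : ℤ → ℝ)) := by ext i j; simp [toC, ofR]
  have hy : imPart τ'.1 = A.1.map (Int.cast : ℤ → ℝ) * imPart τ.1 *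
      (A.1.map (Int.cast : ℤ → ℝ))ᵀ := by
    ext i j
    simp [imPart, h, Matrix.mul_apply, toC, Fin.sum_univ_two]
  have hdR : IsUnit (A.1.map (Int.cast : ℤ → ℝ)).det := by
    have := (Int.castRingHom ℝ).map_det A.1
    rw [RingHom.mapMatrix_apply] at this
    change IsUnit (A.1.map (Int.castRingHom ℝ)).det
    rw [← this]
    exact hdet.map _
  have hinv : (A.1.map (Int.cast : ℤ → ℝ))ᵀ * (imPart τ'.1)⁻¹ * A.1.map (Int.cast : ℤ → ℝ) =
      (imPart τ.1)⁻¹ := by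
    rw [hy, Matrix.mul_inv_rev, Matrix.mul_inv_rev, ← Matrix.mul_assoc,
      Matrix.mul_nonsing_inv _ (by rwa [Matrix.det_transpose]), Matrix.one_mul, Matrix.mul_assoc,
      Matrix.nonsing_inv_mul _ hdR, Matrix.mul_one]
  have hN : (toC A.1)ᵀ * ofR (imPart τ'.1)⁻¹ * toC A.1 = ofR (imPart τ.1)⁻¹ := by
    rw [← hinv, ofR_mul, ofR_mul, hAR]
    rfl
  have h1 := evalR_expLap_subst hP (imPart_symm τ') (imPart_symm τ) (toC A.1) (toC A.1) hN hN x x'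
    (fun i j => by rw [hx]; simp [toC]) (fun i j => by rw [hx]; simp [toC])
  rw [coordTerm, h1, coordTerm, gaussProd, gaussProd, toC_det, ← pow_add, mul_assoc]
  congr 2
  refine Finset.prod_congr rfl fun i _ => ?_
  congr 2
  rcases i with i | i
  · have h3 : ∀ j k, (sgnPt b τ' (Sum.inl i)).1 j k = (toC A.1 * τ.1 * (toC A.1)ᵀ) j k :=
      fun j k => by rw [← h]; rfl
    have h4 : ∀ j k, (sgnPt b τ (Sum.inl i)).1 j k = τ.1 j k := fun _ _ => rfl
    simp only [quadVal, h3, h4, hx, toC, Matrix.mul_apply, Fin.sum_univ_two, Matrix.transpose_apply,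
      Matrix.map_apply]
    push_cast
    ring
  · have h3 : ∀ j k, (sgnPt b τ' (Sum.inr i)).1 j k =
        -(starRingEnd ℂ) ((toC A.1 * τ.1 * (toC A.1)ᵀ) j k) := fun j k => by rw [← h]; rfl
    have h4 : ∀ j k, (sgnPt b τ (Sum.inr i)).1 j k = -(starRingEnd ℂ) (τ.1 j k) := fun _ _ => rfl
    simp only [quadVal, h3, h4, hx, toC, Matrix.mul_apply, Fin.sum_univ_two, Matrix.transpose_apply,
      Matrix.map_apply, map_add, map_mul]
    simp only [map_intCast]
    push_cast
    ring

end Subst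

/-! ### Integral coordinates and absolute convergence -/

section Param

variable {L : Type*} [AddCommGroup L] {q : QuadraticForm ℤ L} {b : ℕ}
  {e : Module.Basis (Fin b ⊕ Fin 2) ℝ (ℝ ⊗[ℤ] L)}

/-- The pair of vectors with given coordinates. -/
def pairVec {ι V : Type*} [Fintype ι] [AddCommGroup V] [Module ℝ V] (c : Module.Basis ι ℝ V)
    (t : ι × Fin 2 → ℝ) : Fin 2 → V := fun j => ∑ k, t (k, j) • c k

/-- Pairs of vectors of a lattice are parametrized by their integral coordinates. -/
def pairEquiv {ι W : Type*} [Fintype ι] [AddCommGroup W] (c : Module.Basis ι ℤ W) :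
    (ι × Fin 2 → ℤ) ≃ (Fin 2 → W) where
  toFun n j := ∑ k, n (k, j) • c k
  invFun w p := c.repr (w p.2) p.1
  left_inv n := by
    funext p
    exact congrFun (c.repr_sum_self fun k => n (k, p.2)) p.1
  right_inv w := by
    funext j
    exact c.sum_repr (w j)

theorem coe_pairEquiv {ι : Type*} [Fintype ι] {S : Submodule ℤ (ℝ ⊗[ℤ] L)}
    (c : Module.Basis ι ℤ S) (cV : Module.Basis ι ℝ (ℝ ⊗[ℤ] L))
    (h : ∀ k, (c k : ℝ ⊗[ℤ] L) = cV k) (n : ι × Fin 2 → ℤ) :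
    (fun j => (pairEquiv c n j : ℝ ⊗[ℤ] L)) = pairVec cV (intVec n) := by
  funext j
  simp [pairEquiv, pairVec, intVec, h, Int.cast_smul_eq_zsmul]

theorem coord_add (g : (ℝ ⊗[ℤ] L) ≃ₗ[ℝ] (ℝ ⊗[ℤ] L)) (v w : Fin 2 → ℝ ⊗[ℤ] L) :
    coord e g (v + w) = coord e g v + coord e g w := by
  funext p
  simp [coord]

/-- The change of coordinates from one basis to another, on pairs of vectors. -/
def coordMap (e : Module.Basis (Fin b ⊕ Fin 2) ℝ (ℝ ⊗[ℤ] L))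
    (g : (ℝ ⊗[ℤ] L) ≃ₗ[ℝ] (ℝ ⊗[ℤ] L)) (c : Module.Basis (Fin b ⊕ Fin 2) ℝ (ℝ ⊗[ℤ] L)) :
    ((Fin b ⊕ Fin 2) × Fin 2 → ℝ) →ₗ[ℝ] ((Fin b ⊕ Fin 2) × Fin 2 → ℝ) where
  toFun t := coord e g (pairVec c t)
  map_add' s t := by
    rw [← coord_add]
    congr 1
    funext j
    simp [pairVec, add_smul, Finset.sum_add_distrib]
  map_smul' r t := by
    funext p
    simp only [coord, pairVec, Pi.smul_apply, smul_eq_mul, mul_smul, ← Finset.smul_sum, map_smul,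
      Finsupp.smul_apply, RingHom.id_apply]

theorem coordMap_apply (e : Module.Basis (Fin b ⊕ Fin 2) ℝ (ℝ ⊗[ℤ] L))
    (g : (ℝ ⊗[ℤ] L) ≃ₗ[ℝ] (ℝ ⊗[ℤ] L)) (c : Module.Basis (Fin b ⊕ Fin 2) ℝ (ℝ ⊗[ℤ] L))
    (t : (Fin b ⊕ Fin 2) × Fin 2 → ℝ) : coordMap e g c t = coord e g (pairVec c t) := rfl

theorem coordMap_injective (g : (ℝ ⊗[ℤ] L) ≃ₗ[ℝ] (ℝ ⊗[ℤ] L))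
    (c : Module.Basis (Fin b ⊕ Fin 2) ℝ (ℝ ⊗[ℤ] L)) :
    Function.Injective (coordMap e g c) := by
  intro s t h
  have h1 : pairVec c s = pairVec c t := by
    funext j
    apply g.injective
    apply e.repr.injective
    ext i
    exact congrFun h (i, j)
  funext p
  have h2 := congrArg (fun v => c.repr v p.1) (congrFun h1 p.2)
  have h3 : ∀ t : (Fin b ⊕ Fin 2) × Fin 2 → ℝ, c.repr (pairVec c t p.2) p.1 = t p := fun t =>
    congrFun (c.repr_sum_self fun k => t (k, p.2)) p.1
  simpa only [h3] using h2

theorem continuous_expi_ofReal {X : Type*} [TopologicalSpace X] {f : X → ℝ} (hf : Continuous f) :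
    Continuous fun x => expi (f x : ℝ) := by
  unfold expi
  fun_prop

theorem norm_expi_ofReal (r : ℝ) : ‖expi (r : ℂ)‖ = 1 := by simp [norm_expi]

theorem trForm_pairVec_continuous (c : Module.Basis (Fin b ⊕ Fin 2) ℝ (ℝ ⊗[ℤ] L))
    (w : Fin 2 → ℝ ⊗[ℤ] L) : Continuous fun t => trForm q (pairVec c t) w := by
  simp only [trForm, pairVec, map_sum, map_smul, LinearMap.sum_apply, LinearMap.smul_apply,
    smul_eq_mul]
  fun_prop

/-- The free real phase `f` covers the character of the theta series as well as the additional
character used in Poisson summation. -/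
theorem rapidDecay_coordTerm_comp (g : (ℝ ⊗[ℤ] L) ≃ₗ[ℝ] (ℝ ⊗[ℤ] L))
    (c : Module.Basis (Fin b ⊕ Fin 2) ℝ (ℝ ⊗[ℤ] L))
    (P : MvPolynomial ((Fin b ⊕ Fin 2) × Fin 2) ℂ) (τ : HH2) (β : Fin 2 → ℝ ⊗[ℤ] L)
    {f : ((Fin b ⊕ Fin 2) × Fin 2 → ℝ) → ℝ} (hf : Continuous f) :
    RapidDecay fun t => expi (f t : ℝ) * coordTerm P τ (coord e g (pairVec c t + β)) := by
  have h := ((rapidDecay_coordTerm P τ).comp_affine (coordMap e g c) (coordMap_injective g c)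
    (coord e g β)).mul_of_bound (continuous_expi_ofReal hf) 0 1
    (fun x => by rw [norm_expi_ofReal]; simp)
  simpa only [coordMap_apply, ← coord_add] using h

/-- In integral coordinates the terms are values at integral points of a rapidly decaying function.
Summing over all of (L')² covers all classes at once. -/
theorem summable_thetaTerm [Module.Free ℤ L] [Module.Finite ℤ L] (he : IsSignatureBasis q e) {g : (ℝ ⊗[ℤ] L) ≃ₗ[ℝ] (ℝ ⊗[ℤ] L)}
    (hg : g ∈ SOV q) (P : MvPolynomial ((Fin b ⊕ Fin 2) × Fin 2) ℂ) (τ : HH2)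
    (α β : Fin 2 → ℝ ⊗[ℤ] L) :
    Summable fun v : Fin 2 → dual q => thetaTerm q e P τ α β g fun j => (v j : ℝ ⊗[ℤ] L) := by
  obtain ⟨cV, dV, bL, bD, -, hD, -⟩ := exists_dual_bases he
  rw [← (pairEquiv bD).summable_iff]
  have h := (rapidDecay_coordTerm_comp (e := e) g dV P τ β
    (f := fun t => -trForm q (pairVec dV t + (1 / 2 : ℝ) • β) α) (by
      simp only [trForm_add_left]
      exact ((trForm_pairVec_continuous dV α).add continuous_const).neg)).summable 0
  refine h.congr fun n => ?_
  rw [Function.comp_apply, coe_pairEquiv bD dV hD, thetaTerm_eq he hg, zero_add, mul_comm,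
    Complex.ofReal_neg]

/-- The component of the theta function at a class, without the determinant factor. -/
def thetaSeries (q : QuadraticForm ℤ L) (e : Module.Basis (Fin b ⊕ Fin 2) ℝ (ℝ ⊗[ℤ] L))
    (P : MvPolynomial ((Fin b ⊕ Fin 2) × Fin 2) ℂ) (τ : HH2) (α β : Fin 2 → ℝ ⊗[ℤ] L)
    (g : (ℝ ⊗[ℤ] L) ≃ₗ[ℝ] (ℝ ⊗[ℤ] L)) (γ : Fin 2 → Disc q) : ℂ :=
  ∑' v : {v : Fin 2 → dual q // cls q v = γ},
    thetaTerm q e P τ α β g (fun j => (v.1 j : ℝ ⊗[ℤ] L))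

theorem theta_apply (q : QuadraticForm ℤ L) (e : Module.Basis (Fin b ⊕ Fin 2) ℝ (ℝ ⊗[ℤ] L))
    (P : MvPolynomial ((Fin b ⊕ Fin 2) × Fin 2) ℂ) (mneg : ℕ) (τ : HH2) (α β : Fin 2 → ℝ ⊗[ℤ] L)
    (g : (ℝ ⊗[ℤ] L) ≃ₗ[ℝ] (ℝ ⊗[ℤ] L)) (γ : Fin 2 → Disc q) :
    theta q e P mneg τ α β g γ =
      (((imPart τ.1).det ^ (1 + mneg) : ℝ) : ℂ) * thetaSeries q e P τ α β g γ := rfl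

end Param

/-! ### Translations τ ↦ τ + B -/

section Translation

variable {L : Type*} [AddCommGroup L] {q : QuadraticForm ℤ L} {b : ℕ}
  {e : Module.Basis (Fin b ⊕ Fin 2) ℝ (ℝ ⊗[ℤ] L)}

theorem act_mkT (B : Matrix (Fin 2) (Fin 2) ℤ) (hB : Bᵀ = B) (τ : HH2) :
    (act (mkT B hB).mat τ).1 = τ.1 + toC B := by
  obtain ⟨h1, h2, h3, h4⟩ := blk_of_eq (mkT B hB).mat (A := 1) (B := B) (C := 0) (D := 1) rfl
  rw [act_val, num, den, h1, h2, h3, h4]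
  simp [toC_one, toC_zero]

theorem imPart_act_mkT (B : Matrix (Fin 2) (Fin 2) ℤ) (hB : Bᵀ = B) (τ : HH2) :
    imPart (act (mkT B hB).mat τ).1 = imPart τ.1 := by
  rw [act_mkT]
  ext i j
  simp [imPart, toC]

/-- B is real, so -τ̄ moves by -B. The resulting signs assemble the increments into the indefinite
form. -/
theorem quadVal_sgnPt_mkT (B : Matrix (Fin 2) (Fin 2) ℤ) (hB : Bᵀ = B) (τ : HH2)
    (x : (Fin b ⊕ Fin 2) × Fin 2 → ℝ) (i : Fin b ⊕ Fin 2) :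
    quadVal (sgnPt b (act (mkT B hB).mat τ) i).1 (fun j => x (i, j)) =
      quadVal (sgnPt b τ i).1 (fun j => x (i, j)) +
        sgn b i * quadVal (toC B) fun j => x (i, j) := by
  rcases i with i | i
  · have h : (sgnPt b (act (mkT B hB).mat τ) (Sum.inl i)).1 = τ.1 + toC B := act_mkT B hB τ
    have h' : (sgnPt b τ (Sum.inl i)).1 = τ.1 := rfl
    simp only [h, h', quadVal, Matrix.add_apply, add_mul, Finset.sum_add_distrib, sgn]
    simp
  · have h : ∀ j k, (sgnPt b (act (mkT B hB).mat τ) (Sum.inr i)).1 j k =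
        (sgnPt b τ (Sum.inr i)).1 j k - toC B j k := by
      intro j k
      change -(starRingEnd ℂ) ((act (mkT B hB).mat τ).1 j k) =
        -(starRingEnd ℂ) (τ.1 j k) - toC B j k
      rw [act_mkT, Matrix.add_apply, map_add]
      simp [toC]
      ring
    simp only [quadVal, h, sub_mul, Finset.sum_sub_distrib, sgn]
    simp
    ring

theorem gaussProd_sgnPt_mkT (he : IsSignatureBasis q e) {g : (ℝ ⊗[ℤ] L) ≃ₗ[ℝ] (ℝ ⊗[ℤ] L)}
    (hg : g ∈ SOV q) (B : Matrix (Fin 2) (Fin 2) ℤ) (hB : Bᵀ = B) (τ : HH2)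
    (u : Fin 2 → ℝ ⊗[ℤ] L) :
    gaussProd (sgnPt b (act (mkT B hB).mat τ)) (coord e g u) =
      gaussProd (sgnPt b τ) (coord e g u) * expi (ofR (qmat q u) * toC B).trace := by
  have hs : (toC B)ᵀ = toC B := by rw [← toC_transpose, hB]
  rw [trace_qmat_mul _ _ hs, gaussProd, gaussProd, ← Complex.exp_sum, ← Complex.exp_sum, expi,
    ← Complex.exp_add]
  congr 1
  have h2 : ∀ j k, form q (u j) (u k) =
      ∑ i, sgn b i * coord e g u (i, j) * coord e g u (i, k) := fun j k =>
    form_eq_coord he hg _ _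
  simp only [quadVal_sgnPt_mkT, h2, mul_add, Finset.sum_add_distrib]
  congr 1
  simp only [quadVal, Fin.sum_univ_two, Complex.ofReal_sum, Finset.mul_sum,
    ← Finset.sum_add_distrib]
  refine Finset.sum_congr rfl fun i _ => ?_
  push_cast
  ring

theorem trForm_rmul_right (u v : Fin 2 → ℝ ⊗[ℤ] L) (B : Matrix (Fin 2) (Fin 2) ℤ) :
    trForm q u (rmul v Bᵀ) = ∑ j, ∑ k, (B j k : ℝ) * form q (u j) (v k) := by
  refine Finset.sum_congr rfl fun j _ => ?_
  rw [rmul, map_sum]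
  refine Finset.sum_congr rfl fun k _ => ?_
  rw [map_zsmul, zsmul_eq_mul, Matrix.transpose_apply]

/-- Expanding tr q(u + β)B gives tr q(u)B plus tr(u + β/2, βB). The shift by β/2 in the character
thus cancels everything except the term depending on the lattice vector alone. -/
theorem trace_qmat_add (u β α : Fin 2 → ℝ ⊗[ℤ] L) (B : Matrix (Fin 2) (Fin 2) ℤ)
    (hB : Bᵀ = B) :
    (ofR (qmat q (u + β)) * toC B).trace +
        -(trForm q (u + (1 / 2 : ℝ) • β) (α + rmul β Bᵀ) : ℝ) =
      (ofR (qmat q u) * toC B).trace + -(trForm q (u + (1 / 2 : ℝ) • β) α : ℝ) := by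
  have h10 : B 1 0 = B 0 1 := congrFun (congrFun hB 0) 1
  have hs : (toC B)ᵀ = toC B := by rw [← toC_transpose, hB]
  rw [trace_qmat_mul _ _ hs, trace_qmat_mul _ _ hs, trForm_add_right, trForm_rmul_right]
  have f2 := form_symm q (u 1) (u 0)
  have f3 := form_symm q (β 1) (u 0)
  have f4 := form_symm q (β 0) (u 1)
  have f5 := form_symm q (β 0) (u 0)
  have f6 := form_symm q (β 1) (u 1)
  have f1 := form_symm q (β 1) (β 0)
  simp only [Fin.sum_univ_two, Pi.add_apply, Pi.smul_apply, map_add, map_smul, LinearMap.add_apply,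
    LinearMap.smul_apply, smul_eq_mul, toC, Matrix.map_apply, h10, f1, f2, f3, f4, f5, f6]
  push_cast
  ring

theorem thetaTerm_mkT (P : MvPolynomial ((Fin b ⊕ Fin 2) × Fin 2) ℂ)
    (he : IsSignatureBasis q e) {g : (ℝ ⊗[ℤ] L) ≃ₗ[ℝ] (ℝ ⊗[ℤ] L)} (hg : g ∈ SOV q)
    (B : Matrix (Fin 2) (Fin 2) ℤ) (hB : Bᵀ = B) (τ : HH2)
    (α β : Fin 2 → ℝ ⊗[ℤ] L) (v : Fin 2 → dual q) :
    thetaTerm q e P (act (mkT B hB).mat τ) (α + rmul β Bᵀ) β g (fun j => (v j : ℝ ⊗[ℤ] L)) =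
      discQ q (cls q v) B * thetaTerm q e P τ α β g fun j => (v j : ℝ ⊗[ℤ] L) := by
  rw [discQ_cls _ _ _ hB, thetaTerm_eq he hg, thetaTerm_eq he hg, coordTerm, coordTerm,
    imPart_act_mkT, gaussProd_sgnPt_mkT he hg]
  have hexp := congrArg expi (trace_qmat_add (q := q) (fun j => (v j : ℝ ⊗[ℤ] L)) β α B hB)
  rw [expi_add, expi_add] at hexp
  linear_combination (evalR (coord e g ((fun j => (v j : ℝ ⊗[ℤ] L)) + β))
    (expLap (imPart τ.1) P) *
      gaussProd (sgnPt b τ) (coord e g ((fun j => (v j : ℝ ⊗[ℤ] L)) + β))) * hexp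

end Translation

/-! ### Right multiplication of pairs by integral matrices -/

section RightMul

variable {W : Type*} [AddCommGroup W]

theorem rmul_one (x : Fin 2 → W) : rmul x 1 = x := by
  funext j
  fin_cases j <;> simp [rmul, Matrix.one_apply]

theorem rmul_zero (x : Fin 2 → W) : rmul x 0 = 0 := by
  funext j
  simp [rmul]

theorem rmul_neg (x : Fin 2 → W) (M : Matrix (Fin 2) (Fin 2) ℤ) : rmul x (-M) = -rmul x M := by
  funext j
  simp [rmul]

theorem rmul_add (x : Fin 2 → W) (M N : Matrix (Fin 2) (Fin 2) ℤ) :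
    rmul x (M + N) = rmul x M + rmul x N := by
  funext j
  simp only [rmul, Matrix.add_apply, add_smul, Finset.sum_add_distrib, Pi.add_apply]

theorem add_rmul (x y : Fin 2 → W) (M : Matrix (Fin 2) (Fin 2) ℤ) :
    rmul (x + y) M = rmul x M + rmul y M := by
  funext j
  simp only [rmul, Pi.add_apply, smul_add, Finset.sum_add_distrib]

theorem rmul_mul (x : Fin 2 → W) (M N : Matrix (Fin 2) (Fin 2) ℤ) :
    rmul (rmul x M) N = rmul x (M * N) := by
  funext j
  simp only [rmul, Fin.sum_univ_two, Matrix.mul_apply, add_smul, smul_add, mul_smul]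
  simp only [smul_comm (N _ _)]
  abel

theorem GL_mul_inv (A : GL (Fin 2) ℤ) : A.1 * (A⁻¹).1 = 1 := by
  rw [← Units.val_mul, mul_inv_cancel, Units.val_one]

theorem GL_inv_mul (A : GL (Fin 2) ℤ) : (A⁻¹).1 * A.1 = 1 := by
  rw [← Units.val_mul, inv_mul_cancel, Units.val_one]

theorem GL_det_sq (A : GL (Fin 2) ℤ) : A.1.det * A.1.det = 1 := by
  have hdet : IsUnit A.1.det := by
    rw [← Matrix.isUnit_iff_isUnit_det]; exact A.isUnit
  rcases Int.isUnit_iff.1 hdet with h | h <;> simp [h]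

/-- Right multiplication by an element of `GL₂(ℤ)`. -/
def rmulEquiv (A : GL (Fin 2) ℤ) : (Fin 2 → W) ≃ (Fin 2 → W) where
  toFun x := rmul x A.1
  invFun x := rmul x (A⁻¹).1
  left_inv x := by simp only [rmul_mul, GL_mul_inv, rmul_one]
  right_inv x := by simp only [rmul_mul, GL_inv_mul, rmul_one]

end RightMul

/-! ### The action of GL₂(ℤ) -/

section Diagonal

variable {L : Type*} [AddCommGroup L] {q : QuadraticForm ℤ L} {b : ℕ}
  {e : Module.Basis (Fin b ⊕ Fin 2) ℝ (ℝ ⊗[ℤ] L)}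

theorem cls_rmul (v : Fin 2 → dual q) (A : Matrix (Fin 2) (Fin 2) ℤ) :
    cls q (rmul v A) = rmul (cls q v) A := by
  funext j
  simp only [cls, rmul, Fin.sum_univ_two, Submodule.Quotient.mk_add, Submodule.Quotient.mk_smul]

theorem coe_rmul (v : Fin 2 → dual q) (A : Matrix (Fin 2) (Fin 2) ℤ) :
    (fun j => ((rmul v A j : dual q) : ℝ ⊗[ℤ] L)) = rmul (fun j => (v j : ℝ ⊗[ℤ] L)) A := by
  funext j
  simp [rmul]

theorem coord_rmul (g : (ℝ ⊗[ℤ] L) ≃ₗ[ℝ] (ℝ ⊗[ℤ] L)) (v : Fin 2 → ℝ ⊗[ℤ] L)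
    (A : Matrix (Fin 2) (Fin 2) ℤ) (i : Fin b ⊕ Fin 2) (j : Fin 2) :
    coord e g (rmul v A) (i, j) = ∑ k, coord e g v (i, k) * A k j := by
  simp only [coord, rmul, map_zsmul, Fin.sum_univ_two, Finsupp.add_apply, map_add,
    Finsupp.smul_apply, zsmul_eq_mul]
  ring

theorem act_mkDiag (A : GL (Fin 2) ℤ) (τ : HH2) :
    (act (mkDiag A).mat τ).1 = toC A.1 * τ.1 * (toC A.1)ᵀ := by
  obtain ⟨h1, h2, h3, h4⟩ := blk_of_eq (mkDiag A).mat (A := A.1) (B := 0) (C := 0)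
    (D := (A⁻¹).1ᵀ) rfl
  have hinv : (toC (A⁻¹).1ᵀ)⁻¹ = (toC A.1)ᵀ := by
    apply Matrix.inv_eq_left_inv
    rw [toC_transpose, ← Matrix.transpose_mul, ← toC_mul, GL_inv_mul, toC_one, Matrix.transpose_one]
  rw [act_val, num, den, h1, h2, h3, h4, toC_zero, Matrix.zero_mul, add_zero, zero_add, hinv]

theorem det_imPart_act_mkDiag (A : GL (Fin 2) ℤ) (τ : HH2) :
    (imPart (act (mkDiag A).mat τ).1).det = (imPart τ.1).det := by
  have hy : imPart (act (mkDiag A).mat τ).1 = A.1.map (Int.cast : ℤ → ℝ) * imPart τ.1 *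
      (A.1.map (Int.cast : ℤ → ℝ))ᵀ := by
    rw [act_mkDiag]
    ext i j
    simp [imPart, Matrix.mul_apply, toC, Fin.sum_univ_two]
  have hdet : (A.1.map (Int.cast : ℤ → ℝ)).det = (A.1.det : ℝ) := by
    have := (Int.castRingHom ℝ).map_det A.1
    rw [RingHom.mapMatrix_apply] at this
    exact this.symm
  rw [hy, Matrix.det_mul, Matrix.det_mul, Matrix.det_transpose, hdet, mul_right_comm]
  have := GL_det_sq A
  rw [← Int.cast_mul, this, Int.cast_one, one_mul]

theorem trForm_rmul_left (u v : Fin 2 → ℝ ⊗[ℤ] L) (B : Matrix (Fin 2) (Fin 2) ℤ) :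
    trForm q (rmul u B) v = trForm q u (rmul v Bᵀ) := by
  rw [trForm_comm, ← Matrix.transpose_transpose B, trForm_rmul_right, Matrix.transpose_transpose,
    trForm_rmul_right, Finset.sum_comm]
  exact Finset.sum_congr rfl fun j _ => Finset.sum_congr rfl fun k _ => by
    rw [form_symm, Matrix.transpose_apply]

/-- Here `coordTerm_mul_GL` is used from the transformed point back to τ; since (det A)² = 1, the
same power of the determinant appears on either side. -/
theorem thetaTerm_mkDiag {P : MvPolynomial ((Fin b ⊕ Fin 2) × Fin 2) ℂ} {mpos mneg : ℕ}
    (hP : IsVeryHomogeneous P mpos mneg)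
    (he : IsSignatureBasis q e) {g : (ℝ ⊗[ℤ] L) ≃ₗ[ℝ] (ℝ ⊗[ℤ] L)} (hg : g ∈ SOV q)
    (A : GL (Fin 2) ℤ) (τ : HH2) (α β v : Fin 2 → ℝ ⊗[ℤ] L) :
    thetaTerm q e P (act (mkDiag A).mat τ) (rmul α A.1ᵀ) (rmul β (A⁻¹).1) g v =
      (A.1.det : ℂ) ^ (mpos + mneg) * thetaTerm q e P τ α β g (rmul v A.1) := by
  rw [thetaTerm_eq he hg, thetaTerm_eq he hg, ← trForm_rmul_left]
  have h1 : ∀ c : ℝ, rmul (v + c • rmul β (A⁻¹).1) A.1 = rmul v A.1 + c • β := by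
    intro c
    rw [add_rmul]
    congr 1
    have : c • rmul β (A⁻¹).1 = rmul (c • β) (A⁻¹).1 := by
      funext j
      simp only [rmul, Pi.smul_apply, Finset.smul_sum]
      exact Finset.sum_congr rfl fun i _ => smul_comm _ _ _
    rw [this, rmul_mul, GL_inv_mul, rmul_one]
  rw [h1, ← mul_assoc]
  congr 1
  have h2 := coordTerm_mul_GL hP A τ _ (act_mkDiag A τ) (coord e g (v + rmul β (A⁻¹).1))
    (coord e g (rmul v A.1 + β)) (fun i j => by
      rw [← coord_rmul, ← one_smul ℝ (rmul β _), h1, one_smul])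
  rw [h2, ← mul_assoc, ← mul_pow, ← Int.cast_mul, GL_det_sq, Int.cast_one, one_pow, one_mul]

theorem thetaSeries_mkDiag {P : MvPolynomial ((Fin b ⊕ Fin 2) × Fin 2) ℂ} {mpos mneg : ℕ}
    (hP : IsVeryHomogeneous P mpos mneg)
    (he : IsSignatureBasis q e) {g : (ℝ ⊗[ℤ] L) ≃ₗ[ℝ] (ℝ ⊗[ℤ] L)} (hg : g ∈ SOV q)
    (A : GL (Fin 2) ℤ) (τ : HH2) (α β : Fin 2 → ℝ ⊗[ℤ] L) (γ : Fin 2 → Disc q) :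
    thetaSeries q e P (act (mkDiag A).mat τ) (rmul α A.1ᵀ) (rmul β (A⁻¹).1) g γ =
      (A.1.det : ℂ) ^ (mpos + mneg) * thetaSeries q e P τ α β g (rmul γ A.1) := by
  rw [thetaSeries, thetaSeries, ← tsum_mul_left]
  have hcls : ∀ v : Fin 2 → dual q, cls q v = γ ↔ cls q (rmulEquiv A v) = rmul γ A.1 := by
    intro v
    change _ ↔ cls q (rmul v A.1) = _
    rw [cls_rmul]
    exact ((rmulEquiv A).injective.eq_iff (a := cls q v) (b := γ)).symm
  rw [← ((rmulEquiv A).subtypeEquiv (p := fun v => cls q v = γ)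
    (q := fun v => cls q v = rmul γ A.1) hcls).tsum_eq]
  refine tsum_congr fun v => ?_
  rw [thetaTerm_mkDiag hP he hg, ← coe_rmul]
  rfl

theorem thetaSeries_mkT (P : MvPolynomial ((Fin b ⊕ Fin 2) × Fin 2) ℂ)
    (he : IsSignatureBasis q e) {g : (ℝ ⊗[ℤ] L) ≃ₗ[ℝ] (ℝ ⊗[ℤ] L)} (hg : g ∈ SOV q)
    (B : Matrix (Fin 2) (Fin 2) ℤ) (hB : Bᵀ = B) (τ : HH2) (α β : Fin 2 → ℝ ⊗[ℤ] L)
    (γ : Fin 2 → Disc q) :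
    thetaSeries q e P (act (mkT B hB).mat τ) (α + rmul β Bᵀ) β g γ =
      discQ q γ B * thetaSeries q e P τ α β g γ := by
  rw [thetaSeries, thetaSeries, ← tsum_mul_left]
  refine tsum_congr fun v => ?_
  rw [thetaTerm_mkT P he hg, v.2]

/-- Both half-integral powers are principal values with the same base, so the exponents add up to
the integer m⁺ - m⁻, which may be replaced by m⁺ + m⁻ because det A = ±1. -/
theorem GL_root_zpow (A : GL (Fin 2) ℤ) (τ : HH2) (b mpos mneg : ℕ) :
    (mkDiag A).root τ ^ ((b : ℤ) - 2 + 2 * (mpos : ℤ) - 2 * (mneg : ℤ)) *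
      ((A.1.det : ℤ) : ℂ) ^ (((2 : ℕ) - (b : ℂ)) / 2) = (A.1.det : ℂ) ^ (mpos + mneg) := by
  have hne : ((A.1.det : ℤ) : ℂ) ≠ 0 := by
    intro h
    have := GL_det_sq A
    rw [Int.cast_eq_zero.1 h] at this
    simp at this
  have hsq : ((A.1.det : ℤ) : ℂ) * ((A.1.det : ℤ) : ℂ) = 1 := by
    rw [← Int.cast_mul, GL_det_sq, Int.cast_one]
  change (((A.1.det : ℤ) : ℂ) ^ (1 / 2 : ℂ)) ^ _ * _ = _
  rw [← Complex.cpow_mul_int, ← Complex.cpow_add _ _ hne]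
  have h : (1 / 2 : ℂ) * (((b : ℤ) - 2 + 2 * (mpos : ℤ) - 2 * (mneg : ℤ) : ℤ) : ℂ) +
      ((2 : ℕ) - (b : ℂ)) / 2 = ((mpos : ℤ) - (mneg : ℤ) : ℤ) := by
    push_cast
    ring
  rw [h, Complex.cpow_intCast, zpow_sub₀ hne, zpow_natCast, zpow_natCast, div_eq_iff (pow_ne_zero _ hne),
    pow_add, mul_assoc, ← mul_pow, hsq, one_pow, mul_one]

end Diagonal

/-! ### Covolume of the dual lattice -/

section Inversion

open MeasureTheory

variable {L : Type*} [AddCommGroup L] {q : QuadraticForm ℤ L} {b : ℕ}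
  {e : Module.Basis (Fin b ⊕ Fin 2) ℝ (ℝ ⊗[ℤ] L)}

/-- Both vectors of the pair undergo the same change of basis; the matrix is a Kronecker product
with the 2 × 2 identity, hence the square. -/
theorem det_coordMap [DecidableEq (Fin b ⊕ Fin 2)] (g : (ℝ ⊗[ℤ] L) ≃ₗ[ℝ] (ℝ ⊗[ℤ] L))
    (c : Module.Basis (Fin b ⊕ Fin 2) ℝ (ℝ ⊗[ℤ] L)) :
    LinearMap.det (coordMap e g c) = (e.map g.symm).det c ^ 2 := by
  classical
  have h : coordMap e g c =
      Matrix.toLin' (Matrix.kroneckerMap (· * ·) ((e.map g.symm).toMatrix c) (1 : Matrix (Fin 2) (Fin 2) ℝ)) := by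
    apply LinearMap.ext
    intro t
    funext p
    rw [coordMap_apply, Matrix.toLin'_apply]
    simp only [coord, pairVec, map_sum, map_smul, Finsupp.coe_finsetSum, Finset.sum_apply,
      Finsupp.smul_apply, smul_eq_mul, Matrix.mulVec, dotProduct, Fintype.sum_prod_type,
      Matrix.kroneckerMap_apply, Matrix.one_apply, Module.Basis.toMatrix_apply, mul_ite, mul_one,
      mul_zero, ite_mul, zero_mul, Finset.sum_ite_eq, Finset.mem_univ, if_true]
    refine Finset.sum_congr rfl fun k _ => ?_
    rw [mul_comm]
    rfl
  rw [h, LinearMap.det_toLin', Matrix.det_kronecker, Matrix.det_one, one_pow,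
    mul_one, Fintype.card_fin, Module.Basis.det_apply]

/-- The square of the covolume of the dual lattice is the inverse of the order of the discriminant
group. -/
theorem abs_det_coordMap_inv (he : IsSignatureBasis q e) {g : (ℝ ⊗[ℤ] L) ≃ₗ[ℝ] (ℝ ⊗[ℤ] L)}
    (hg : g ∈ SOV q) (cV dV : Module.Basis (Fin b ⊕ Fin 2) ℝ (ℝ ⊗[ℤ] L))
    (bL : Module.Basis (Fin b ⊕ Fin 2) ℤ (lat L)) (bD : Module.Basis (Fin b ⊕ Fin 2) ℤ (dual q))
    (hL : ∀ k, (bL k : ℝ ⊗[ℤ] L) = cV k) (hD : ∀ k, (bD k : ℝ ⊗[ℤ] L) = dV k)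
    (hdual : ∀ k l, form q (dV k) (cV l) = if k = l then 1 else 0) :
    LinearMap.det (coordMap e g dV) ≠ 0 ∧
      |(LinearMap.det (coordMap e g dV))⁻¹| = Nat.card (Disc q) := by
  classical
  have : Module.Free ℤ (dual q) := Module.Free.of_basis bD
  have : Module.Finite ℤ (dual q) := Module.Finite.of_basis bD
  have hcard := Submodule.natAbs_det_basis_change bD ((lat L).submoduleOf (dual q))
    (bL.map (Submodule.submoduleOfEquivOfLe (lat_le_dual q)).symm)
  have hrepr : ∀ (v : dual q) i, dV.repr (v : ℝ ⊗[ℤ] L) i = (bD.repr v i : ℤ) := by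
    intro v i
    have h1 : (v : ℝ ⊗[ℤ] L) = ∑ k, (bD.repr v k : ℝ) • dV k := by
      refine (congrArg Subtype.val (bD.sum_repr v).symm).trans ?_
      rw [Submodule.coe_sum]
      exact Finset.sum_congr rfl fun k _ => by
        rw [Submodule.coe_smul, hD, Int.cast_smul_eq_zsmul]
    rw [h1]
    exact congrFun (dV.repr_sum_self fun k => (bD.repr v k : ℝ)) i
  have hG : dV.det cV = ((bD.det ((↑) ∘ bL.map
      (Submodule.submoduleOfEquivOfLe (lat_le_dual q)).symm) : ℤ) : ℝ) := by
    rw [Module.Basis.det_apply, Module.Basis.det_apply]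
    have := (Int.castRingHom ℝ).map_det (bD.toMatrix ((↑) ∘ bL.map
      (Submodule.submoduleOfEquivOfLe (lat_le_dual q)).symm))
    refine Eq.trans ?_ this.symm
    congr 1
    ext i j
    rw [RingHom.mapMatrix_apply, Matrix.map_apply, Module.Basis.toMatrix_apply,
      Module.Basis.toMatrix_apply]
    refine Eq.trans ?_ (hrepr _ i)
    rw [← hL]
    rfl
  have hcard' : (Nat.card (Disc q) : ℝ) = |dV.det cV| := by
    rw [hG, ← hcard, Nat.cast_natAbs, Int.cast_abs]
  set e' := e.map g.symm with he'
  have hmul : e'.det cV = e'.det dV * dV.det cV := by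
    rw [Module.Basis.det_apply, Module.Basis.det_apply, Module.Basis.det_apply, ← Matrix.det_mul,
      Module.Basis.toMatrix_mul_toMatrix]
  -- Duality of the two bases, written in orthogonal coordinates. The sign matrix has determinant
  -- (-1)² = 1, so taking determinants gives (det_{e'} d)² · det_d c = 1, while |det_d c| is the
  -- index of L in L'.
  have hone : (e'.toMatrix dV)ᵀ * Matrix.diagonal (sgn b) * e'.toMatrix cV = 1 := by
    ext k l
    rw [Matrix.mul_assoc, Matrix.mul_apply, Matrix.one_apply, ← hdual k l, form_eq_coord he hg]
    refine Finset.sum_congr rfl fun i _ => ?_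
    rw [Matrix.diagonal_mul, Matrix.transpose_apply, Module.Basis.toMatrix_apply,
      Module.Basis.toMatrix_apply, ← mul_assoc, mul_comm (sgn b i)]
    rfl
  have hdet := congrArg Matrix.det hone
  rw [Matrix.det_mul, Matrix.det_mul, Matrix.det_transpose, Matrix.det_diagonal, Matrix.det_one,
    ← Module.Basis.det_apply, ← Module.Basis.det_apply, hmul] at hdet
  have hsgn : ∏ i, sgn b i = 1 := by simp [sgn, Fintype.prod_sum_type]
  rw [hsgn, mul_one, ← mul_assoc, ← pow_two] at hdet
  rw [det_coordMap]
  refine ⟨left_ne_zero_of_mul_eq_one hdet, ?_⟩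
  rw [hcard', eq_inv_of_mul_eq_one_right hdet]

theorem integral_coordMap (g : (ℝ ⊗[ℤ] L) ≃ₗ[ℝ] (ℝ ⊗[ℤ] L))
    (c : Module.Basis (Fin b ⊕ Fin 2) ℝ (ℝ ⊗[ℤ] L)) (h : LinearMap.det (coordMap e g c) ≠ 0)
    (F : ((Fin b ⊕ Fin 2) × Fin 2 → ℝ) → ℂ) (a : (Fin b ⊕ Fin 2) × Fin 2 → ℝ) :
    ∫ t, F (coordMap e g c t + a) = (|(LinearMap.det (coordMap e g c))⁻¹| : ℝ) * ∫ x, F x := by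
  have hemb : MeasurableEmbedding (coordMap e g c) := by
    have := ((LinearEquiv.ofInjectiveEndo _ (coordMap_injective (e := e) g
      c)).toContinuousLinearEquiv).toHomeomorph.measurableEmbedding
    exact this
  have h1 := hemb.integral_map (μ := volume) fun x => F (x + a)
  rw [← h1, Real.map_linearMap_volume_pi_eq_smul_volume_pi h, integral_smul_measure,
    ENNReal.toReal_ofReal (abs_nonneg _), integral_add_right_eq_self]
  simp

end Inversion

/-! ### Poisson summation over the dual lattice -/

section InversionSeries

open MeasureTheory

variable {L : Type*} [AddCommGroup L] {q : QuadraticForm ℤ L} {b : ℕ}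
  {e : Module.Basis (Fin b ⊕ Fin 2) ℝ (ℝ ⊗[ℤ] L)}

theorem cls_surjective : Function.Surjective (cls q) := fun γ =>
  ⟨fun j => (Submodule.Quotient.mk_surjective _ (γ j)).choose, funext fun j =>
    (Submodule.Quotient.mk_surjective _ (γ j)).choose_spec⟩

theorem discPair_cls_eq (v w : Fin 2 → dual q) :
    discPair q (cls q v) (cls q w) = expi (((-trForm q (fun j => (v j : ℝ ⊗[ℤ] L))
      (fun j => (w j : ℝ ⊗[ℤ] L)) : ℝ)) : ℂ) := by
  rw [discPair_cls, trace_gram, Complex.ofReal_neg]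

theorem norm_discPair (γ δ : Fin 2 → Disc q) : ‖discPair q γ δ‖ = 1 := by
  rw [discPair, trace_gram, ← Complex.ofReal_neg, norm_expi_ofReal]

/-- The pairs of vectors of the dual lattice in a given class. -/
def cosetEquiv (w : Fin 2 → dual q) :
    (Fin 2 → (lat L).submoduleOf (dual q)) ≃ {v : Fin 2 → dual q // cls q v = cls q w} where
  toFun l := ⟨fun j => w j + l j, funext fun j => (Submodule.Quotient.eq _).2 (by simp)⟩
  invFun v := fun j => ⟨v.1 j - w j, (Submodule.Quotient.eq _).1 (congrFun v.2 j)⟩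
  left_inv l := by
    funext j
    simp
  right_inv v := by
    apply Subtype.ext
    funext j
    simp

theorem tsum_eq_sum_fiber [Fintype (Disc q)] {f : (Fin 2 → dual q) → ℂ} (hf : Summable f) :
    ∑' v, f v = ∑ γ : Fin 2 → Disc q, ∑' v : {v : Fin 2 → dual q // cls q v = γ}, f v.1 := by
  rw [← (Equiv.sigmaFiberEquiv (cls q)).tsum_eq, ← tsum_fintype (L := .unconditional _)]
  exact ((Equiv.sigmaFiberEquiv (cls q)).summable_iff.2 hf).tsum_sigma

/-- With dual bases, the trace form becomes the standard pairing of ℤⁿ that occurs in Poisson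
summation. -/
theorem trForm_pairVec_dual {cV dV : Module.Basis (Fin b ⊕ Fin 2) ℝ (ℝ ⊗[ℤ] L)}
    (hdual : ∀ k l, form q (dV k) (cV l) = if k = l then 1 else 0)
    (s t : (Fin b ⊕ Fin 2) × Fin 2 → ℝ) :
    trForm q (pairVec dV s) (pairVec cV t) = ∑ p, s p * t p := by
  rw [Fintype.sum_prod_type, Finset.sum_comm]
  refine Finset.sum_congr rfl fun j _ => ?_
  simp only [pairVec, map_sum, map_smul, LinearMap.sum_apply, LinearMap.smul_apply, smul_eq_mul,
    hdual, mul_ite, mul_one, mul_zero, Finset.sum_ite_eq', Finset.mem_univ, if_true]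
  exact Finset.sum_congr rfl fun k _ => mul_comm _ _

/-- The factor in the Fourier transform of the summand of the theta series. -/
def fourierFactor (b mpos mneg : ℕ) (τ : HH2) : ℂ :=
  (Complex.I / sqrtDet τ) ^ b * -((starRingEnd ℂ) τ.1.det)⁻¹ *
    ((τ.1.det)⁻¹ ^ mpos * ((starRingEnd ℂ) τ.1.det)⁻¹ ^ mneg)

/-- The transformation of the theta series under inversion, by Poisson summation. -/
theorem sum_discPair_thetaSeries [Module.Free ℤ L] [Module.Finite ℤ L] [Fintype (Disc q)]
    {P : MvPolynomial ((Fin b ⊕ Fin 2) × Fin 2) ℂ} {mpos mneg : ℕ}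
    (hP : IsVeryHomogeneous P mpos mneg) (he : IsSignatureBasis q e)
    {g : (ℝ ⊗[ℤ] L) ≃ₗ[ℝ] (ℝ ⊗[ℤ] L)} (hg : g ∈ SOV q) (τ : HH2) (α β : Fin 2 → ℝ ⊗[ℤ] L)
    (δ : Fin 2 → Disc q) :
    ∑ γ, discPair q δ γ * thetaSeries q e P τ α β g γ =
      (Nat.card (Disc q) * fourierFactor b mpos mneg τ) *
        thetaSeries q e P (invPt τ) (-β) α g δ := by
  obtain ⟨cV, dV, bL, bD, hL, hD, hdual⟩ := exists_dual_bases he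
  obtain ⟨hdet, hcard⟩ := abs_det_coordMap_inv he hg cV dV bL bD hL hD hdual
  obtain ⟨w, rfl⟩ := cls_surjective δ
  set w' : Fin 2 → ℝ ⊗[ℤ] L := fun j => (w j : ℝ ⊗[ℤ] L) with hw'
  -- The first part is the character of the theta series. The second is the discriminant pairing
  -- with a representative w of δ, extended from lattice points to real points.
  set φ : ((Fin b ⊕ Fin 2) × Fin 2 → ℝ) → ℝ := fun t =>
    -trForm q (pairVec dV t + (1 / 2 : ℝ) • β) α - trForm q (pairVec dV t) w' with hφ
  have hφc : Continuous φ := by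
    simp only [hφ, trForm_add_left]
    exact ((trForm_pairVec_continuous dV α).add continuous_const).neg.sub
      (trForm_pairVec_continuous dV w')
  have hf := rapidDecay_coordTerm_comp (e := e) g dV P τ β hφc
  have hval : ∀ n, expi (φ (intVec n) : ℝ) * coordTerm P τ (coord e g (pairVec dV (intVec n) + β)) =
      discPair q (cls q w) (cls q (pairEquiv bD n)) *
        thetaTerm q e P τ α β g fun j => (pairEquiv bD n j : ℝ ⊗[ℤ] L) := by
    intro n
    rw [discPair_cls_eq, thetaTerm_eq he hg, coe_pairEquiv bD dV hD, mul_left_comm, ← expi_add,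
      mul_comm]
    congr 2
    rw [← Complex.ofReal_neg, ← Complex.ofReal_add, trForm_comm (fun j => (w j : ℝ ⊗[ℤ] L))]
    congr 1
    rw [hφ]
    ring
  let bN := bL.map (Submodule.submoduleOfEquivOfLe (lat_le_dual q)).symm
  -- The frequencies n are the coordinates of vectors of L², dual to (L')²; the extra phase shifts
  -- them to the coset w + L².
  let E := (pairEquiv bN).trans (cosetEquiv w)
  have hE : ∀ n, (fun j => ((E n).1 j : ℝ ⊗[ℤ] L)) = w' + pairVec cV (intVec n) := by
    intro n
    have h1 : (fun j => (pairEquiv bL n j : ℝ ⊗[ℤ] L)) = pairVec cV (intVec n) :=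
      coe_pairEquiv bL cV hL n
    funext j
    rw [← h1]
    change ((w j + ((∑ k, n (k, j) • bN k : (lat L).submoduleOf (dual q)) : dual q) : dual q) :
      ℝ ⊗[ℤ] L) = w j + ((∑ k, n (k, j) • bL k : lat L) : ℝ ⊗[ℤ] L)
    rw [Submodule.coe_add, Submodule.coe_sum, Submodule.coe_sum, Submodule.coe_sum]
    rfl
  have hint : ∀ n : (Fin b ⊕ Fin 2) × Fin 2 → ℤ,
      ∫ t, expi (-∑ i, (n i : ℂ) * t i) *
        (expi (φ t : ℝ) * coordTerm P τ (coord e g (pairVec dV t + β))) =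
      (Nat.card (Disc q) * fourierFactor b mpos mneg τ) *
        thetaTerm q e P (invPt τ) (-β) α g fun j => ((E n).1 j : ℝ ⊗[ℤ] L) := by
    intro n
    rw [hE]
    set u := w' + pairVec cV (intVec n) with hu
    -- The sign converts the Euclidean pairing of the Fourier transform into the form on V. The
    -- shift by α is the translation part of the new series, and the leftover phase e(tr(u + α/2,
    -- β)) is its character, so (α, β) becomes (-β, α).
    set ξ : (Fin b ⊕ Fin 2) × Fin 2 → ℝ := fun p => sgn b p.1 * coord e g (u + α) p with hξ
    have hphase : ∀ t, expi (-∑ i, (n i : ℂ) * t i) *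
        (expi (φ t : ℝ) * coordTerm P τ (coord e g (pairVec dV t + β))) =
        expi ((trForm q (u + (1 / 2 : ℝ) • α) β : ℝ)) *
          (fun x => coordTerm P τ x * expi (-∑ p, (x p : ℂ) * (ξ p : ℝ)))
            (coordMap e g dV t + coord e g β) := by
      intro t
      have h1 : -∑ i, (n i : ℂ) * t i =
          ((-trForm q (pairVec dV t) (pairVec cV (intVec n)) : ℝ) : ℂ) := by
        rw [trForm_pairVec_dual hdual]
        push_cast
        congr 1
        exact Finset.sum_congr rfl fun i _ => by simp [intVec, mul_comm]
      have h2 : -∑ p, (coord e g (pairVec dV t + β) p : ℂ) * (ξ p : ℝ) =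
          ((-trForm q (pairVec dV t + β) (u + α) : ℝ) : ℂ) := by
        rw [trForm_eq_coord he hg]
        simp only [hξ]
        push_cast
        rfl
      rw [coordMap_apply, ← coord_add]
      simp only [h1, h2]
      rw [← mul_assoc, ← expi_add, mul_left_comm, ← expi_add, mul_comm]
      congr 2
      rw [← Complex.ofReal_add, ← Complex.ofReal_add]
      congr 1
      rw [hφ, hu]
      simp only [trForm_add_left, trForm_add_right, trForm_smul_left]
      rw [trForm_comm w' β, trForm_comm (pairVec cV (intVec n)) β, trForm_comm α β]
      ring
    simp only [hphase]
    rw [integral_const_mul, integral_coordMap g dV hdet (fun x => coordTerm P τ x *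
      expi (-∑ p, (x p : ℂ) * (ξ p : ℝ))), hcard, fourier_coordTerm hP, hξ, coordTerm_sgn hP,
      thetaTerm_eq he hg, trForm_neg_right, fourierFactor]
    push_cast
    rw [neg_neg]
    ring
  have hsum := summable_thetaTerm he hg P τ α β
  have hsum' := summable_thetaTerm he hg P (invPt τ) (-β) α
  -- The summability that Poisson requires of the Fourier coefficients is the convergence of the
  -- theta series at -τ⁻¹.
  have hpoisson := hf.poisson (by
    simp only [hint]
    exact (hsum'.comp_injective (Subtype.val_injective.comp E.injective)).mul_left _)
  simp only [hval, hint] at hpoisson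
  have hsum2 : Summable fun v : Fin 2 → dual q => discPair q (cls q w) (cls q v) *
      thetaTerm q e P τ α β g fun j => (v j : ℝ ⊗[ℤ] L) := by
    refine Summable.of_norm_bounded hsum.norm fun v => ?_
    rw [norm_mul, norm_discPair, one_mul]
  rw [tsum_mul_left, E.tsum_eq fun v => thetaTerm q e P (invPt τ) (-β) α g fun j =>
    (v.1 j : ℝ ⊗[ℤ] L), (pairEquiv bD).tsum_eq fun v => discPair q (cls q w) (cls q v) *
      thetaTerm q e P τ α β g fun j => (v j : ℝ ⊗[ℤ] L), tsum_eq_sum_fiber hsum2] at hpoisson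
  rw [thetaSeries, ← hpoisson]
  refine Finset.sum_congr rfl fun γ _ => ?_
  rw [thetaSeries, ← tsum_mul_left]
  exact tsum_congr fun v => by rw [v.2]

end InversionSeries

/-! ### Operators attached to the generators -/

section Operators

variable {L : Type*} [AddCommGroup L] {q : QuadraticForm ℤ L} {b : ℕ}
  {e : Module.Basis (Fin b ⊕ Fin 2) ℝ (ℝ ⊗[ℤ] L)}

/-- The linear map `R` describes the behaviour of all theta functions under `γ`. -/
def Transforms (q : QuadraticForm ℤ L) (e : Module.Basis (Fin b ⊕ Fin 2) ℝ (ℝ ⊗[ℤ] L)) (γ : Mp4Z)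
    (R : Module.End ℂ ((Fin 2 → Disc q) → ℂ)) : Prop :=
  ∀ (mpos mneg : ℕ) (P : MvPolynomial ((Fin b ⊕ Fin 2) × Fin 2) ℂ),
    IsVeryHomogeneous P mpos mneg → ∀ (α β : Fin 2 → ℝ ⊗[ℤ] L), ∀ g ∈ SOV q, ∀ τ : HH2,
      theta q e P mneg (act γ.mat τ) (rmul α (blkA γ.mat)ᵀ + rmul β (blkB γ.mat)ᵀ)
          (rmul α (blkC γ.mat)ᵀ + rmul β (blkD γ.mat)ᵀ) g =
        γ.root τ ^ ((b : ℤ) - 2 + 2 * (mpos : ℤ) - 2 * (mneg : ℤ)) •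
          R (theta q e P mneg τ α β g)

/-- The action of `mkDiag A`. -/
def opDiag (q : QuadraticForm ℤ L) (b : ℕ) (A : GL (Fin 2) ℤ) :
    Module.End ℂ ((Fin 2 → Disc q) → ℂ) :=
  ((A.1.det : ℤ) : ℂ) ^ ((((2 : ℕ) : ℂ) - (b : ℂ)) / 2) •
    LinearMap.funLeft ℂ ℂ fun δ => rmul δ A.1

/-- The action of `mkT B`. -/
def opT (q : QuadraticForm ℤ L) (B : Matrix (Fin 2) (Fin 2) ℤ) :
    Module.End ℂ ((Fin 2 → Disc q) → ℂ) :=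
  LinearMap.mulLeft ℂ fun δ => discQ q δ B

/-- The action of `mkS`. -/
def opS (q : QuadraticForm ℤ L) [Fintype (Disc q)] (b : ℕ) :
    Module.End ℂ ((Fin 2 → Disc q) → ℂ) :=
  (Complex.I ^ (((2 : ℕ) : ℤ) - (b : ℤ)) / (Nat.card (Disc q) : ℂ)) •
    (Matrix.of (discPair q)).mulVecLin

theorem transforms_mkDiag (he : IsSignatureBasis q e) (A : GL (Fin 2) ℤ) :
    Transforms q e (mkDiag A) (opDiag q b A) := by
  intro mpos mneg P hP α β g hg τ
  obtain ⟨h1, h2, h3, h4⟩ := blk_of_eq (mkDiag A).mat (A := A.1) (B := 0) (C := 0)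
    (D := (A⁻¹).1ᵀ) rfl
  funext δ
  rw [h1, h2, h3, h4, Matrix.transpose_zero, Matrix.transpose_transpose, rmul_zero, rmul_zero,
    add_zero, zero_add, theta_apply, thetaSeries_mkDiag hP he hg, det_imPart_act_mkDiag,
    ← GL_root_zpow A τ b mpos mneg, Pi.smul_apply, opDiag, LinearMap.smul_apply, Pi.smul_apply,
    LinearMap.funLeft_apply, theta_apply, smul_eq_mul, smul_eq_mul]
  ring

theorem transforms_mkT (he : IsSignatureBasis q e) (B : Matrix (Fin 2) (Fin 2) ℤ) (hB : Bᵀ = B) :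
    Transforms q e (mkT B hB) (opT q B) := by
  intro mpos mneg P hP α β g hg τ
  obtain ⟨h1, h2, h3, h4⟩ := blk_of_eq (mkT B hB).mat (A := 1) (B := B) (C := 0) (D := 1) rfl
  have hroot : (mkT B hB).root τ = 1 := rfl
  funext δ
  rw [h1, h2, h3, h4, Matrix.transpose_zero, Matrix.transpose_one, rmul_zero, rmul_one, rmul_one,
    zero_add, theta_apply, thetaSeries_mkT P he hg, imPart_act_mkT, hroot, one_zpow, one_smul, opT,
    LinearMap.mulLeft_apply, Pi.mul_apply, theta_apply]
  ring

/-- Follows by taking determinants in y' = (τᴴ)⁻¹ y τ⁻¹. -/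
theorem det_imPart_invPt (τ : HH2) : ((imPart (invPt τ).1).det : ℂ) =
    (imPart τ.1).det * (τ.1.det)⁻¹ * ((starRingEnd ℂ) τ.1.det)⁻¹ := by
  have hofR : ∀ X : Matrix (Fin 2) (Fin 2) ℝ, (X.det : ℂ) =
      (X.map (fun r : ℝ => (r : ℂ))).det := fun X => by simp [Matrix.det_fin_two]
  have hd : IsUnit τ.1.det := (det_ne_zero τ).isUnit
  have hdh : IsUnit (τ.1ᴴ).det := by rw [Matrix.det_conjTranspose]; exact hd.star
  have h1 : (2 * Complex.I) • imC (invPt τ).1 =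
      (τ.1ᴴ)⁻¹ * ((2 * Complex.I) • imC τ.1) * (τ.1)⁻¹ := by
    rw [two_I_imC _ (invPt τ).2.1, two_I_imC _ τ.2.1, invPt_val, Matrix.mul_sub, Matrix.sub_mul,
      Matrix.nonsing_inv_mul _ hdh, Matrix.mul_assoc, Matrix.mul_nonsing_inv _ hd,
      Matrix.conjTranspose_neg, Matrix.conjTranspose_nonsing_inv, Matrix.mul_one, Matrix.one_mul]
    abel
  have h2 := congrArg Matrix.det h1
  rw [Matrix.det_mul, Matrix.det_mul, Matrix.det_smul, Matrix.det_smul, Matrix.det_nonsing_inv,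
    Matrix.det_nonsing_inv, Matrix.det_conjTranspose, Ring.inverse_eq_inv'] at h2
  have h3 : (2 * Complex.I) ^ Fintype.card (Fin 2) ≠ 0 := by simp
  apply mul_left_cancel₀ h3
  rw [hofR, hofR]
  refine h2.trans ?_
  rw [imC, ← starRingEnd_apply]
  ring

/-- The weight is tuned to this identity: sᵇ cancels the b positive Gaussian factors, i²⁻ᵇ = -i⁻ᵇ
cancels iᵇ and the sign from the negative plane, and N cancels the covolume. The prefactor (det
y)^{1+m⁻} supplies the remaining powers of d and c. -/
theorem inversion_scalar {s d c y N : ℂ} (hs : s ^ 2 = d) (hs0 : s ≠ 0) (hc : c ≠ 0) (hN : N ≠ 0)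
    (b mpos mneg : ℕ) :
    (y * d⁻¹ * c⁻¹) ^ (1 + mneg) = s ^ ((b : ℤ) - 2 + 2 * (mpos : ℤ) - 2 * (mneg : ℤ)) *
      (Complex.I ^ (((2 : ℕ) : ℤ) - (b : ℤ)) / N * (y ^ (1 + mneg) *
        (N * ((Complex.I / s) ^ b * -c⁻¹ * (d⁻¹ ^ mpos * c⁻¹ ^ mneg))))) := by
  have h1 : s ^ ((b : ℤ) - 2 + 2 * (mpos : ℤ) - 2 * (mneg : ℤ)) =
      s ^ b * d⁻¹ * d ^ mpos * (d ^ mneg)⁻¹ := by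
    rw [zpow_sub₀ hs0, zpow_add₀ hs0, zpow_sub₀ hs0, zpow_mul, zpow_mul, zpow_natCast, zpow_natCast,
      zpow_natCast, div_eq_mul_inv, div_eq_mul_inv]
    have : s ^ (2 : ℤ) = d := by rw [← hs]; norm_cast
    rw [this]
  have h2 : Complex.I ^ (((2 : ℕ) : ℤ) - (b : ℤ)) = -(Complex.I ^ b)⁻¹ := by
    rw [zpow_sub₀ Complex.I_ne_zero, zpow_natCast, zpow_natCast, Complex.I_sq, neg_div, one_div]
  have hd0 : d ≠ 0 := hs ▸ pow_ne_zero 2 hs0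
  have hI : Complex.I ^ b ≠ 0 := pow_ne_zero _ Complex.I_ne_zero
  have hd : d ^ mpos ≠ 0 := pow_ne_zero _ hd0
  rw [h1, h2, div_pow, mul_pow, mul_pow, pow_add, pow_add, pow_add]
  simp only [inv_pow]
  field_simp

theorem transforms_mkS [Module.Free ℤ L] [Module.Finite ℤ L] [Fintype (Disc q)]
    (he : IsSignatureBasis q e) : Transforms q e mkS (opS q b) := by
  intro mpos mneg P hP α β g hg τ
  obtain ⟨h1, h2, h3, h4⟩ := blk_of_eq mkS.mat (A := 0) (B := -1) (C := 1) (D := 0) rfl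
  funext δ
  have hact : act mkS.mat τ = invPt τ := rfl
  have hroot : mkS.root τ = sqrtDet τ := rfl
  have hN : (Nat.card (Disc q) : ℂ) ≠ 0 := by
    rw [Nat.cast_ne_zero]
    exact Nat.card_pos.ne'
  have hc : (starRingEnd ℂ) τ.1.det ≠ 0 := by
    rw [Ne, map_eq_zero]
    exact det_ne_zero τ
  have hs0 : sqrtDet τ ≠ 0 := mkS.root_ne_zero τ
  have hscalar := inversion_scalar (y := ((imPart τ.1).det : ℂ)) (sqrtDet_sq τ) hs0 hc hN b mpos mneg
  rw [h1, h2, h3, h4, Matrix.transpose_zero, Matrix.transpose_neg, Matrix.transpose_one, rmul_zero,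
    rmul_zero, rmul_neg, rmul_one, rmul_one, zero_add, add_zero, hact, hroot, theta_apply,
    Complex.ofReal_pow, det_imPart_invPt, hscalar, Pi.smul_apply, opS, LinearMap.smul_apply,
    Pi.smul_apply, Matrix.mulVecLin_apply, Matrix.mulVec, dotProduct, smul_eq_mul, smul_eq_mul]
  have hsum := sum_discPair_thetaSeries hP he hg τ α β δ
  have hsum2 : ∑ γ, Matrix.of (discPair q) δ γ * theta q e P mneg τ α β g γ =
      ((imPart τ.1).det : ℂ) ^ (1 + mneg) *
        ∑ γ, discPair q δ γ * thetaSeries q e P τ α β g γ := by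
    rw [Finset.mul_sum]
    refine Finset.sum_congr rfl fun γ _ => ?_
    rw [theta_apply, Matrix.of_apply, Complex.ofReal_pow]
    ring
  rw [hsum2, hsum, fourierFactor]
  ring

theorem opDiag_basisVec (A : GL (Fin 2) ℤ) (γ : Fin 2 → Disc q) :
    opDiag q b A (basisVec q γ) =
      (((A.1.det : ℤ) : ℂ) ^ ((((2 : ℕ) : ℂ) - (b : ℂ)) / 2)) • basisVec q (rmul γ (A⁻¹).1) := by
  rw [opDiag, LinearMap.smul_apply]
  congr 1
  funext δ
  rw [LinearMap.funLeft_apply, basisVec, basisVec]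
  congr 1
  have h : δ = rmul γ (A⁻¹).1 ↔ rmul δ A.1 = γ := (rmulEquiv A).eq_symm_apply
  exact propext h.symm

theorem opT_basisVec (B : Matrix (Fin 2) (Fin 2) ℤ) (γ : Fin 2 → Disc q) :
    opT q B (basisVec q γ) = discQ q γ B • basisVec q γ := by
  funext δ
  rw [opT, LinearMap.mulLeft_apply, Pi.mul_apply, Pi.smul_apply, smul_eq_mul, basisVec]
  split_ifs with h
  · rw [h]
  · rw [mul_zero, mul_zero]

theorem opS_basisVec [Fintype (Disc q)] (γ : Fin 2 → Disc q) :
    opS q b (basisVec q γ) =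
      (Complex.I ^ (((2 : ℕ) : ℤ) - (b : ℤ)) / (Nat.card (Disc q) : ℂ)) •
        ∑ᶠ δ : Fin 2 → Disc q, discPair q δ γ • basisVec q δ := by
  rw [opS, LinearMap.smul_apply]
  congr 1
  funext δ
  rw [finsum_eq_sum_of_fintype, Finset.sum_apply, Matrix.mulVecLin_apply, Matrix.mulVec, dotProduct]
  simp [basisVec]

theorem End_ext_basisVec [Fintype (Disc q)] {R R' : Module.End ℂ ((Fin 2 → Disc q) → ℂ)}
    (h : ∀ γ, R (basisVec q γ) = R' (basisVec q γ)) : R = R' := by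
  classical
  refine (Pi.basisFun ℂ (Fin 2 → Disc q)).ext fun γ => ?_
  have : Pi.basisFun ℂ (Fin 2 → Disc q) γ = basisVec q γ := by
    funext δ
    rw [Pi.basisFun_apply, Pi.single_apply, basisVec]
  rw [this, h]

end Operators

/-! ### Theta functions span the group algebra -/

section Span

variable {L : Type*} [AddCommGroup L] {q : QuadraticForm ℤ L} {b : ℕ}
  {e : Module.Basis (Fin b ⊕ Fin 2) ℝ (ℝ ⊗[ℤ] L)}

theorem isVeryHomogeneous_one :
    IsVeryHomogeneous (1 : MvPolynomial ((Fin b ⊕ Fin 2) × Fin 2) ℂ) 0 0 :=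
  ⟨1, 1, by simp, by simp, by simp⟩

theorem coordTerm_one_iPt (x : (Fin b ⊕ Fin 2) × Fin 2 → ℝ) :
    coordTerm (1 : MvPolynomial ((Fin b ⊕ Fin 2) × Fin 2) ℂ) iPt x =
      ((Real.exp (-Real.pi * ∑ p, x p ^ 2) : ℝ) : ℂ) := by
  have h1 : ∀ i, (sgnPt b iPt i).1 = (Complex.I • 1 : Matrix (Fin 2) (Fin 2) ℂ) := by
    rintro (i | i)
    · rfl
    · change -(Complex.I • (1 : Matrix (Fin 2) (Fin 2) ℂ)).map (starRingEnd ℂ) = _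
      ext j k
      by_cases h : j = k <;> simp [h]
  have h2 : evalR x (expLap (imPart iPt.1) (1 : MvPolynomial ((Fin b ⊕ Fin 2) × Fin 2) ℂ)) = 1 := by
    rw [expLap, evalR]
    simp
  rw [coordTerm, h2, one_mul, gaussProd, ← Complex.exp_sum, Complex.ofReal_exp, Fintype.sum_prod_type]
  congr 1
  push_cast
  rw [Finset.mul_sum]
  refine Finset.sum_congr rfl fun i _ => ?_
  simp only [quadVal, h1, Fin.sum_univ_two, Matrix.smul_apply, Matrix.one_apply, smul_eq_mul]
  simp
  linear_combination (Real.pi * (x (i, 0) ^ 2 + x (i, 1) ^ 2) : ℂ) * Complex.I_sq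

theorem thetaTerm_one_iPt (he : IsSignatureBasis q e) (v : Fin 2 → ℝ ⊗[ℤ] L) :
    thetaTerm q e 1 iPt 0 0 1 v =
      ((Real.exp (-Real.pi * ∑ p, coord e 1 v p ^ 2) : ℝ) : ℂ) := by
  rw [thetaTerm_eq he (one_mem _), coordTerm_one_iPt, add_zero]
  simp [trForm, expi]

/-- For α in (L')² and β = 0 the character of the theta series depends on the summation vector only
through its class. -/
theorem thetaTerm_char (he : IsSignatureBasis q e) (μ v : Fin 2 → dual q) :
    thetaTerm q e 1 iPt (fun j => (μ j : ℝ ⊗[ℤ] L)) 0 1 (fun j => (v j : ℝ ⊗[ℤ] L)) =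
      discPair q (cls q v) (cls q μ) * thetaTerm q e 1 iPt 0 0 1 fun j => (v j : ℝ ⊗[ℤ] L) := by
  rw [thetaTerm_eq he (one_mem _), thetaTerm_eq he (one_mem _), discPair_cls_eq, smul_zero, add_zero,
    mul_comm, Complex.ofReal_neg]
  congr 1
  simp [trForm, expi]

variable [Module.Free ℤ L] [Module.Finite ℤ L]

/-- At τ = i the summands are values of a real Gaussian, so the series has positive terms over a
nonempty coset. -/
theorem thetaSeries_one_iPt_ne_zero (he : IsSignatureBasis q e) (γ : Fin 2 → Disc q) :
    thetaSeries q e 1 iPt 0 0 1 γ ≠ 0 := by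
  obtain ⟨w, hw⟩ := cls_surjective γ
  have hsum := (summable_thetaTerm he (one_mem (SOV q)) 1 iPt 0 0).subtype {v | cls q v = γ}
  have hsum' : Summable fun v : {v : Fin 2 → dual q // cls q v = γ} =>
      Real.exp (-Real.pi * ∑ p, coord e 1 (fun j => (v.1 j : ℝ ⊗[ℤ] L)) p ^ 2) := by
    rw [← Complex.summable_ofReal]
    exact hsum.congr fun v => thetaTerm_one_iPt he _
  have hpos := hsum'.tsum_pos (fun v => (Real.exp_pos _).le) ⟨w, hw⟩ (Real.exp_pos _)
  rw [thetaSeries]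
  simp only [thetaTerm_one_iPt he]
  rw [← Complex.ofReal_tsum, Complex.ofReal_ne_zero]
  exact hpos.ne'

/-- The dual of L' is again L. This biduality gives the nondegeneracy of the discriminant pairing.
-/
theorem mem_lat_of_forall_int (he : IsSignatureBasis q e) {x : ℝ ⊗[ℤ] L}
    (h : ∀ y ∈ dual q, ∃ n : ℤ, form q y x = n) : x ∈ lat L := by
  obtain ⟨cV, dV, bL, bD, hL, hD, hdual⟩ := exists_dual_bases he
  have h1 : ∀ k, ∃ n : ℤ, cV.repr x k = n := by
    intro k
    obtain ⟨n, hn⟩ := h (dV k) (by rw [← hD]; exact (bD k).2)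
    refine ⟨n, ?_⟩
    rw [← hn]
    conv_rhs => rw [← cV.sum_repr x]
    simp only [map_sum, map_smul, hdual, smul_eq_mul, mul_ite, mul_one, mul_zero, Finset.sum_ite_eq,
      Finset.mem_univ, if_true]
  choose n hn using h1
  rw [← cV.sum_repr x]
  refine Submodule.sum_mem _ fun k _ => ?_
  rw [hn, ← hL, Int.cast_smul_eq_zsmul]
  exact Submodule.smul_mem _ _ (bL k).2

/-- The characters of the pairs in the discriminant group. -/
def discChar (q : QuadraticForm ℤ L) (γ : Fin 2 → Disc q) : AddChar (Fin 2 → Disc q) ℂ where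
  toFun δ := discPair q γ δ
  map_zero_eq_one' := by
    obtain ⟨v, rfl⟩ := cls_surjective γ
    have h0 : (0 : Fin 2 → Disc q) = cls q 0 := by
      funext j
      exact (Submodule.Quotient.mk_zero _).symm
    rw [h0, discPair_cls_eq]
    simp [trForm, expi]
  map_add_eq_mul' δ ε := by
    obtain ⟨v, rfl⟩ := cls_surjective γ
    obtain ⟨w, rfl⟩ := cls_surjective δ
    obtain ⟨u, rfl⟩ := cls_surjective ε
    have h0 : cls q w + cls q u = cls q (w + u) := by
      funext j
      exact (Submodule.Quotient.mk_add _).symm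
    rw [h0, discPair_cls_eq, discPair_cls_eq, discPair_cls_eq, ← expi_add, ← Complex.ofReal_add]
    congr 2
    have h1 : (fun j => (((w + u) j : dual q) : ℝ ⊗[ℤ] L)) =
        (fun j => (w j : ℝ ⊗[ℤ] L)) + fun j => (u j : ℝ ⊗[ℤ] L) := rfl
    rw [h1, trForm_add_right]
    ring

theorem discChar_injective (he : IsSignatureBasis q e) : Function.Injective (discChar q) := by
  intro γ γ' h
  obtain ⟨v, rfl⟩ := cls_surjective γ
  obtain ⟨v', rfl⟩ := cls_surjective γ'
  funext j
  refine (Submodule.Quotient.eq _).2 (mem_lat_of_forall_int he fun y hy => ?_)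
  have h1 : discPair q (cls q v) (cls q (Pi.single j ⟨y, hy⟩)) =
      discPair q (cls q v') (cls q (Pi.single j ⟨y, hy⟩)) :=
    congrArg (fun χ : AddChar (Fin 2 → Disc q) ℂ => χ (cls q (Pi.single j ⟨y, hy⟩))) h
  have h2 : ∀ v : Fin 2 → dual q, trForm q (fun k => (v k : ℝ ⊗[ℤ] L))
      (fun k => ((Pi.single j ⟨y, hy⟩ : Fin 2 → dual q) k : ℝ ⊗[ℤ] L)) = form q (v j) y := by
    intro v
    rw [trForm, Finset.sum_eq_single j]
    · rw [Pi.single_eq_same]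
    · intro k _ hk
      rw [Pi.single_eq_of_ne hk, Submodule.coe_zero, map_zero]
    · simp
  rw [discPair_cls_eq, discPair_cls_eq, h2, h2, expi, expi, Complex.exp_eq_exp_iff_exists_int] at h1
  obtain ⟨n, hn⟩ := h1
  refine ⟨-n, ?_⟩
  have hpi : (2 * Real.pi * Complex.I : ℂ) ≠ 0 := Complex.two_pi_I_ne_zero
  have h3 : ((-form q (v j) y : ℝ) : ℂ) = ((-form q (v' j) y : ℝ) : ℂ) + n := by
    apply mul_left_cancel₀ hpi
    rw [hn]
    ring
  have h4 : -form q (v j) y = -form q (v' j) y + n := by exact_mod_cast h3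
  rw [form_symm, map_sub, map_sub, LinearMap.sub_apply, Submodule.subtype_apply,
    Submodule.subtype_apply]
  push_cast
  linarith

/-- The theta functions attached to the constant polynomial span the group algebra. -/
theorem span_theta_eq_top [Fintype (Disc q)] (he : IsSignatureBasis q e) :
    Submodule.span ℂ (Set.range fun p : HH2 × (Fin 2 → ℝ ⊗[ℤ] L) × (Fin 2 → ℝ ⊗[ℤ] L) =>
      theta q e 1 0 p.1 p.2.1 p.2.2 1) = ⊤ := by
  classical
  by_contra hne
  obtain ⟨f, hf0, hf⟩ := Submodule.exists_le_ker_of_lt_top _ (lt_top_iff_ne_top.2 hne)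
  apply hf0
  have hlin : LinearIndependent ℂ fun γ => (discChar q γ : (Fin 2 → Disc q) → ℂ) :=
    (AddChar.linearIndependent (Fin 2 → Disc q) ℂ).comp _ (discChar_injective he)
  have hdet : (imPart iPt.1).det ^ (1 + 0) ≠ 0 := pow_ne_zero _ iPt.2.2.det_pos.ne'
  set a : (Fin 2 → Disc q) → ℂ := theta q e 1 0 iPt 0 0 1 with ha
  have ha0 : ∀ γ, a γ ≠ 0 := fun γ =>
    mul_ne_zero (Complex.ofReal_ne_zero.2 hdet) (thetaSeries_one_iPt_ne_zero he γ)
  have hexpand : ∀ F, f F = ∑ γ, F γ * f (Pi.single γ 1) := by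
    intro F
    conv_lhs => rw [← Finset.univ_sum_single F]
    rw [map_sum]
    refine Finset.sum_congr rfl fun γ _ => ?_
    rw [← smul_eq_mul, ← map_smul, ← Pi.single_smul, smul_eq_mul, mul_one]
  -- A functional that kills the theta vectors for all α = μ in (L')² yields a linear relation
  -- between the characters of D_L²; since every `a γ` is nonzero, the functional vanishes.
  have hz : ∑ γ, (a γ * f (Pi.single γ 1)) • (discChar q γ : (Fin 2 → Disc q) → ℂ) = 0 := by
    funext δ
    obtain ⟨μ, rfl⟩ := cls_surjective δ
    have h1 : f (theta q e 1 0 iPt (fun j => (μ j : ℝ ⊗[ℤ] L)) 0 1) = 0 :=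
      hf (Submodule.subset_span ⟨(iPt, (fun j => (μ j : ℝ ⊗[ℤ] L)), 0), rfl⟩)
    rw [hexpand] at h1
    rw [Finset.sum_apply, Pi.zero_apply, ← h1]
    refine Finset.sum_congr rfl fun γ _ => ?_
    have h2 : theta q e 1 0 iPt (fun j => (μ j : ℝ ⊗[ℤ] L)) 0 1 γ =
        discPair q γ (cls q μ) * a γ := by
      rw [ha, theta_apply, theta_apply, mul_left_comm]
      congr 1
      rw [thetaSeries, thetaSeries, ← tsum_mul_left]
      exact tsum_congr fun v => by rw [thetaTerm_char he, v.2]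
    rw [h2, Pi.smul_apply, smul_eq_mul]
    change _ * discPair q γ (cls q μ) = _
    ring
  have hz' := Fintype.linearIndependent_iff.1 hlin _ hz
  apply LinearMap.ext
  intro F
  rw [hexpand, LinearMap.zero_apply]
  refine Finset.sum_eq_zero fun γ _ => ?_
  rw [(mul_eq_zero.1 (hz' γ)).resolve_left (ha0 γ), mul_zero]

end Span

/-! ### Existence and uniqueness of the Weil representation -/

section Existence

variable {L : Type*} [AddCommGroup L] {q : QuadraticForm ℤ L} {b : ℕ}
  {e : Module.Basis (Fin b ⊕ Fin 2) ℝ (ℝ ⊗[ℤ] L)}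

/-- The parameters (α, β) transform like a column vector under M, so they carry a left action
compatible with that on τ. -/
theorem char_mul (M N : Sp4Z) {V : Type*} [AddCommGroup V] (α β : Fin 2 → V) :
    rmul α (blkA (M * N))ᵀ + rmul β (blkB (M * N))ᵀ =
      rmul (rmul α (blkA N)ᵀ + rmul β (blkB N)ᵀ) (blkA M)ᵀ +
        rmul (rmul α (blkC N)ᵀ + rmul β (blkD N)ᵀ) (blkB M)ᵀ ∧
    rmul α (blkC (M * N))ᵀ + rmul β (blkD (M * N))ᵀ =
      rmul (rmul α (blkA N)ᵀ + rmul β (blkB N)ᵀ) (blkC M)ᵀ +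
        rmul (rmul α (blkC N)ᵀ + rmul β (blkD N)ᵀ) (blkD M)ᵀ := by
  obtain ⟨h1, h2, h3, h4⟩ := blk_mul M N
  rw [h1, h2, h3, h4]
  simp only [add_rmul, rmul_mul, Matrix.transpose_add, Matrix.transpose_mul, rmul_add]
  constructor <;> abel

theorem char_one {V : Type*} [AddCommGroup V] (α β : Fin 2 → V) :
    rmul α (blkA 1)ᵀ + rmul β (blkB 1)ᵀ = α ∧ rmul α (blkC 1)ᵀ + rmul β (blkD 1)ᵀ = β := by
  obtain ⟨h1, h2, h3, h4⟩ := blk_of_eq (1 : Sp4Z) (A := 1) (B := 0) (C := 0) (D := 1)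
    Matrix.fromBlocks_one.symm
  rw [h1, h2, h3, h4, Matrix.transpose_zero, Matrix.transpose_one, rmul_one, rmul_zero, rmul_one,
    rmul_zero]
  simp

theorem Transforms.one : Transforms q e 1 1 := by
  intro mpos mneg P hP α β g hg τ
  have h1 : (1 : Mp4Z).mat = 1 := rfl
  have h2 : (1 : Mp4Z).root τ = 1 := rfl
  rw [h1, h2, act_one, (char_one α β).1, (char_one α β).2, one_zpow, one_smul, Module.End.one_apply]

/-- The weight exponent is an integral power of the root, and roots multiply as a cocycle by
definition of the metaplectic product. -/
theorem Transforms.mul {γ δ : Mp4Z} {R S : Module.End ℂ ((Fin 2 → Disc q) → ℂ)}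
    (hγ : Transforms q e γ R) (hδ : Transforms q e δ S) : Transforms q e (γ * δ) (R * S) := by
  intro mpos mneg P hP α β g hg τ
  rw [Mp4Z.mat_mul, act_mul, (char_mul γ.mat δ.mat α β).1, (char_mul γ.mat δ.mat α β).2,
    hγ mpos mneg P hP _ _ g hg, hδ mpos mneg P hP _ _ g hg, Mp4Z.root_mul, map_smul, smul_smul,
    mul_zpow, Module.End.mul_apply]

theorem Transforms.inv {γ : Mp4Z} {R S : Module.End ℂ ((Fin 2 → Disc q) → ℂ)}
    (hγ : Transforms q e γ R) (h : S * R = 1) : Transforms q e γ⁻¹ S := by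
  intro mpos mneg P hP α β g hg τ
  have h1 := hγ mpos mneg P hP (rmul α (blkA γ⁻¹.mat)ᵀ + rmul β (blkB γ⁻¹.mat)ᵀ)
    (rmul α (blkC γ⁻¹.mat)ᵀ + rmul β (blkD γ⁻¹.mat)ᵀ) g hg (act γ⁻¹.mat τ)
  rw [← (char_mul γ.mat γ⁻¹.mat α β).1, ← (char_mul γ.mat γ⁻¹.mat α β).2, ← act_mul,
    ← Mp4Z.mat_mul, mul_inv_cancel] at h1
  have h2 : (1 : Mp4Z).mat = 1 := rfl
  have h3 : γ⁻¹.root τ = (γ.root (act γ⁻¹.mat τ))⁻¹ := rfl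
  rw [h2, act_one, (char_one α β).1, (char_one α β).2] at h1
  rw [h1, h3, map_smul, ← Module.End.mul_apply, h, Module.End.one_apply, smul_smul, inv_zpow,
    inv_mul_cancel₀ (zpow_ne_zero _ (γ.root_ne_zero _)), one_smul]

variable [Module.Free ℤ L] [Module.Finite ℤ L] [Fintype (Disc q)]

/-- The operators agree on the theta vectors with P = 1 and g = 1, which span. -/
theorem Transforms.unique (he : IsSignatureBasis q e) {γ : Mp4Z}
    {R S : Module.End ℂ ((Fin 2 → Disc q) → ℂ)} (hR : Transforms q e γ R)
    (hS : Transforms q e γ S) : R = S := by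
  refine LinearMap.ext_on (span_theta_eq_top he) ?_
  rintro _ ⟨⟨τ, α, β⟩, rfl⟩
  have h1 := hR 0 0 1 isVeryHomogeneous_one α β 1 (one_mem _) τ
  rw [hS 0 0 1 isVeryHomogeneous_one α β 1 (one_mem _) τ] at h1
  exact (smul_right_injective _ (zpow_ne_zero _ (γ.root_ne_zero τ)) h1).symm

/-- Each theta vector at (τ, α, β) is, up to a nonzero scalar, the image under R of the theta vector
at the point moved by γ⁻¹. Hence R is onto and, in finite dimension, bijective. -/
theorem Transforms.exists_left_inverse (he : IsSignatureBasis q e) {γ : Mp4Z}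
    {R : Module.End ℂ ((Fin 2 → Disc q) → ℂ)} (hR : Transforms q e γ R) : ∃ S, S * R = 1 := by
  have hsurj : Function.Surjective R := by
    rw [← LinearMap.range_eq_top, eq_top_iff, ← span_theta_eq_top he, Submodule.span_le]
    rintro _ ⟨⟨τ, α, β⟩, rfl⟩
    have h1 := hR 0 0 1 isVeryHomogeneous_one (rmul α (blkA γ⁻¹.mat)ᵀ + rmul β (blkB γ⁻¹.mat)ᵀ)
      (rmul α (blkC γ⁻¹.mat)ᵀ + rmul β (blkD γ⁻¹.mat)ᵀ) 1 (one_mem _) (act γ⁻¹.mat τ)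
    have h2 : (1 : Mp4Z).mat = 1 := rfl
    rw [← (char_mul γ.mat γ⁻¹.mat α β).1, ← (char_mul γ.mat γ⁻¹.mat α β).2, ← act_mul,
      ← Mp4Z.mat_mul, mul_inv_cancel, h2, act_one, (char_one α β).1, (char_one α β).2,
      ← map_smul] at h1
    exact ⟨_, h1.symm⟩
  have hinj := LinearMap.injective_iff_surjective.2 hsurj
  refine ⟨(LinearEquiv.ofBijective R ⟨hinj, hsurj⟩).symm.toLinearMap, LinearMap.ext fun x => ?_⟩
  exact (LinearEquiv.ofBijective R ⟨hinj, hsurj⟩).symm_apply_apply x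

/-- The induction closes under inverses only because the operators are invertible, which is again a
consequence of the spanning property. -/
theorem exists_transforms (he : IsSignatureBasis q e) (γ : Mp4Z) : ∃ R, Transforms q e γ R := by
  have hγ : γ ∈ Subgroup.closure mpGens := closure_mpGens ▸ Subgroup.mem_top γ
  induction hγ using Subgroup.closure_induction with
  | mem γ h =>
    rcases h with ⟨A, rfl⟩ | ⟨B, hB, rfl⟩ | rfl
    · exact ⟨_, transforms_mkDiag he A⟩
    · exact ⟨_, transforms_mkT he B hB⟩
    · exact ⟨_, transforms_mkS he⟩
  | one => exact ⟨_, Transforms.one⟩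
  | mul γ δ _ _ hγ hδ =>
    obtain ⟨R, hR⟩ := hγ
    obtain ⟨S, hS⟩ := hδ
    exact ⟨_, hR.mul hS⟩
  | inv γ _ hγ =>
    obtain ⟨R, hR⟩ := hγ
    obtain ⟨S, hS⟩ := hR.exists_left_inverse he
    exact ⟨S, hR.inv hS⟩

/-- The Weil representation, as it acts on the theta functions. -/
def weilRep (he : IsSignatureBasis q e) : Representation ℂ Mp4Z ((Fin 2 → Disc q) → ℂ) where
  toFun γ := (exists_transforms he γ).choose
  map_one' := (exists_transforms he 1).choose_spec.unique he Transforms.one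
  map_mul' γ δ := (exists_transforms he (γ * δ)).choose_spec.unique he
    ((exists_transforms he γ).choose_spec.mul (exists_transforms he δ).choose_spec)

theorem weilRep_transforms (he : IsSignatureBasis q e) (γ : Mp4Z) :
    Transforms q e γ (weilRep he γ) := (exists_transforms he γ).choose_spec

theorem weilRep_isWeilRepresentation (he : IsSignatureBasis q e) :
    IsWeilRepresentation q b 2 (weilRep he) where
  diag A γ := by
    rw [(weilRep_transforms he _).unique he (transforms_mkDiag he A), opDiag_basisVec]
  trans B hB γ := by
    rw [(weilRep_transforms he _).unique he (transforms_mkT he B hB), opT_basisVec]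
  inversion γ := by
    rw [(weilRep_transforms he _).unique he (transforms_mkS he), opS_basisVec]

-- A homomorphism is determined by its values on generators, and each operator by its values on the
-- standard basis.
omit [Module.Free ℤ L] [Module.Finite ℤ L] in
theorem IsWeilRepresentation.unique {ρ ρ' : Representation ℂ Mp4Z ((Fin 2 → Disc q) → ℂ)}
    (h : IsWeilRepresentation q b 2 ρ) (h' : IsWeilRepresentation q b 2 ρ') : ρ = ρ' := by
  refine MonoidHom.eq_of_eqOn_dense closure_mpGens ?_
  rintro _ (⟨A, rfl⟩ | ⟨B, hB, rfl⟩ | rfl)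
  · exact End_ext_basisVec fun γ => by rw [h.diag, h'.diag]
  · exact End_ext_basisVec fun γ => by rw [h.trans, h'.trans]
  · exact End_ext_basisVec fun γ => by rw [h.inversion, h'.inversion]

end Existence

end

end SiegelTheta

theorem mainTheorem10 {L : Type*} [AddCommGroup L] [Module.Free ℤ L] [Module.Finite ℤ L]
    (q : QuadraticForm ℤ L) (b : ℕ) (hb : 0 < b)
    (e : Module.Basis (Fin b ⊕ Fin 2) ℝ (ℝ ⊗[ℤ] L)) (he : SiegelTheta.IsSignatureBasis q e) :
    (∃! ρ : Representation ℂ SiegelTheta.Mp4Z ((Fin 2 → SiegelTheta.Disc q) → ℂ),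
      SiegelTheta.IsWeilRepresentation q b 2 ρ) ∧
    ∀ (mpos mneg : ℕ) (P : MvPolynomial ((Fin b ⊕ Fin 2) × Fin 2) ℂ),
      SiegelTheta.IsVeryHomogeneous P mpos mneg →
      ∀ (α β : Fin 2 → ℝ ⊗[ℤ] L), ∀ g ∈ SiegelTheta.SOV q, ∀ τ : SiegelTheta.HH2,
        (∀ δ : Fin 2 → SiegelTheta.Disc q,
          Summable fun v : {v : Fin 2 → SiegelTheta.dual q // SiegelTheta.cls q v = δ} =>
            SiegelTheta.thetaTerm q e P τ α β g (fun j => (v.1 j : ℝ ⊗[ℤ] L))) ∧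
        ∀ ρ : Representation ℂ SiegelTheta.Mp4Z ((Fin 2 → SiegelTheta.Disc q) → ℂ),
          SiegelTheta.IsWeilRepresentation q b 2 ρ →
          ∀ γ : SiegelTheta.Mp4Z,
            SiegelTheta.theta q e P mneg (SiegelTheta.act γ.mat τ)
                (SiegelTheta.rmul α (SiegelTheta.blkA γ.mat)ᵀ +
                  SiegelTheta.rmul β (SiegelTheta.blkB γ.mat)ᵀ)
                (SiegelTheta.rmul α (SiegelTheta.blkC γ.mat)ᵀ +
                  SiegelTheta.rmul β (SiegelTheta.blkD γ.mat)ᵀ) g =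
              γ.root τ ^ ((b : ℤ) - 2 + 2 * (mpos : ℤ) - 2 * (mneg : ℤ)) •
                ρ γ (SiegelTheta.theta q e P mneg τ α β g) := by
  have : Finite (SiegelTheta.Disc q) := SiegelTheta.finite_disc q (SiegelTheta.form_nondegenerate he)
  have := Fintype.ofFinite (SiegelTheta.Disc q)
  have hweil := SiegelTheta.weilRep_isWeilRepresentation he
  refine ⟨⟨SiegelTheta.weilRep he, hweil, fun ρ hρ => hρ.unique hweil⟩, ?_⟩
  intro mpos mneg P hP α β g hg τ
  refine ⟨fun δ => (SiegelTheta.summable_thetaTerm he hg P τ α β).subtype _, ?_⟩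
  intro ρ hρ γ
  -- By uniqueness an arbitrary Weil representation is `weilRep`, for which the law holds by
  -- construction.
  rw [hρ.unique hweil]
  exact SiegelTheta.weilRep_transforms he γ mpos mneg P hP α β g hg τ
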